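/- Let $k$ be an algebraically closed field of characteristic $0$ with a fixed compatible family of primitive roots of unity $\xi_m\in k$ ($m\ge 1$, $\xi_{\ell m}^{\ell}=\xi_m$). Let $\mathcal R=(k[t,t^{-1}],\frac{d}{dt})$ and $\widehat{\mathcal S}=(k[t^q\mid q\in\mathbb Q],\frac{d}{dt})$. For a commutative $k$-algebra $R$ with a $k$-linear derivation $\delta$, an $(R,\delta)$-conformal superalgebra is an $R$-module $\mathcal A=\mathcal A_{\bar 0}\oplus\mathcal A_{\bar 1}$ with a parity-preserving $k$-linear map $\partial$ and $k$-bilinear products $a_{(n)}b$, $n\ge 0$, such that $a_{(n)}b=0$ for $n\gg0$; $(\partial a)_{(n)}b=-n\,a_{(n-1)}b$; $a_{(n)}\partial b=\partial(a_{(n)}b)+n\,a_{(n-1)}b$; $\partial(ra)=r\,\partial a+\delta(r)a$; $a_{(n)}(rb)=r(a_{(n)}b)$; and $(ra)_{(n)}b=\sum_{j\ge0}\frac{1}{j!}\delta^j(r)\,(a_{(n+j)}b)$. Isomorphisms are $R$-linear bijections that preserve parity, $\partial$ and all products. A $k$-conformal superalgebra is one over $(k,0)$; every $(R,\delta)$-conformal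 superalgebra is one by restriction of scalars. For an extension $(R,\delta_R)\to(S,\delta_S)$ of differential $k$-algebras, the base change $\mathcal A\otimes_R S$ has $\partial(a\otimes s)=\partial a\otimes s+a\otimes\delta_S(s)$ and $(a\otimes r)_{(n)}(b\otimes s)=\sum_{j\ge0}(a_{(n+j)}b)\otimes\frac{1}{j!}\delta_S^j(r)s$. For a $k$-conformal superalgebra $\mathcal A$ and an automorphism $\sigma$ of $\mathcal A$ with $\sigma^m=\mathrm{id}$, $m\ge1$, the twisted loop algebra is $$L(\mathcal A,\sigma)=\bigoplus_{i\in\mathbb Z}\{a\in\mathcal A\mid\sigma(a)=\xi_m^i a\}\otimes t^{i/m}\subseteq\mathcal A\otimes_k k[t^q\mid q\in\mathbb Q],$$ which is an $\mathcal R$-conformal, hence also a $k$-conformal, superalgebra. An $\widehat{\mathcal S}/\mathcal R$-form of $\mathcal A$ is an $\mathcal R$-conformal superalgebra $\mathcal F$ with $\mathcal F\otimes_{\mathcal R}\widehat{\mathcal S}\cong(\mathcal A\otimes_k\mathcal R)\otimes_{\mathcal R}\widehat{\mathcal S}$ as $\widehat{\mathcal S}$-conformal superalgebras. Let $\mathcal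 A$ be the classical $N=2$ $k$-conformal superalgebra: the free $k[\partial]$-module on the even elements $L,J$ and the odd elements $G^+,G^-$ with the Lie conformal superalgebra structure given, in terms of $[a_\lambda b]=\sum_n\frac{\lambda^n}{n!}a_{(n)}b$, by $[L_\lambda L]=(\partial+2\lambda)L$, $[L_\lambda J]=(\partial+\lambda)J$, $[L_\lambda G^\pm]=(\partial+\tfrac32\lambda)G^\pm$, $[J_\lambda J]=0$, $[J_\lambda G^\pm]=\pm G^\pm$, $[G^\pm{}_\lambda G^\pm]=0$, $[G^+{}_\lambda G^-]=L+\tfrac12(\partial+2\lambda)J$, the remaining brackets being determined by skew-symmetry and sesquilinearity. Let $\omega$ be the automorphism of $\mathcal A$ (of order $2$) with $L\mapsto L$, $J\mapsto-J$, $G^\pm\mapsto G^\mp$. **Theorem.** Up to $k$-conformal isomorphism there are exactly two twisted loop algebras of $\mathcal A$, namely $L(\mathcal A,\mathrm{id})$ and $L(\mathcal A,\omega)$: every $L(\mathcal A,\sigma)$ with $\sigma$ of finite order is isomorphic to one of them as a $k$-conformal superalgebra, and these two are not isomorphic as $k$-conformal superalgebras. Furthermore, every $\widehat{\mathcal S}/\mathcal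 R$-form of $\mathcal A$ is isomorphic, as an $\mathcal R$-conformal superalgebra, to $L(\mathcal A,\mathrm{id})$ or to $L(\mathcal A,\omega)$. -/

import Mathlib

open scoped TensorProduct

noncomputable section

/-- The divided power `T^{(j)} = T^j / j!` of a linear endomorphism. -/
def dividedPow {k V : Type*} [Field k] [AddCommGroup V] [Module k V]
    (T : V →ₗ[k] V) (j : ℕ) : V →ₗ[k] V :=
  ((j.factorial : k)⁻¹) • T ^ j

/-- An `(R, δ)`-conformal superalgebra structure on the `R`-module `A`, where `(R, δ)` is a
commutative `k`-algebra with a `k`-linear derivation. -/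
structure ConformalSuperalgebra (k : Type*) [Field k] {R : Type*} [CommRing R] [Algebra k R]
    (δ : Derivation k R R) (A : Type*) [AddCommGroup A] [Module k A] [Module R A]
    [IsScalarTower k R A] where
  /-- The even part. -/
  even : Submodule R A
  /-- The odd part. -/
  odd : Submodule R A
  /-- `A` is the direct sum of its even and odd parts. -/
  isCompl : IsCompl even odd
  /-- The derivation `∂`. -/
  der : A →ₗ[k] A
  der_even : ∀ a ∈ even, der a ∈ even
  der_odd : ∀ a ∈ odd, der a ∈ odd
  /-- The `n`-products `a_(n) b`. -/
  prod : ℕ → A →ₗ[k] A →ₗ[k] A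
  /-- (CS0) -/
  prod_eventually_zero : ∀ a b, ∃ N, ∀ n, N ≤ n → prod n a b = 0
  /-- (CS1), first half. -/
  der_prod : ∀ n a b, prod n (der a) b = -((n : k) • prod (n - 1) a b)
  /-- (CS1), second half. -/
  prod_der : ∀ n a b,
    prod n a (der b) = der (prod n a b) + (n : k) • prod (n - 1) a b
  /-- (CS2) -/
  der_smul : ∀ (r : R) a, der (r • a) = r • der a + δ r • a
  /-- (CS3), first half. -/
  prod_smul : ∀ n (r : R) a b, prod n a (r • b) = r • prod n a b
  /-- (CS3), second half; by (CS0) only finitely many terms are nonzero. -/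
  smul_prod : ∀ n (r : R) a b,
    prod n (r • a) b = ∑ᶠ j : ℕ, dividedPow (δ : R →ₗ[k] R) j r • prod (n + j) a b

/-- An isomorphism of `(R, δ)`-conformal superalgebras. -/
structure ConformalEquiv {k : Type*} [Field k] {R : Type*} [CommRing R] [Algebra k R]
    {δ : Derivation k R R}
    {A : Type*} [AddCommGroup A] [Module k A] [Module R A] [IsScalarTower k R A]
    {B : Type*} [AddCommGroup B] [Module k B] [Module R B] [IsScalarTower k R B]
    (SA : ConformalSuperalgebra k δ A) (SB : ConformalSuperalgebra k δ B)
    extends A ≃ₗ[R] B where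
  map_even : ∀ a ∈ SA.even, toFun a ∈ SB.even
  map_odd : ∀ a ∈ SA.odd, toFun a ∈ SB.odd
  map_prod : ∀ n a b, toFun (SA.prod n a b) = SB.prod n (toFun a) (toFun b)
  map_der : ∀ a, toFun (SA.der a) = SB.der (toFun a)

namespace ConformalSuperalgebra

section Aux

variable {k : Type*} [Field k]

lemma finsum_eq_range {M : Type*} [AddCommMonoid M] (f : ℕ → M) (N : ℕ)
    (h : ∀ n, N ≤ n → f n = 0) : ∑ᶠ j, f j = ∑ j ∈ Finset.range N, f j := by
  apply finsum_eq_sum_of_support_subset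
  intro j hj
  simp only [Finset.coe_range, Set.mem_Iio]
  by_contra hc
  exact hj (h j (not_lt.mp hc))

lemma dividedPow_zero {V : Type*} [AddCommGroup V] [Module k V] (T : V →ₗ[k] V) (v : V) :
    dividedPow T 0 v = v := by
  simp [dividedPow]

lemma apply_dividedPow [CharZero k] {V : Type*} [AddCommGroup V] [Module k V] (T : V →ₗ[k] V)
    (j : ℕ) (v : V) : T (dividedPow T j v) = ((j + 1 : ℕ) : k) • dividedPow T (j + 1) v := by
  have h : ((j.factorial : ℕ) : k) ≠ 0 := by exact_mod_cast j.factorial_ne_zero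
  have h' : ((j + 1 : ℕ) : k) ≠ 0 := by exact_mod_cast j.succ_ne_zero
  simp only [dividedPow, LinearMap.smul_apply, map_smul, smul_smul, Nat.factorial_succ,
    Nat.cast_mul, pow_succ', Module.End.mul_apply]
  congr 1
  field_simp

lemma dividedPow_apply [CharZero k] {V : Type*} [AddCommGroup V] [Module k V] (T : V →ₗ[k] V)
    (j : ℕ) (v : V) : dividedPow T j (T v) = ((j + 1 : ℕ) : k) • dividedPow T (j + 1) v := by
  rw [← apply_dividedPow]
  simp only [dividedPow, LinearMap.smul_apply, map_smul]
  rw [← Module.End.mul_apply, ← Module.End.mul_apply, ← pow_succ, ← pow_succ']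

lemma dividedPow_mul [CharZero k] {R : Type*} [CommRing R] [Algebra k R] (δ : Derivation k R R)
    (j : ℕ) (r s : R) : dividedPow (δ : R →ₗ[k] R) j (r * s) =
      ∑ p ∈ Finset.HasAntidiagonal.antidiagonal j,
        dividedPow (δ : R →ₗ[k] R) p.1 r * dividedPow (δ : R →ₗ[k] R) p.2 s := by
  induction j with
  | zero => simp [dividedPow_zero]
  | succ j ih =>
    have h' : ((j + 1 : ℕ) : k) ≠ 0 := by exact_mod_cast j.succ_ne_zero
    apply smul_right_injective R h'
    simp only
    rw [← apply_dividedPow, ih, map_sum]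
    simp only [Derivation.coeFn_coe, Derivation.leibniz, smul_eq_mul]
    have e : ∀ (i : ℕ) (x : R), δ (dividedPow (δ : R →ₗ[k] R) i x) =
        ((i + 1 : ℕ) : k) • dividedPow (δ : R →ₗ[k] R) (i + 1) x :=
      fun i x => apply_dividedPow (δ : R →ₗ[k] R) i x
    simp only [e, Finset.sum_add_distrib]
    have h1 : ∑ p ∈ Finset.HasAntidiagonal.antidiagonal j, dividedPow (δ : R →ₗ[k] R) p.1 r *
        (((p.2 + 1 : ℕ) : k) • dividedPow (δ : R →ₗ[k] R) (p.2 + 1) s) =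
        ∑ p ∈ Finset.HasAntidiagonal.antidiagonal (j + 1), dividedPow (δ : R →ₗ[k] R) p.1 r *
        ((p.2 : k) • dividedPow (δ : R →ₗ[k] R) p.2 s) := by
      rw [Finset.Nat.antidiagonal_succ']
      simp
    have h2 : ∑ p ∈ Finset.HasAntidiagonal.antidiagonal j, dividedPow (δ : R →ₗ[k] R) p.2 s *
        (((p.1 + 1 : ℕ) : k) • dividedPow (δ : R →ₗ[k] R) (p.1 + 1) r) =
        ∑ p ∈ Finset.HasAntidiagonal.antidiagonal (j + 1), dividedPow (δ : R →ₗ[k] R) p.2 s *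
        ((p.1 : k) • dividedPow (δ : R →ₗ[k] R) p.1 r) := by
      rw [Finset.Nat.antidiagonal_succ]
      simp
    rw [h1, h2, ← Finset.sum_add_distrib, Finset.smul_sum]
    apply Finset.sum_congr rfl
    intro p hp
    rw [← Finset.HasAntidiagonal.mem_antidiagonal.mp hp]
    simp only [mul_smul_comm, Nat.cast_add, add_smul]
    rw [mul_comm (dividedPow (δ : R →ₗ[k] R) p.2 s), add_comm]

end Aux

section Ext

variable {k : Type*} [Field k]
  {R : Type*} [CommRing R] [Algebra k R] {δR : Derivation k R R}
  {S : Type*} [CommRing S] [Algebra k S] {δS : Derivation k S S}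
  [Algebra R S] [IsScalarTower k R S]

lemma dividedPow_algebraMap (hδ : ∀ r, δS (algebraMap R S r) = algebraMap R S (δR r)) (j : ℕ)
    (r : R) : dividedPow (δS : S →ₗ[k] S) j (algebraMap R S r) =
      algebraMap R S (dividedPow (δR : R →ₗ[k] R) j r) := by
  have h : ∀ r, ((δS : S →ₗ[k] S) ^ j) (algebraMap R S r) =
      algebraMap R S (((δR : R →ₗ[k] R) ^ j) r) := by
    induction j with
    | zero => simp
    | succ j ih => intro r; simp [pow_succ, hδ, ih]
  simp only [dividedPow, LinearMap.smul_apply, h]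
  exact (map_smul (IsScalarTower.toAlgHom k R S) _ _).symm

/-- Restriction of scalars along an extension `(R, δR) → (S, δS)` of differential rings. -/
def restrict (hδ : ∀ r, δS (algebraMap R S r) = algebraMap R S (δR r))
    {A : Type*} [AddCommGroup A] [Module k A] [Module R A] [Module S A]
    [IsScalarTower k R A] [IsScalarTower k S A] [IsScalarTower R S A]
    (SA : ConformalSuperalgebra k δS A) : ConformalSuperalgebra k δR A where
  even := SA.even.restrictScalars R
  odd := SA.odd.restrictScalars R
  isCompl := by
    have h := SA.isCompl
    refine ⟨?_, ?_⟩
    · rw [Submodule.disjoint_def]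
      exact fun x hx hy => (Submodule.disjoint_def.mp h.disjoint) x hx hy
    · rw [codisjoint_iff, eq_top_iff]
      intro x _
      have hx : x ∈ SA.even ⊔ SA.odd := by rw [h.sup_eq_top]; trivial
      obtain ⟨a, ha, b, hb, rfl⟩ := Submodule.mem_sup.mp hx
      exact Submodule.mem_sup.mpr ⟨a, ha, b, hb, rfl⟩
  der := SA.der
  der_even := SA.der_even
  der_odd := SA.der_odd
  prod := SA.prod
  prod_eventually_zero := SA.prod_eventually_zero
  der_prod := SA.der_prod
  prod_der := SA.prod_der
  der_smul r a := by
    rw [← algebraMap_smul S r a, SA.der_smul, hδ]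
    simp only [algebraMap_smul]
  prod_smul n r a b := by
    rw [← algebraMap_smul S r b, SA.prod_smul]
    simp only [algebraMap_smul]
  smul_prod n r a b := by
    rw [← algebraMap_smul S r a, SA.smul_prod]
    simp only [dividedPow_algebraMap hδ, algebraMap_smul]

/-- The conformal superalgebra structure on a graded submodule that is stable under the
derivation and the `n`-products. -/
def sub {A : Type*} [AddCommGroup A] [Module k A] [Module R A] [IsScalarTower k R A]
    (SA : ConformalSuperalgebra k δR A) (N : Submodule R A)
    (hgr : ∀ x ∈ N, ∃ a ∈ N ⊓ SA.even, ∃ b ∈ N ⊓ SA.odd, a + b = x)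
    (hder : ∀ x ∈ N, SA.der x ∈ N)
    (hprod : ∀ n, ∀ x ∈ N, ∀ y ∈ N, SA.prod n x y ∈ N) :
    ConformalSuperalgebra k δR N where
  even := SA.even.comap N.subtype
  odd := SA.odd.comap N.subtype
  isCompl := by
    refine ⟨?_, ?_⟩
    · rw [Submodule.disjoint_def]
      exact fun x hx hy => Subtype.ext ((Submodule.disjoint_def.mp SA.isCompl.disjoint) x hx hy)
    · rw [codisjoint_iff, eq_top_iff]
      rintro ⟨x, hx⟩ _
      obtain ⟨a, ha, b, hb, rfl⟩ := hgr x hx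
      exact Submodule.mem_sup.mpr ⟨⟨a, ha.1⟩, ha.2, ⟨b, hb.1⟩, hb.2, rfl⟩
  der :=
    { toFun := fun x => ⟨SA.der x, hder x x.2⟩
      map_add' := fun x y => Subtype.ext (by simp)
      map_smul' := fun c x => Subtype.ext (by simp) }
  der_even := fun a ha => SA.der_even a ha
  der_odd := fun a ha => SA.der_odd a ha
  prod n := LinearMap.mk₂ k (fun x y => ⟨SA.prod n x y, hprod n x x.2 y y.2⟩)
    (fun x y z => Subtype.ext (by simp)) (fun c x y => Subtype.ext (by simp))
    (fun x y z => Subtype.ext (by simp)) (fun c x y => Subtype.ext (by simp))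
  prod_eventually_zero a b := by
    obtain ⟨M, hM⟩ := SA.prod_eventually_zero a b
    exact ⟨M, fun n hn => Subtype.ext (hM n hn)⟩
  der_prod n a b := Subtype.ext (SA.der_prod n a b)
  prod_der n a b := Subtype.ext (SA.prod_der n a b)
  der_smul r a := Subtype.ext (SA.der_smul r a)
  prod_smul n r a b := Subtype.ext (SA.prod_smul n r a b)
  smul_prod n r a b := by
    obtain ⟨M, hM⟩ := SA.prod_eventually_zero a b
    apply Subtype.ext
    have h := SA.smul_prod n r a b
    rw [finsum_eq_range _ M (fun j hj => by rw [hM _ (by omega), smul_zero])] at h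
    rw [finsum_eq_range _ M]
    · simpa using h
    · intro j hj
      apply Subtype.ext
      simp [hM (n + j) (by omega)]

end Ext


section BaseChange

variable {k : Type*} [Field k]
  {R : Type*} [CommRing R] [Algebra k R] {δR : Derivation k R R}
  {S : Type*} [CommRing S] [Algebra k S] {δS : Derivation k S S}
  [Algebra R S] [IsScalarTower k R S]
  {A : Type*} [AddCommGroup A] [Module k A] [Module R A] [IsScalarTower k R A]

/-- The derivation `s ⊗ a ↦ δ(s) ⊗ a + s ⊗ ∂(a)` of the base change. -/
def bcDer (hδ : ∀ r, δS (algebraMap R S r) = algebraMap R S (δR r))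
    (SA : ConformalSuperalgebra k δR A) : S ⊗[R] A →ₗ[k] S ⊗[R] A :=
  let f : S ⊗[R] A →+ S ⊗[R] A := TensorProduct.liftAddHom
    (AddMonoidHom.mk' (fun s => AddMonoidHom.mk' (fun a => δS s ⊗ₜ[R] a + s ⊗ₜ[R] SA.der a)
      (fun a b => by simp only [map_add, TensorProduct.tmul_add]; abel))
      (fun s t => by
        ext a
        simp only [map_add, TensorProduct.add_tmul, AddMonoidHom.mk'_apply,
          AddMonoidHom.add_apply]
        abel))
    (fun r s a => by
      simp only [AddMonoidHom.mk'_apply, SA.der_smul, TensorProduct.tmul_add,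
        TensorProduct.tmul_smul, Algebra.smul_def r s, Derivation.leibniz, hδ,
        TensorProduct.add_tmul]
      simp only [← TensorProduct.smul_tmul', ← Algebra.smul_def, smul_eq_mul]
      simp only [mul_comm s, ← Algebra.smul_def, ← TensorProduct.smul_tmul']
      abel)
  { toFun := f
    map_add' := f.map_add
    map_smul' := fun c x => by
      induction x using TensorProduct.induction_on with
      | zero => simp
      | add x y hx hy => simp only [smul_add, map_add, hx, hy]
      | tmul s a =>
        simp [f, TensorProduct.smul_tmul'] }

lemma bcDer_tmul (hδ : ∀ r, δS (algebraMap R S r) = algebraMap R S (δR r))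
    (SA : ConformalSuperalgebra k δR A) (s : S) (a : A) :
    bcDer hδ SA (s ⊗ₜ a) = δS s ⊗ₜ[R] a + s ⊗ₜ[R] SA.der a := rfl

lemma bcDer_smul (hδ : ∀ r, δS (algebraMap R S r) = algebraMap R S (δR r))
    (SA : ConformalSuperalgebra k δR A) (s : S) (x : S ⊗[R] A) :
    bcDer hδ SA (s • x) = s • bcDer hδ SA x + δS s • x := by
  induction x using TensorProduct.induction_on with
  | zero => simp
  | add x y hx hy => simp only [smul_add, map_add, hx, hy]; abel
  | tmul t a =>
    simp only [TensorProduct.smul_tmul', bcDer_tmul, smul_eq_mul, Derivation.leibniz,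
      TensorProduct.add_tmul, smul_add, mul_comm t]
    abel

lemma support_finite (SA : ConformalSuperalgebra k δR A) (δ : S →ₗ[k] S) (n : ℕ) (s : S)
    (a b : A) :
    (Function.support fun j : ℕ => dividedPow δ j s ⊗ₜ[R] SA.prod (n + j) a b).Finite := by
  obtain ⟨M, hM⟩ := SA.prod_eventually_zero a b
  apply (Set.finite_Iio M).subset
  intro j hj
  by_contra hc
  have hc' : M ≤ j := not_lt.mp hc
  exact hj (by simp [hM (n + j) (by omega)])

/-- For fixed `s` and `a`, the `S`-linear operator
`t ⊗ b ↦ ∑_j δ^{(j)}(s) t ⊗ a_(n+j) b`. -/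
def bcOp (δS : Derivation k S S) (SA : ConformalSuperalgebra k δR A) (n : ℕ) (s : S) (a : A) :
    S ⊗[R] A →ₗ[S] S ⊗[R] A :=
  LinearMap.liftBaseChange S
    { toFun := fun b => ∑ᶠ j : ℕ, dividedPow (δS : S →ₗ[k] S) j s ⊗ₜ[R] SA.prod (n + j) a b
      map_add' := fun b c => by
        rw [← finsum_add_distrib (support_finite SA _ n s a b) (support_finite SA _ n s a c)]
        simp only [map_add, TensorProduct.tmul_add]
      map_smul' := fun r b => by
        rw [RingHom.id_apply, smul_finsum' _ (support_finite SA _ n s a b)]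
        simp only [SA.prod_smul, TensorProduct.tmul_smul] }

lemma bcOp_tmul (SA : ConformalSuperalgebra k δR A) (n : ℕ) (s t : S) (a b : A) :
    bcOp δS SA n s a (t ⊗ₜ b) =
      t • ∑ᶠ j : ℕ, dividedPow (δS : S →ₗ[k] S) j s ⊗ₜ[R] SA.prod (n + j) a b :=
  LinearMap.liftBaseChange_tmul ..

lemma bcOp_ext {f g : S ⊗[R] A →ₗ[S] S ⊗[R] A} (h : ∀ b, f (1 ⊗ₜ b) = g (1 ⊗ₜ b)) : f = g := by
  ext b
  exact h b

lemma bcOp_one_tmul_range (SA : ConformalSuperalgebra k δR A) (n : ℕ) (s : S) (a b : A) (M : ℕ)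
    (hM : ∀ m, M ≤ m → SA.prod m a b = 0) :
    bcOp δS SA n s a (1 ⊗ₜ b) =
      ∑ j ∈ Finset.range M, dividedPow (δS : S →ₗ[k] S) j s ⊗ₜ[R] SA.prod (n + j) a b := by
  rw [bcOp_tmul, one_smul, finsum_eq_range _ M]
  intro j hj
  rw [hM _ (by omega), TensorProduct.tmul_zero]

/-- Rearrangement of a double sum with finitely many nonzero terms along antidiagonals. -/
lemma sum_antidiagonal_range {M : Type*} [AddCommMonoid M] (F : ℕ → ℕ → M) (N : ℕ)
    (h : ∀ i j, N ≤ i + j → F i j = 0) :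
    ∑ m ∈ Finset.range N, ∑ p ∈ Finset.HasAntidiagonal.antidiagonal m, F p.1 p.2 =
      ∑ i ∈ Finset.range N, ∑ j ∈ Finset.range N, F i j := by
  rw [← Finset.sum_product', Finset.sum_sigma']
  apply Finset.sum_bij_ne_zero (fun x _ _ => x.2)
  · rintro ⟨m, p⟩ hx _
    simp only [Finset.mem_sigma, Finset.mem_range, Finset.HasAntidiagonal.mem_antidiagonal] at hx
    simp only [Finset.mem_product, Finset.mem_range]
    omega
  · rintro ⟨m, p⟩ hx _ ⟨m', p'⟩ hx' _ heq
    simp only [Finset.mem_sigma, Finset.mem_range, Finset.HasAntidiagonal.mem_antidiagonal]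
      at hx hx' heq
    subst heq
    obtain ⟨_, rfl⟩ := hx
    obtain ⟨_, rfl⟩ := hx'
    rfl
  · rintro ⟨i, j⟩ _ hne
    refine ⟨⟨i + j, (i, j)⟩, ?_, hne, rfl⟩
    simp only [Finset.mem_sigma, Finset.mem_range, Finset.HasAntidiagonal.mem_antidiagonal,
      and_true]
    by_contra hc
    exact hne (h i j (not_lt.mp hc))
  · intros; rfl

lemma bcOp_mul [CharZero k] (SA : ConformalSuperalgebra k δR A) (n : ℕ) (c s : S) (a b : A)
    (M : ℕ) (hM : ∀ m, M ≤ m → SA.prod m a b = 0) :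
    bcOp δS SA n (c * s) a (1 ⊗ₜ b) =
      ∑ i ∈ Finset.range M, dividedPow (δS : S →ₗ[k] S) i c •
        bcOp δS SA (n + i) s a (1 ⊗ₜ b) := by
  rw [bcOp_one_tmul_range SA n _ a b M hM]
  simp only [bcOp_one_tmul_range SA _ s a b M hM, Finset.smul_sum, TensorProduct.smul_tmul',
    smul_eq_mul]
  rw [← sum_antidiagonal_range
    (fun i j => (dividedPow (δS : S →ₗ[k] S) i c * dividedPow (δS : S →ₗ[k] S) j s) ⊗ₜ[R]
      SA.prod (n + i + j) a b) M
    (fun i j hij => by rw [hM _ (by omega), TensorProduct.tmul_zero])]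
  apply Finset.sum_congr rfl
  intro m _
  rw [dividedPow_mul, TensorProduct.sum_tmul]
  apply Finset.sum_congr rfl
  intro p hp
  rw [← Finset.HasAntidiagonal.mem_antidiagonal.mp hp, add_assoc]

lemma bcOp_balanced [CharZero k] (hδ : ∀ r, δS (algebraMap R S r) = algebraMap R S (δR r))
    (SA : ConformalSuperalgebra k δR A) (n : ℕ) (r : R) (s : S) (a : A) :
    bcOp δS SA n (r • s) a = bcOp δS SA n s (r • a) := by
  apply bcOp_ext
  intro b
  obtain ⟨M, hM⟩ := SA.prod_eventually_zero a b
  have hr : ∀ m, SA.prod m (r • a) b =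
      ∑ j ∈ Finset.range M, dividedPow (δR : R →ₗ[k] R) j r • SA.prod (m + j) a b := by
    intro m
    rw [SA.smul_prod, finsum_eq_range _ M]
    intro j hj
    rw [hM _ (by omega), smul_zero]
  have hM' : ∀ m, M ≤ m → SA.prod m (r • a) b = 0 := by
    intro m hm
    rw [hr]
    exact Finset.sum_eq_zero fun j _ => by rw [hM _ (by omega), smul_zero]
  rw [Algebra.smul_def, bcOp_mul SA n _ s a b M hM, bcOp_one_tmul_range SA n s _ b M hM']
  simp only [bcOp_one_tmul_range SA _ s a b M hM, hr, TensorProduct.tmul_sum, Finset.smul_sum]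
  rw [Finset.sum_comm]
  refine Finset.sum_congr rfl fun j _ => Finset.sum_congr rfl fun i _ => ?_
  rw [dividedPow_algebraMap hδ, algebraMap_smul, TensorProduct.tmul_smul, add_right_comm]

lemma bcOp_add_right (SA : ConformalSuperalgebra k δR A) (n : ℕ) (s : S) (a a' : A) :
    bcOp δS SA n s (a + a') = bcOp δS SA n s a + bcOp δS SA n s a' := by
  apply bcOp_ext
  intro b
  simp only [LinearMap.add_apply, bcOp_tmul, one_smul]
  rw [← finsum_add_distrib (support_finite SA _ n s a b) (support_finite SA _ n s a' b)]
  simp only [map_add, LinearMap.add_apply, TensorProduct.tmul_add]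

lemma bcOp_add_left (SA : ConformalSuperalgebra k δR A) (n : ℕ) (s s' : S) (a : A) :
    bcOp δS SA n (s + s') a = bcOp δS SA n s a + bcOp δS SA n s' a := by
  apply bcOp_ext
  intro b
  simp only [LinearMap.add_apply, bcOp_tmul, one_smul]
  rw [← finsum_add_distrib (support_finite SA _ n s a b) (support_finite SA _ n s' a b)]
  simp only [map_add, TensorProduct.add_tmul]

/-- The `n`-product `(s ⊗ a)_(n) (t ⊗ b) = ∑_j δ^{(j)}(s) t ⊗ a_(n+j) b` of the base change. -/
def bcProd [CharZero k] (hδ : ∀ r, δS (algebraMap R S r) = algebraMap R S (δR r))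
    (SA : ConformalSuperalgebra k δR A) (n : ℕ) :
    S ⊗[R] A →ₗ[k] S ⊗[R] A →ₗ[k] S ⊗[R] A :=
  let f : S ⊗[R] A →+ (S ⊗[R] A →ₗ[S] S ⊗[R] A) := TensorProduct.liftAddHom
    { toFun := fun s =>
        { toFun := fun a => bcOp δS SA n s a
          map_zero' := by
            apply bcOp_ext
            intro b
            simp [bcOp_tmul]
          map_add' := bcOp_add_right SA n s }
      map_zero' := by
        ext1 a
        apply bcOp_ext
        intro b
        simp [bcOp_tmul]
      map_add' := fun s s' => by
        ext1 a
        exact bcOp_add_left SA n s s' a }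
    (fun r s a => bcOp_balanced hδ SA n r s a)
  LinearMap.mk₂ k (fun x y => f x y)
    (fun x x' y => by rw [map_add, LinearMap.add_apply])
    (fun c x y => by
      induction x using TensorProduct.induction_on with
      | zero => simp
      | add x x' hx hx' => simp only [smul_add, map_add, LinearMap.add_apply, hx, hx']
      | tmul s a =>
        have : bcOp δS SA n (c • s) a = c • bcOp δS SA n s a := by
          apply bcOp_ext
          intro b
          rw [LinearMap.smul_apply, bcOp_tmul, bcOp_tmul, one_smul, one_smul,
            smul_finsum' _ (support_finite SA _ n s a b)]
          simp only [map_smul, TensorProduct.smul_tmul']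
        exact congrArg (fun g => g y) this)
    (fun x y y' => map_add _ _ _)
    (fun c x y => by
      rw [← algebraMap_smul S c y, map_smul, algebraMap_smul])

lemma bcProd_tmul [CharZero k] (hδ : ∀ r, δS (algebraMap R S r) = algebraMap R S (δR r))
    (SA : ConformalSuperalgebra k δR A) (n : ℕ) (s : S) (a : A) (y : S ⊗[R] A) :
    bcProd hδ SA n (s ⊗ₜ a) y = bcOp δS SA n s a y := rfl

lemma bcProd_smul [CharZero k] (hδ : ∀ r, δS (algebraMap R S r) = algebraMap R S (δR r))
    (SA : ConformalSuperalgebra k δR A) (n : ℕ) (s : S) (x y : S ⊗[R] A) :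
    bcProd hδ SA n x (s • y) = s • bcProd hδ SA n x y := by
  induction x using TensorProduct.induction_on with
  | zero => simp
  | add x x' hx hx' => simp only [map_add, LinearMap.add_apply, hx, hx', smul_add]
  | tmul t a => simp only [bcProd_tmul, map_smul]

lemma tmul_smul_k (c : k) (s : S) (a : A) : s ⊗ₜ[R] (c • a) = c • (s ⊗ₜ[R] a) := by
  rw [← algebraMap_smul R c a, TensorProduct.tmul_smul, algebraMap_smul]

lemma bcOp_shift [CharZero k] (SA : ConformalSuperalgebra k δR A) (n : ℕ) (s : S) (a b : A)
    (M : ℕ) (hM : ∀ m, M ≤ m → SA.prod m a b = 0) :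
    bcOp δS SA n (δS s) a (1 ⊗ₜ b) + (n : k) • bcOp δS SA (n - 1) s a (1 ⊗ₜ b) =
      ∑ j ∈ Finset.range (M + 1), ((n + j : ℕ) : k) •
        (dividedPow (δS : S →ₗ[k] S) j s ⊗ₜ[R] SA.prod (n + j - 1) a b) := by
  have hM1 : ∀ m, M + 1 ≤ m → SA.prod m a b = 0 := fun m hm => hM m (by omega)
  have e1 : bcOp δS SA n (δS s) a (1 ⊗ₜ b) = ∑ j ∈ Finset.range (M + 1), (j : k) •
      (dividedPow (δS : S →ₗ[k] S) j s ⊗ₜ[R] SA.prod (n + j - 1) a b) := by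
    rw [bcOp_one_tmul_range SA n (δS s) a b M hM, Finset.sum_range_succ', Nat.cast_zero,
      zero_smul, add_zero]
    refine Finset.sum_congr rfl fun j _ => ?_
    have := dividedPow_apply (δS : S →ₗ[k] S) j s
    rw [Derivation.coeFn_coe] at this
    rw [this, TensorProduct.smul_tmul']
    rfl
  rw [e1, bcOp_one_tmul_range SA (n - 1) s a b (M + 1) hM1, Finset.smul_sum,
    ← Finset.sum_add_distrib]
  refine Finset.sum_congr rfl fun j _ => ?_
  rcases Nat.eq_zero_or_pos n with rfl | hn
  · simp
  · rw [show n - 1 + j = n + j - 1 by omega, Nat.cast_add, add_smul, add_comm]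

lemma bcProd_eventually_zero [CharZero k]
    (hδ : ∀ r, δS (algebraMap R S r) = algebraMap R S (δR r))
    (SA : ConformalSuperalgebra k δR A) (x y : S ⊗[R] A) :
    ∃ N, ∀ n, N ≤ n → bcProd hδ SA n x y = 0 := by
  induction x using TensorProduct.induction_on with
  | zero => exact ⟨0, fun n _ => by simp⟩
  | add x x' hx hx' =>
    obtain ⟨M, hM⟩ := hx
    obtain ⟨M', hM'⟩ := hx'
    exact ⟨max M M', fun n hn => by
      rw [map_add, LinearMap.add_apply, hM n (by omega), hM' n (by omega), add_zero]⟩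
  | tmul s a =>
    simp only [bcProd_tmul]
    induction y using TensorProduct.induction_on with
    | zero => exact ⟨0, fun n _ => by simp⟩
    | add y y' hy hy' =>
      obtain ⟨M, hM⟩ := hy
      obtain ⟨M', hM'⟩ := hy'
      exact ⟨max M M', fun n hn => by rw [map_add, hM n (by omega), hM' n (by omega), add_zero]⟩
    | tmul t b =>
      obtain ⟨M, hM⟩ := SA.prod_eventually_zero a b
      refine ⟨M, fun n hn => ?_⟩
      have : ∀ j : ℕ, dividedPow (δS : S →ₗ[k] S) j s ⊗ₜ[R] SA.prod (n + j) a b = 0 :=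
        fun j => by rw [hM _ (by omega), TensorProduct.tmul_zero]
      rw [bcOp_tmul]
      simp only [this, finsum_zero, smul_zero]

/-- The base change `A ⊗_R S` of an `(R, δR)`-conformal superalgebra along an extension
`(R, δR) → (S, δS)` (with the factors written in the order `S ⊗[R] A`). -/
def baseChange [CharZero k] (hδ : ∀ r, δS (algebraMap R S r) = algebraMap R S (δR r))
    (SA : ConformalSuperalgebra k δR A) : ConformalSuperalgebra k δS (S ⊗[R] A) where
  even := SA.even.baseChange S
  odd := SA.odd.baseChange S
  isCompl := by
    refine ⟨?_, ?_⟩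
    · rw [Submodule.disjoint_def]
      intro x hx hy
      let p : A →ₗ[R] A := SA.even.subtype ∘ₗ SA.even.projectionOnto SA.odd SA.isCompl
      have h1 : ∀ x ∈ SA.even.baseChange S, p.baseChange S x = x := by
        intro x hx
        rw [Submodule.baseChange_eq_span] at hx
        induction hx using Submodule.span_induction with
        | mem x h =>
          obtain ⟨a, ha, rfl⟩ := h
          have : p a = a := by
            simpa [p] using congrArg Subtype.val
              (Submodule.projectionOnto_apply_left SA.isCompl ⟨a, ha⟩)
          simp [this]
        | zero => simp
        | add x y _ _ hx hy => rw [map_add, hx, hy]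
        | smul c x _ hx => rw [map_smul, hx]
      have h2 : ∀ x ∈ SA.odd.baseChange S, p.baseChange S x = 0 := by
        intro x hx
        rw [Submodule.baseChange_eq_span] at hx
        induction hx using Submodule.span_induction with
        | mem x h =>
          obtain ⟨a, ha, rfl⟩ := h
          have : p a = 0 := by
            simpa [p] using congrArg Subtype.val
              (Submodule.projectionOnto_apply_right SA.isCompl ⟨a, ha⟩)
          simp [this]
        | zero => simp
        | add x y _ _ hx hy => rw [map_add, hx, hy, add_zero]
        | smul c x _ hx => rw [map_smul, hx, smul_zero]
      rw [← h1 x hx, h2 x hy]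
    · rw [codisjoint_iff, eq_top_iff]
      intro x _
      induction x using TensorProduct.induction_on with
      | zero => exact zero_mem _
      | add x y hx hy => exact add_mem (hx trivial) (hy trivial)
      | tmul s a =>
        have h : a ∈ SA.even ⊔ SA.odd := by rw [SA.isCompl.sup_eq_top]; trivial
        obtain ⟨a, ha, b, hb, rfl⟩ := Submodule.mem_sup.mp h
        rw [TensorProduct.tmul_add]
        exact Submodule.add_mem_sup (Submodule.tmul_mem_baseChange_of_mem s ha)
          (Submodule.tmul_mem_baseChange_of_mem s hb)
  der := bcDer hδ SA
  der_even x hx := by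
    rw [Submodule.baseChange_eq_span] at hx
    induction hx using Submodule.span_induction with
    | mem x h =>
      obtain ⟨a, ha, rfl⟩ := h
      exact add_mem (Submodule.tmul_mem_baseChange_of_mem _ ha)
        (Submodule.tmul_mem_baseChange_of_mem _ (SA.der_even a ha))
    | zero => rw [map_zero]; exact zero_mem _
    | add x y _ _ hx hy => rw [map_add]; exact add_mem hx hy
    | smul c x h hx =>
      rw [bcDer_smul]
      rw [← Submodule.baseChange_eq_span] at h
      exact add_mem (Submodule.smul_mem _ _ hx) (Submodule.smul_mem _ _ h)
  der_odd x hx := by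
    rw [Submodule.baseChange_eq_span] at hx
    induction hx using Submodule.span_induction with
    | mem x h =>
      obtain ⟨a, ha, rfl⟩ := h
      exact add_mem (Submodule.tmul_mem_baseChange_of_mem _ ha)
        (Submodule.tmul_mem_baseChange_of_mem _ (SA.der_odd a ha))
    | zero => rw [map_zero]; exact zero_mem _
    | add x y _ _ hx hy => rw [map_add]; exact add_mem hx hy
    | smul c x h hx =>
      rw [bcDer_smul]
      rw [← Submodule.baseChange_eq_span] at h
      exact add_mem (Submodule.smul_mem _ _ hx) (Submodule.smul_mem _ _ h)
  prod := bcProd hδ SA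
  prod_eventually_zero := bcProd_eventually_zero hδ SA
  der_prod n x y := by
    induction x using TensorProduct.induction_on with
    | zero => simp
    | add x x' hx hx' =>
      simp only [map_add, LinearMap.add_apply, smul_add, hx, hx', neg_add]
    | tmul s a =>
      rw [bcDer_tmul, map_add, LinearMap.add_apply]
      simp only [bcProd_tmul]
      induction y using TensorProduct.induction_on with
      | zero => simp
      | add y y' hy hy' =>
        simp only [map_add, smul_add, neg_add]
        rw [add_add_add_comm, hy, hy']
      | tmul t b =>
        obtain ⟨M, hM⟩ := SA.prod_eventually_zero a b
        have key := bcOp_shift (S := S) (δS := δS) SA n s a b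
        rw [← mul_one t, ← smul_eq_mul, ← TensorProduct.smul_tmul']
        simp only [map_smul, ← smul_add]
        rw [smul_comm (n : k) t]
        refine Eq.trans ?_ (smul_neg t _)
        congr 1
        have hM' : ∀ m, M + 1 ≤ m → SA.prod m (SA.der a) b = 0 := by
          intro m hm
          rw [SA.der_prod, hM _ (by omega), smul_zero, neg_zero]
        have e1 : bcOp δS SA n s (SA.der a) (1 ⊗ₜ b) =
            - ∑ j ∈ Finset.range (M + 1), ((n + j : ℕ) : k) •
              (dividedPow (δS : S →ₗ[k] S) j s ⊗ₜ[R] SA.prod (n + j - 1) a b) := by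
          rw [bcOp_one_tmul_range SA n s _ b (M + 1) hM', ← Finset.sum_neg_distrib]
          refine Finset.sum_congr rfl fun j _ => ?_
          rw [SA.der_prod, TensorProduct.tmul_neg, tmul_smul_k]
        rw [e1, ← key M hM]
        abel
  prod_der n x y := by
    induction x using TensorProduct.induction_on with
    | zero => simp
    | add x x' hx hx' =>
      simp only [map_add, LinearMap.add_apply, smul_add, hx, hx']
      abel
    | tmul s a =>
      simp only [bcProd_tmul]
      induction y using TensorProduct.induction_on with
      | zero => simp
      | add y y' hy hy' =>
        simp only [map_add, smul_add, hy, hy']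
        abel
      | tmul t b =>
        obtain ⟨M, hM⟩ := SA.prod_eventually_zero a b
        have key := bcOp_shift (S := S) (δS := δS) SA n s a b M hM
        have main : bcOp δS SA n s a (1 ⊗ₜ SA.der b) =
            bcDer hδ SA (bcOp δS SA n s a (1 ⊗ₜ b)) +
              (n : k) • bcOp δS SA (n - 1) s a (1 ⊗ₜ b) := by
          have hM' : ∀ m, M + 1 ≤ m → SA.prod m a (SA.der b) = 0 := by
            intro m hm
            rw [SA.prod_der, hM _ (by omega), hM _ (by omega), smul_zero, map_zero, add_zero]
          have hM1 : ∀ m, M + 1 ≤ m → SA.prod m a b = 0 := fun m hm => hM m (by omega)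
          have e1 : bcOp δS SA n s a (1 ⊗ₜ SA.der b) =
              ∑ j ∈ Finset.range (M + 1),
                dividedPow (δS : S →ₗ[k] S) j s ⊗ₜ[R] SA.der (SA.prod (n + j) a b) +
              ∑ j ∈ Finset.range (M + 1), ((n + j : ℕ) : k) •
              (dividedPow (δS : S →ₗ[k] S) j s ⊗ₜ[R] SA.prod (n + j - 1) a b) := by
            rw [bcOp_one_tmul_range SA n s a _ (M + 1) hM', ← Finset.sum_add_distrib]
            refine Finset.sum_congr rfl fun j _ => ?_
            rw [SA.prod_der, TensorProduct.tmul_add, tmul_smul_k]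
          have e2 : bcDer hδ SA (bcOp δS SA n s a (1 ⊗ₜ b)) =
              bcOp δS SA n (δS s) a (1 ⊗ₜ b) + ∑ j ∈ Finset.range (M + 1),
                dividedPow (δS : S →ₗ[k] S) j s ⊗ₜ[R] SA.der (SA.prod (n + j) a b) := by
            rw [bcOp_one_tmul_range SA n s a b (M + 1) hM1,
              bcOp_one_tmul_range SA n (δS s) a b (M + 1) hM1, map_sum,
              ← Finset.sum_add_distrib]
            refine Finset.sum_congr rfl fun j _ => ?_
            rw [bcDer_tmul]
            congr 2
            exact (apply_dividedPow (δS : S →ₗ[k] S) j s).trans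
              (dividedPow_apply (δS : S →ₗ[k] S) j s).symm
          rw [e1, e2, ← key]
          abel
        rw [bcDer_tmul, map_add]
        have h1 : ∀ (u : S) (c : A), u ⊗ₜ[R] c = u • ((1 : S) ⊗ₜ[R] c) := fun u c => by
          rw [TensorProduct.smul_tmul', smul_eq_mul, mul_one]
        rw [h1 (δS t), h1 t (SA.der b), h1 t b]
        simp only [map_smul, bcDer_smul, main, smul_add]
        rw [smul_comm (n : k) t]
        abel
  der_smul := bcDer_smul hδ SA
  prod_smul n s x y := bcProd_smul hδ SA n s x y
  smul_prod n c x y := by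
    obtain ⟨M, hM⟩ := bcProd_eventually_zero hδ SA x y
    have gen : ∀ x y : S ⊗[R] A, ∃ M, ∀ M', M ≤ M' → bcProd hδ SA n (c • x) y =
        ∑ j ∈ Finset.range M', dividedPow (δS : S →ₗ[k] S) j c • bcProd hδ SA (n + j) x y := by
      intro x y
      induction x using TensorProduct.induction_on with
      | zero => exact ⟨0, fun M' _ => by simp⟩
      | add x x' hx hx' =>
        obtain ⟨M, hM⟩ := hx
        obtain ⟨M', hM'⟩ := hx'
        refine ⟨max M M', fun N hN => ?_⟩
        simp only [smul_add, map_add, LinearMap.add_apply, Finset.sum_add_distrib]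
        rw [hM N (by omega), hM' N (by omega)]
      | tmul s a =>
        rw [TensorProduct.smul_tmul', smul_eq_mul]
        simp only [bcProd_tmul]
        induction y using TensorProduct.induction_on with
        | zero => exact ⟨0, fun M' _ => by simp⟩
        | add y y' hy hy' =>
          obtain ⟨M, hM⟩ := hy
          obtain ⟨M', hM'⟩ := hy'
          refine ⟨max M M', fun N hN => ?_⟩
          simp only [map_add, smul_add, Finset.sum_add_distrib]
          rw [hM N (by omega), hM' N (by omega)]
        | tmul t b =>
          obtain ⟨M, hM⟩ := SA.prod_eventually_zero a b
          refine ⟨M, fun N hN => ?_⟩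
          have h1 : t ⊗ₜ[R] b = t • ((1 : S) ⊗ₜ[R] b) := by
            rw [TensorProduct.smul_tmul', smul_eq_mul, mul_one]
          rw [h1]
          simp only [map_smul]
          rw [bcOp_mul SA n c s a b N (fun m hm => hM m (by omega)), Finset.smul_sum]
          exact Finset.sum_congr rfl fun j _ => smul_comm _ _ _
    obtain ⟨M', hM'⟩ := gen x y
    rw [hM' (max M M') (by omega), finsum_eq_range _ (max M M')]
    intro j hj
    rw [hM _ (by omega), smul_zero]

end BaseChange

end ConformalSuperalgebra

section Defs

open ConformalSuperalgebra

variable {k : Type*} [Field k]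

/-- The identity automorphism. -/
def ConformalEquiv.refl {R : Type*} [CommRing R] [Algebra k R] {δ : Derivation k R R}
    {A : Type*} [AddCommGroup A] [Module k A] [Module R A] [IsScalarTower k R A]
    (SA : ConformalSuperalgebra k δ A) : ConformalEquiv SA SA where
  toLinearEquiv := LinearEquiv.refl R A
  map_even _ h := h
  map_odd _ h := h
  map_prod _ _ _ := rfl
  map_der _ := rfl

/-- Two `(R, δ)`-conformal superalgebras are isomorphic over `(R, δ)`. -/
def IsoOver {R : Type*} [CommRing R] [Algebra k R] {δ : Derivation k R R}
    {A : Type*} [AddCommGroup A] [Module k A] [Module R A] [IsScalarTower k R A]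
    {B : Type*} [AddCommGroup B] [Module k B] [Module R B] [IsScalarTower k R B]
    (SA : ConformalSuperalgebra k δ A) (SB : ConformalSuperalgebra k δ B) : Prop :=
  Nonempty (ConformalEquiv SA SB)

/-- Every differential `k`-algebra `(S, δ)` is an extension of `(k, 0)`. -/
lemma der_algebraMap_base {S : Type*} [CommRing S] [Algebra k S] (δ : Derivation k S S) (c : k) :
    δ (algebraMap k S c) = algebraMap k S ((0 : Derivation k k k) c) := by
  simp

/-- Two `(R, δ)`-conformal superalgebras are isomorphic as `k`-conformal superalgebras, after
restriction of scalars to `(k, 0)`. -/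
def IsoOverBase {R : Type*} [CommRing R] [Algebra k R] {δ : Derivation k R R}
    {A : Type*} [AddCommGroup A] [Module k A] [Module R A] [IsScalarTower k R A]
    {B : Type*} [AddCommGroup B] [Module k B] [Module R B] [IsScalarTower k R B]
    (SA : ConformalSuperalgebra k δ A) (SB : ConformalSuperalgebra k δ B) : Prop :=
  IsoOver (SA.restrict (der_algebraMap_base δ)) (SB.restrict (der_algebraMap_base δ))

/-- `F` is an `(S, δS)/(R, δR)`-form of `A`: the base changes of `F` and `A` to `(S, δS)` are
isomorphic `(S, δS)`-conformal superalgebras. -/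
def IsForm [CharZero k] {R : Type*} [CommRing R] [Algebra k R] {δR : Derivation k R R}
    {S : Type*} [CommRing S] [Algebra k S] {δS : Derivation k S S}
    [Algebra R S] [IsScalarTower k R S]
    (hδ : ∀ r, δS (algebraMap R S r) = algebraMap R S (δR r))
    {F : Type*} [AddCommGroup F] [Module k F] [Module R F] [IsScalarTower k R F]
    {A : Type*} [AddCommGroup A] [Module k A] [Module R A] [IsScalarTower k R A]
    (SF : ConformalSuperalgebra k δR F) (SA : ConformalSuperalgebra k δR A) : Prop :=
  IsoOver (SF.baseChange hδ) (SA.baseChange hδ)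

/-! ### The rings `R = k[t, t⁻¹]` and `Ŝ = k[t^q | q ∈ ℚ]` with the derivation `d/dt` -/

/-- The derivation `t^q ↦ q t^{q-1}` of the algebra `k[t^q | q ∈ G]`, for a ring of exponents
`G` mapping to `k`. -/
def powerDer {G : Type*} [CommRing G] (c : G →+* k) :
    Derivation k (AddMonoidAlgebra k G) (AddMonoidAlgebra k G) :=
  Derivation.mk'
    (Finsupp.linearCombination k (fun q : G => AddMonoidAlgebra.single (q - 1) (c q)) ∘ₗ
      (AddMonoidAlgebra.coeffLinearEquiv k).toLinearMap)
    (fun x y => by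
      induction x using AddMonoidAlgebra.induction_linear with
      | zero => simp
      | add x x' hx hx' => rw [add_mul, map_add, hx, hx', map_add]; simp only [smul_eq_mul]; ring
      | single p a =>
        induction y using AddMonoidAlgebra.induction_linear with
        | zero => simp
        | add y y' hy hy' => rw [mul_add, map_add, hy, hy', map_add]; simp only [smul_eq_mul]; ring
        | single q b =>
          simp only [AddMonoidAlgebra.single_mul_single, LinearMap.comp_apply,
            LinearEquiv.coe_coe, AddMonoidAlgebra.coeffLinearEquiv_apply,
            AddMonoidAlgebra.coeff_single, Finsupp.linearCombination_single,
            AddMonoidAlgebra.smul_single, smul_eq_mul, map_add]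
          rw [show p + (q - 1) = p + q - 1 by ring, show q + (p - 1) = p + q - 1 by ring,
            ← AddMonoidAlgebra.single_add]
          congr 1
          ring)

lemma powerDer_single {G : Type*} [CommRing G] (c : G →+* k) (q : G) (a : k) :
    powerDer c (AddMonoidAlgebra.single q a) = AddMonoidAlgebra.single (q - 1) (a * c q) := by
  simp [powerDer]

/-- The ring `Ŝ = k[t^q | q ∈ ℚ]`, the union of the rings `k[t^{1/m}, t^{-1/m}]`. -/
abbrev RatLaurent (k : Type*) [Field k] : Type _ := AddMonoidAlgebra k ℚ

/-- The inclusion `k[t, t⁻¹] → k[t^q | q ∈ ℚ]`. -/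
instance ratLaurentAlgebra : Algebra (LaurentPolynomial k) (RatLaurent k) :=
  (AddMonoidAlgebra.mapDomainRingHom k (Int.castAddHom ℚ)).toAlgebra

lemma algebraMap_ratLaurent_single (n : ℤ) (a : k) :
    algebraMap (LaurentPolynomial k) (RatLaurent k) (AddMonoidAlgebra.single n a) =
      AddMonoidAlgebra.single (n : ℚ) a := by
  rw [RingHom.algebraMap_toAlgebra, AddMonoidAlgebra.mapDomainRingHom_apply,
    AddMonoidAlgebra.mapDomain_single]
  rfl

instance ratLaurentTower : IsScalarTower k (LaurentPolynomial k) (RatLaurent k) :=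
  IsScalarTower.of_algebraMap_eq fun c => by
    rw [AddMonoidAlgebra.coe_algebraMap, AddMonoidAlgebra.coe_algebraMap]
    simp only [Function.comp_apply, algebraMap_ratLaurent_single, Int.cast_zero]

/-- `d/dt` on `k[t, t⁻¹]`. -/
def laurentDer (k : Type*) [Field k] : Derivation k (LaurentPolynomial k) (LaurentPolynomial k) :=
  powerDer (Int.castRingHom k)

/-- `d/dt` on `k[t^q | q ∈ ℚ]`. -/
def ratLaurentDer (k : Type*) [Field k] [CharZero k] :
    Derivation k (RatLaurent k) (RatLaurent k) :=
  powerDer (Rat.castHom k)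

lemma ratLaurentDer_algebraMap [CharZero k] (r : LaurentPolynomial k) :
    ratLaurentDer k (algebraMap (LaurentPolynomial k) (RatLaurent k) r) =
      algebraMap (LaurentPolynomial k) (RatLaurent k) (laurentDer k r) := by
  induction r using AddMonoidAlgebra.induction_linear with
  | zero => simp
  | add x y hx hy => simp only [map_add, hx, hy]
  | single n a =>
    rw [algebraMap_ratLaurent_single, ratLaurentDer, laurentDer, powerDer_single,
      powerDer_single, algebraMap_ratLaurent_single]
    simp

/-! ### Twisted loop algebras -/

section Loop

variable [CharZero k] {A : Type*} [AddCommGroup A] [Module k A]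
  {SA : ConformalSuperalgebra k (0 : Derivation k k k) A}

/-- The elements `a ⊗ t^{i/m}` with `σ(a) = ζ^i a`. -/
def loopGenerators (σ : ConformalEquiv SA SA) (m : ℕ) (ζ : k) : Set (RatLaurent k ⊗[k] A) :=
  {x | ∃ (i : ℤ) (a : A), σ.toLinearEquiv a = ζ ^ i • a ∧
    x = AddMonoidAlgebra.single ((i : ℚ) / (m : ℚ)) 1 ⊗ₜ[k] a}

lemma tmul_mem_loop {σ : ConformalEquiv SA SA} {m : ℕ} (hm : 0 < m) {ζ : k}
    (hζ : IsPrimitiveRoot ζ m) {i : ℤ} {a : A} (ha : σ.toLinearEquiv a = ζ ^ i • a) (n : ℤ)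
    (q : ℚ) (hq : q = (i : ℚ) / (m : ℚ) + n) (c : k) :
    AddMonoidAlgebra.single q c ⊗ₜ[k] a ∈ Submodule.span k (loopGenerators σ m ζ) := by
  have h : (AddMonoidAlgebra.single q c ⊗ₜ[k] a : RatLaurent k ⊗[k] A) =
      c • (AddMonoidAlgebra.single q 1 ⊗ₜ[k] a) := by
    rw [TensorProduct.smul_tmul', AddMonoidAlgebra.smul_single, smul_eq_mul, mul_one]
  rw [h]
  refine Submodule.smul_mem _ _ (Submodule.subset_span ⟨i + m * n, a, ?_, ?_⟩)
  · have h0 : ζ ≠ 0 := hζ.ne_zero hm.ne'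
    rw [ha, zpow_add₀ h0, zpow_mul, zpow_natCast, hζ.pow_eq_one, one_zpow, mul_one]
  · have hm' : (m : ℚ) ≠ 0 := by exact_mod_cast hm.ne'
    congr 2
    rw [hq]
    push_cast
    field_simp

/-- The subspace `⨁_i A_i ⊗ t^{i/m}` of `A ⊗_k Ŝ`, where `A_i` is the `ζ^i`-eigenspace of `σ`;
it is stable under multiplication by `k[t, t⁻¹]`. -/
def loopSubmodule (σ : ConformalEquiv SA SA) (m : ℕ) (hm : 0 < m) (ζ : k)
    (hζ : IsPrimitiveRoot ζ m) : Submodule (LaurentPolynomial k) (RatLaurent k ⊗[k] A) where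
  carrier := Submodule.span k (loopGenerators σ m ζ)
  add_mem' := add_mem
  zero_mem' := zero_mem _
  smul_mem' r x hx := by
    simp only [SetLike.mem_coe] at hx ⊢
    induction r using AddMonoidAlgebra.induction_linear with
    | zero => rw [zero_smul]; exact zero_mem _
    | add r s hr hs => rw [add_smul]; exact add_mem hr hs
    | single n c =>
      induction hx using Submodule.span_induction with
      | zero => rw [smul_zero]; exact zero_mem _
      | add x y _ _ hx hy => rw [smul_add]; exact add_mem hx hy
      | smul d x _ hx => rw [smul_comm]; exact Submodule.smul_mem _ _ hx
      | mem x h =>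
        obtain ⟨i, a, ha, rfl⟩ := h
        rw [TensorProduct.smul_tmul', Algebra.smul_def, algebraMap_ratLaurent_single,
          AddMonoidAlgebra.single_mul_single]
        exact tmul_mem_loop hm hζ ha n _ (add_comm _ _) _

lemma dividedPow_ratLaurentDer_single (j : ℕ) (q : ℚ) (c : k) :
    ∃ d : k, dividedPow (ratLaurentDer k : RatLaurent k →ₗ[k] RatLaurent k) j
      (AddMonoidAlgebra.single q c) = AddMonoidAlgebra.single (q - j) d := by
  have h : ∃ d : k, ((ratLaurentDer k : RatLaurent k →ₗ[k] RatLaurent k) ^ j)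
      (AddMonoidAlgebra.single q c) = AddMonoidAlgebra.single (q - j) d := by
    induction j with
    | zero => exact ⟨c, by simp⟩
    | succ j ih =>
      obtain ⟨d, hd⟩ := ih
      refine ⟨d * Rat.castHom k (q - j), ?_⟩
      rw [pow_succ', Module.End.mul_apply, hd, Derivation.coeFn_coe, ratLaurentDer,
        powerDer_single]
      congr 1
      push_cast
      ring
  obtain ⟨d, hd⟩ := h
  exact ⟨(j.factorial : k)⁻¹ * d, by
    rw [dividedPow, LinearMap.smul_apply, hd, AddMonoidAlgebra.smul_single, smul_eq_mul]⟩

/-- The twisted loop algebra `L(A, σ) = ⨁_i A_i ⊗ t^{i/m}` as a `(k[t, t⁻¹], d/dt)`-conformal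
superalgebra, for an automorphism `σ` of period `m` and a primitive `m`-th root of unity `ζ`. -/
def twistedLoop (σ : ConformalEquiv SA SA) (m : ℕ) (hm : 0 < m) (ζ : k)
    (hζ : IsPrimitiveRoot ζ m) :
    ConformalSuperalgebra k (laurentDer k) (loopSubmodule σ m hm ζ hζ) :=
  ((SA.baseChange (der_algebraMap_base (ratLaurentDer k))).restrict
      (ratLaurentDer_algebraMap (k := k))).sub (loopSubmodule σ m hm ζ hζ)
    (fun x hx => by
      change x ∈ Submodule.span k _ at hx
      induction hx using Submodule.span_induction with
      | zero => exact ⟨0, zero_mem _, 0, zero_mem _, add_zero 0⟩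
      | add x y _ _ hx hy =>
        obtain ⟨a, ha, b, hb, rfl⟩ := hx
        obtain ⟨a', ha', b', hb', rfl⟩ := hy
        exact ⟨a + a', add_mem ha ha', b + b', add_mem hb hb', by abel⟩
      | smul d x _ hx =>
        obtain ⟨a, ha, b, hb, rfl⟩ := hx
        exact ⟨d • a, Submodule.smul_of_tower_mem _ d ha, d • b,
          Submodule.smul_of_tower_mem _ d hb, (smul_add _ _ _).symm⟩
      | mem x h =>
        obtain ⟨i, a, ha, rfl⟩ := h
        have h : a ∈ SA.even ⊔ SA.odd := by rw [SA.isCompl.sup_eq_top]; trivial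
        obtain ⟨a, hae, b, hbo, rfl⟩ := Submodule.mem_sup.mp h
        have h1 : σ.toLinearEquiv a - ζ ^ i • a = -(σ.toLinearEquiv b - ζ ^ i • b) := by
          rw [map_add, smul_add] at ha
          rw [neg_sub, sub_eq_sub_iff_add_eq_add, ha, add_comm]
        have h2 : σ.toLinearEquiv a - ζ ^ i • a ∈ SA.even :=
          sub_mem (σ.map_even a hae) (Submodule.smul_mem _ _ hae)
        have h3 : σ.toLinearEquiv b - ζ ^ i • b ∈ SA.odd :=
          sub_mem (σ.map_odd b hbo) (Submodule.smul_mem _ _ hbo)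
        have h4 : σ.toLinearEquiv a - ζ ^ i • a = 0 :=
          (Submodule.disjoint_def.mp SA.isCompl.disjoint) _ h2 (h1 ▸ neg_mem h3)
        have h5 : σ.toLinearEquiv b - ζ ^ i • b = 0 := by
          rw [h4] at h1; exact neg_eq_zero.mp h1.symm
        exact ⟨_, ⟨Submodule.subset_span ⟨i, a, sub_eq_zero.mp h4, rfl⟩,
            Submodule.tmul_mem_baseChange_of_mem _ hae⟩,
          _, ⟨Submodule.subset_span ⟨i, b, sub_eq_zero.mp h5, rfl⟩,
            Submodule.tmul_mem_baseChange_of_mem _ hbo⟩,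
          (TensorProduct.tmul_add _ _ _).symm⟩)
    (fun x hx => by
      change x ∈ Submodule.span k _ at hx
      change bcDer (der_algebraMap_base (ratLaurentDer k)) SA x ∈ Submodule.span k _
      induction hx using Submodule.span_induction with
      | zero => rw [map_zero]; exact zero_mem _
      | add x y _ _ hx hy => rw [map_add]; exact add_mem hx hy
      | smul d x _ hx => rw [map_smul]; exact Submodule.smul_mem _ _ hx
      | mem x h =>
        obtain ⟨i, a, ha, rfl⟩ := h
        rw [bcDer_tmul, ratLaurentDer, powerDer_single]
        refine add_mem (tmul_mem_loop hm hζ ha (-1) _ (by push_cast; ring) _)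
          (Submodule.subset_span ⟨i, SA.der a, ?_, rfl⟩)
        exact (σ.map_der a).trans (by
          change SA.der (σ.toLinearEquiv a) = _
          rw [ha, map_smul]))
    (fun n x hx y hy => by
      change x ∈ Submodule.span k _ at hx
      change y ∈ Submodule.span k _ at hy
      change bcProd (der_algebraMap_base (ratLaurentDer k)) SA n x y ∈ Submodule.span k _
      induction hx using Submodule.span_induction with
      | zero => rw [map_zero]; exact zero_mem _
      | add x y _ _ hx hy => rw [map_add]; exact add_mem hx hy
      | smul d x _ hx => rw [map_smul]; exact Submodule.smul_mem _ _ hx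
      | mem x h =>
        obtain ⟨i, a, ha, rfl⟩ := h
        induction hy using Submodule.span_induction with
        | zero => rw [map_zero]; exact zero_mem _
        | add x y _ _ hx hy => rw [map_add]; exact add_mem hx hy
        | smul d x _ hx => rw [map_smul]; exact Submodule.smul_mem _ _ hx
        | mem y h' =>
          obtain ⟨i', b, hb, rfl⟩ := h'
          obtain ⟨M, hM⟩ := SA.prod_eventually_zero a b
          rw [bcProd_tmul, bcOp_tmul, finsum_eq_range _ M
            (fun j hj => by rw [hM _ (by omega), TensorProduct.tmul_zero]), Finset.smul_sum]
          refine sum_mem fun j _ => ?_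
          obtain ⟨d, hd⟩ := dividedPow_ratLaurentDer_single (k := k) j ((i : ℚ) / (m : ℚ)) 1
          rw [hd, TensorProduct.smul_tmul', smul_eq_mul, AddMonoidAlgebra.single_mul_single]
          have hab : σ.toLinearEquiv (SA.prod (n + j) a b) =
              ζ ^ (i + i') • SA.prod (n + j) a b := by
            refine (σ.map_prod (n + j) a b).trans ?_
            change SA.prod (n + j) (σ.toLinearEquiv a) (σ.toLinearEquiv b) = _
            rw [ha, hb, map_smul, map_smul, LinearMap.smul_apply, smul_smul,
              zpow_add₀ (hζ.ne_zero hm.ne'), mul_comm]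
          exact tmul_mem_loop hm hζ hab (-(j : ℤ)) _ (by push_cast; ring) _)

end Loop

/-! ### The `N = 2` conformal superalgebra -/

/-- The generators `L, J, G⁺, G⁻` of the `N = 2` conformal superalgebra. -/
inductive N2Gen : Type
  | L | J | Gp | Gm

open N2Gen in
instance : Fintype N2Gen := ⟨⟨[L, J, Gp, Gm], by simp⟩, by rintro (_ | _ | _ | _) <;> simp⟩

open N2Gen in
lemma N2Gen.sum_univ {M : Type*} [AddCommMonoid M] (f : N2Gen → M) :
    ∑ g, f g = f L + (f J + (f Gp + f Gm)) := by
  change (Multiset.map f (↑[L, J, Gp, Gm])).sum = _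
  simp

/-- The underlying space `k[∂] ⊗_k V`, the free `k[∂]`-module on `L, J, G⁺, G⁻`. -/
abbrev N2 (k : Type*) [Field k] : Type _ := N2Gen → Polynomial k

open N2Gen Polynomial in
/-- The structure polynomials: `[a_λ b] = ∑_c (n2Struct a b c) c` for generators `a, b`, where
`λ` is the outer variable `X` and `∂` the inner variable `C X`. The brackets
`[J_λ L]`, `[G^±_λ L]`, `[G^±_λ J]`, `[G⁻_λ G⁺]` are those forced by skew-symmetry
`[b_λ a] = -p(a,b) [a_{-λ-∂} b]`. -/
def n2Struct (k : Type*) [Field k] : N2Gen → N2Gen → N2Gen → Polynomial (Polynomial k)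
  -- `[L_λ L] = (∂ + 2λ) L`
  | L, L, L => C X + 2 * X
  -- `[L_λ J] = (∂ + λ) J`
  | L, J, J => C X + X
  -- `[L_λ G^±] = (∂ + (3/2)λ) G^±`
  | L, Gp, Gp => C X + C (C (3 / 2)) * X
  | L, Gm, Gm => C X + C (C (3 / 2)) * X
  -- `[J_λ L] = λ J`
  | J, L, J => X
  -- `[J_λ G^±] = ± G^±`
  | J, Gp, Gp => 1
  | J, Gm, Gm => -1
  -- `[G^±_λ L] = ((1/2)∂ + (3/2)λ) G^±`
  | Gp, L, Gp => C (C (1 / 2)) * C X + C (C (3 / 2)) * X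
  | Gm, L, Gm => C (C (1 / 2)) * C X + C (C (3 / 2)) * X
  -- `[G^±_λ J] = ∓ G^±`
  | Gp, J, Gp => -1
  | Gm, J, Gm => 1
  -- `[G⁺_λ G⁻] = L + (1/2)(∂ + 2λ) J`
  | Gp, Gm, L => 1
  | Gp, Gm, J => C (C (1 / 2)) * (C X + 2 * X)
  -- `[G⁻_λ G⁺] = L - (1/2)(∂ + 2λ) J`
  | Gm, Gp, L => 1
  | Gm, Gp, J => -(C (C (1 / 2)) * (C X + 2 * X))
  | _, _, _ => 0

open Polynomial in
/-- The `c`-component of the `λ`-bracket, extended from the generators by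
`[p(∂)a_λ q(∂)b] = p(-λ) q(∂ + λ) [a_λ b]`. -/
def n2Bracket (k : Type*) [Field k] (f g : N2 k) (c : N2Gen) : Polynomial (Polynomial k) :=
  ∑ a, ∑ b, aeval (-X : Polynomial (Polynomial k)) (f a) *
    aeval (C X + X : Polynomial (Polynomial k)) (g b) * n2Struct k a b c

open Polynomial in
/-- The classical `N = 2` conformal superalgebra over `k`. Its `n`-products are given by
`[f_λ g] = ∑_n λ^n / n! f_(n) g`. -/
def n2Conformal (k : Type*) [Field k] :
    ConformalSuperalgebra k (0 : Derivation k k k) (N2 k) where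
  even :=
    { carrier := {f | f N2Gen.Gp = 0 ∧ f N2Gen.Gm = 0}
      add_mem' := fun {f g} hf hg => by simp_all
      zero_mem' := by simp
      smul_mem' := fun c f hf => by simp_all }
  odd :=
    { carrier := {f | f N2Gen.L = 0 ∧ f N2Gen.J = 0}
      add_mem' := fun {f g} hf hg => by simp_all
      zero_mem' := by simp
      smul_mem' := fun c f hf => by simp_all }
  isCompl := by
    refine ⟨?_, ?_⟩
    · rw [Submodule.disjoint_def]
      rintro f ⟨h1, h2⟩ ⟨h3, h4⟩
      funext c
      cases c <;> assumption
    · rw [codisjoint_iff, eq_top_iff]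
      intro f _
      refine Submodule.mem_sup.mpr
        ⟨fun | .L => f .L | .J => f .J | _ => 0, ⟨rfl, rfl⟩,
          fun | .Gp => f .Gp | .Gm => f .Gm | _ => 0, ⟨rfl, rfl⟩, ?_⟩
      funext c
      cases c <;> simp
  der :=
    { toFun := fun f c => X * f c
      map_add' := fun f g => by funext c; simp [mul_add]
      map_smul' := fun r f => by funext c; simp }
  der_even := by rintro f ⟨h1, h2⟩; exact ⟨by simp [h1], by simp [h2]⟩
  der_odd := by rintro f ⟨h1, h2⟩; exact ⟨by simp [h1], by simp [h2]⟩
  prod n := LinearMap.mk₂ k (fun f g c => (n.factorial : k) • (n2Bracket k f g c).coeff n)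
    (fun f f' g => by
      funext c
      simp [n2Bracket, add_mul, Finset.sum_add_distrib])
    (fun r f g => by
      funext c
      simp only [n2Bracket, Pi.smul_apply, map_smul, smul_mul_assoc, ← Finset.smul_sum,
        coeff_smul]
      rw [smul_comm])
    (fun f g g' => by
      funext c
      simp [n2Bracket, mul_add, add_mul, Finset.sum_add_distrib])
    (fun r f g => by
      funext c
      simp only [n2Bracket, Pi.smul_apply, map_smul, smul_mul_assoc, mul_smul_comm,
        ← Finset.smul_sum, coeff_smul]
      rw [smul_comm])
  prod_eventually_zero f g := by
    refine ⟨∑ c, ((n2Bracket k f g c).natDegree + 1), fun n hn => ?_⟩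
    funext c
    have h : (n2Bracket k f g c).natDegree + 1 ≤
        ∑ c, ((n2Bracket k f g c).natDegree + 1) :=
      Finset.single_le_sum (f := fun c => (n2Bracket k f g c).natDegree + 1)
        (fun _ _ => Nat.zero_le _) (Finset.mem_univ c)
    simp only [LinearMap.mk₂_apply, Pi.zero_apply]
    rw [coeff_eq_zero_of_natDegree_lt (by omega), smul_zero]
  der_prod n f g := by
    funext c
    have h : n2Bracket k (fun c => X * f c) g c = -(X * n2Bracket k f g c) := by
      simp only [n2Bracket, map_mul, aeval_X, Finset.mul_sum, ← Finset.sum_neg_distrib]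
      refine Finset.sum_congr rfl fun a _ => Finset.sum_congr rfl fun b _ => ?_
      ring
    simp only [LinearMap.coe_mk, AddHom.coe_mk, LinearMap.mk₂_apply, Pi.neg_apply,
      Pi.smul_apply, h, coeff_neg, smul_neg]
    cases n with
    | zero => simp
    | succ n => rw [coeff_X_mul, smul_smul, Nat.factorial_succ, Nat.cast_mul]; rfl
  prod_der n f g := by
    funext c
    have h : n2Bracket k f (fun c => X * g c) c =
        C X * n2Bracket k f g c + X * n2Bracket k f g c := by
      simp only [n2Bracket, map_mul, aeval_X, Finset.mul_sum, ← Finset.sum_add_distrib]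
      refine Finset.sum_congr rfl fun a _ => Finset.sum_congr rfl fun b _ => ?_
      ring
    simp only [LinearMap.coe_mk, AddHom.coe_mk, LinearMap.mk₂_apply, Pi.add_apply,
      Pi.smul_apply, h, coeff_add, coeff_C_mul, smul_add, mul_smul_comm]
    congr 1
    cases n with
    | zero => simp
    | succ n => rw [coeff_X_mul, smul_smul, Nat.factorial_succ, Nat.cast_mul]; rfl
  der_smul r f := by simp
  prod_smul n r f g := by simp
  smul_prod n r f g := by
    rw [finsum_eq_range _ 1]
    · simp [dividedPow_zero]
    · intro j hj
      obtain ⟨i, rfl⟩ : ∃ i, j = i + 1 := ⟨j - 1, by omega⟩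
      simp [dividedPow, pow_succ]

/-- The map `L ↦ L, J ↦ -J, G⁺ ↦ G⁻, G⁻ ↦ G⁺`, extended `k[∂]`-linearly. -/
def n2OmegaFun (k : Type*) [Field k] (f : N2 k) : N2 k
  | .L => f .L
  | .J => -f .J
  | .Gp => f .Gm
  | .Gm => f .Gp

lemma n2OmegaFun_invol (k : Type*) [Field k] (f : N2 k) : n2OmegaFun k (n2OmegaFun k f) = f := by
  funext c
  cases c <;> simp [n2OmegaFun]

lemma n2Bracket_omega (k : Type*) [Field k] (f g : N2 k) :
    n2Bracket k (n2OmegaFun k f) (n2OmegaFun k g) .L = n2Bracket k f g .L ∧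
    n2Bracket k (n2OmegaFun k f) (n2OmegaFun k g) .J = -n2Bracket k f g .J ∧
    n2Bracket k (n2OmegaFun k f) (n2OmegaFun k g) .Gp = n2Bracket k f g .Gm ∧
    n2Bracket k (n2OmegaFun k f) (n2OmegaFun k g) .Gm = n2Bracket k f g .Gp := by
  refine ⟨?_, ?_, ?_, ?_⟩ <;>
  · simp only [n2Bracket, N2Gen.sum_univ, n2OmegaFun, n2Struct, map_neg, mul_zero, add_zero,
      zero_add]
    ring

/-- The automorphism `ω` of the `N = 2` conformal superalgebra. -/
def n2Omega (k : Type*) [Field k] : ConformalEquiv (n2Conformal k) (n2Conformal k) where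
  toFun := n2OmegaFun k
  invFun := n2OmegaFun k
  left_inv := n2OmegaFun_invol k
  right_inv := n2OmegaFun_invol k
  map_add' f g := by
    funext c
    cases c <;> simp [n2OmegaFun, add_comm]
  map_smul' r f := by
    funext c
    cases c <;> simp [n2OmegaFun]
  map_even := by rintro f ⟨h1, h2⟩; exact ⟨h2, h1⟩
  map_odd := by rintro f ⟨h1, h2⟩; exact ⟨h1, by simp [n2OmegaFun, h2]⟩
  map_prod n f g := by
    change n2OmegaFun k (fun c => (n.factorial : k) • (n2Bracket k f g c).coeff n) =
      fun c => (n.factorial : k) • (n2Bracket k (n2OmegaFun k f) (n2OmegaFun k g) c).coeff n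
    funext c
    cases c
    · change (n.factorial : k) • (n2Bracket k f g .L).coeff n = _
      rw [(n2Bracket_omega k f g).1]
    · change -((n.factorial : k) • (n2Bracket k f g .J).coeff n) = _
      rw [(n2Bracket_omega k f g).2.1, Polynomial.coeff_neg, smul_neg]
    · change (n.factorial : k) • (n2Bracket k f g .Gm).coeff n = _
      rw [(n2Bracket_omega k f g).2.2.1]
    · change (n.factorial : k) • (n2Bracket k f g .Gp).coeff n = _
      rw [(n2Bracket_omega k f g).2.2.2]
  map_der f := by
    change n2OmegaFun k (fun c => Polynomial.X * f c) =
      fun c => Polynomial.X * n2OmegaFun k f c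
    funext c
    cases c <;> simp [n2OmegaFun]

/-- `ω` has period `2`. -/
lemma n2Omega_period (k : Type*) [Field k] (f : N2 k) :
    (n2Omega k).toLinearEquiv^[2] f = f :=
  n2OmegaFun_invol k f

end Defs

end

/-! A form `F` sits in `Ŝ ⊗ F` as the fixed points of `γ ⊗ id`, where `γ` generates the Galois group
topologically: `γ t^q = χ(q) t^q` with `χ(i/m) = ξ_m^i`. Transported along `Ŝ ⊗ F ≅ Ŝ ⊗ A`, this
becomes a `γ`-semilinear automorphism `T` of `Ŝ ⊗ A`. The relations force `T J = ± J`, and then `T`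
maps `G⁺, G⁻` to `α G⁺, α⁻¹ G⁻` or to `α G⁻, α⁻¹ G⁺`, where the unit `α` of `Ŝ` is a monomial
`c t^q`. In the first case finiteness of the orbits of `T` gives `q = 0` and makes `c` a root of
unity. Conjugating with `G^± ↦ β^{±1} G^±` for a monomial `β` (in the second case this takes a
square root in `k`) therefore turns `T` into `γ ⊗ id` or `γ ⊗ ω`, whose fixed points are
`L(A, id)` and `L(A, ω)`. An isomorphism between these two would map `J` to `± J`, which is not
fixed by `γ ⊗ ω`. -/

noncomputable section

namespace ConformalSuperalgebra

section SemiHom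

variable {k : Type*} [Field k] {R S S' : Type*} [CommRing R] [Algebra k R] [CommRing S]
  [Algebra k S] [CommRing S'] [Algebra k S']
  {δR : Derivation k R R} {δ : Derivation k S S} {δ' : Derivation k S' S'}
  {A : Type*} [AddCommGroup A] [Module k A] [Module R A] [IsScalarTower k R A]
  {B : Type*} [AddCommGroup B] [Module k B] [Module S B] [IsScalarTower k S B]
  {C : Type*} [AddCommGroup C] [Module k C] [Module S' C] [IsScalarTower k S' C]
  {SA : ConformalSuperalgebra k δR A} {SB : ConformalSuperalgebra k δ B}
  {SC : ConformalSuperalgebra k δ' C}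

/-- A homomorphism from an `(R, δR)`-conformal to an `(S, δ)`-conformal superalgebra that is
semilinear along `γ : R → S`. -/
structure IsSemiHom (γ : R →ₐ[k] S) (SA : ConformalSuperalgebra k δR A)
    (SB : ConformalSuperalgebra k δ B) (f : A →+ B) : Prop where
  map_smul : ∀ (r : R) a, f (r • a) = γ r • f a
  map_even : ∀ a ∈ SA.even, f a ∈ SB.even
  map_odd : ∀ a ∈ SA.odd, f a ∈ SB.odd
  map_der : ∀ a, f (SA.der a) = SB.der (f a)
  map_prod : ∀ n a b, f (SA.prod n a b) = SB.prod n (f a) (f b)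

lemma map_smul_base {γ : R →ₐ[k] S} {f : A →+ B} (hf : ∀ (r : R) a, f (r • a) = γ r • f a)
    (c : k) (a : A) : f (c • a) = c • f a := by
  rw [← algebraMap_smul R c a, hf, γ.commutes, algebraMap_smul]

lemma IsSemiHom.comp {γ : R →ₐ[k] S} {γ' : S →ₐ[k] S'} {g : B →+ C} {f : A →+ B}
    (hg : IsSemiHom γ' SB SC g) (hf : IsSemiHom γ SA SB f) :
    IsSemiHom (γ'.comp γ) SA SC (g.comp f) where
  map_smul r a := by simp [hf.map_smul, hg.map_smul]
  map_even a ha := hg.map_even _ (hf.map_even a ha)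
  map_odd a ha := hg.map_odd _ (hf.map_odd a ha)
  map_der a := by simp [hf.map_der, hg.map_der]
  map_prod n a b := by simp [hf.map_prod, hg.map_prod]

lemma dividedPow_map {γ : R →ₐ[k] S} (hγ : ∀ r, γ (δR r) = δ (γ r)) (j : ℕ) (r : R) :
    dividedPow (δ : S →ₗ[k] S) j (γ r) = γ (dividedPow (δR : R →ₗ[k] R) j r) := by
  have hpow : ∀ r, ((δ : S →ₗ[k] S) ^ j) (γ r) = γ (((δR : R →ₗ[k] R) ^ j) r) := by
    induction j with
    | zero => simp
    | succ j ih => intro r; simp [pow_succ, ← hγ, ih]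
  simp only [dividedPow, LinearMap.smul_apply, hpow, map_smul]

lemma smul_prod_range (SA : ConformalSuperalgebra k δR A) (n : ℕ) (r : R) (a b : A) (M : ℕ)
    (hM : ∀ m, M ≤ m → SA.prod m a b = 0) :
    SA.prod n (r • a) b =
      ∑ j ∈ Finset.range M, dividedPow (δR : R →ₗ[k] R) j r • SA.prod (n + j) a b := by
  rw [SA.smul_prod, finsum_eq_range _ M]
  intro j hj
  rw [hM _ (by omega), smul_zero]

lemma map_der_of_span {γ : R →ₐ[k] S} (hγ : ∀ r, γ (δR r) = δ (γ r)) {f : A →+ B}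
    (hf : ∀ (r : R) a, f (r • a) = γ r • f a) {X : Set A} (hX : Submodule.span R X = ⊤)
    (hder : ∀ a ∈ X, f (SA.der a) = SB.der (f a)) (a : A) : f (SA.der a) = SB.der (f a) := by
  have ha : a ∈ Submodule.span R X := hX ▸ Submodule.mem_top
  induction ha using Submodule.span_induction with
  | mem x h => exact hder x h
  | zero => simp
  | add x y _ _ hx hy => simp only [map_add, hx, hy]
  | smul r x _ hx => rw [SA.der_smul, map_add, hf, hf, hf, SB.der_smul, hx, hγ]

lemma map_prod_of_span {γ : R →ₐ[k] S} (hγ : ∀ r, γ (δR r) = δ (γ r)) {f : A →+ B}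
    (hf : ∀ (r : R) a, f (r • a) = γ r • f a) {X : Set A} (hX : Submodule.span R X = ⊤)
    (hprod : ∀ n, ∀ a ∈ X, ∀ b ∈ X, f (SA.prod n a b) = SB.prod n (f a) (f b)) (n : ℕ) (a b : A) :
    f (SA.prod n a b) = SB.prod n (f a) (f b) := by
  have ha : a ∈ Submodule.span R X := hX ▸ Submodule.mem_top
  have hb : b ∈ Submodule.span R X := hX ▸ Submodule.mem_top
  induction ha using Submodule.span_induction generalizing n with
  | mem x h =>
    induction hb using Submodule.span_induction with
    | mem y h' => exact hprod n x h y h'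
    | zero => simp
    | add y z _ _ hy hz => simp only [map_add, hy, hz]
    | smul r y _ hy => rw [SA.prod_smul, hf, hf, SB.prod_smul, hy]
  | zero => simp
  | add x y _ _ hx hy => simp only [map_add, LinearMap.add_apply, hx, hy]
  | smul r x _ hx =>
    obtain ⟨M, hM⟩ := SA.prod_eventually_zero x b
    rw [smul_prod_range SA n r x b M hM, hf, smul_prod_range SB n (γ r) (f x) (f b) M
      (fun m hm => by rw [← hx, hM m hm, map_zero]), map_sum]
    exact Finset.sum_congr rfl fun j _ => by rw [hf, hx, dividedPow_map hγ]

end SemiHom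

end ConformalSuperalgebra

open ConformalSuperalgebra

lemma mem_of_apply_mem_of_isCompl {R A B : Type*} [Ring R] [AddCommGroup A] [Module R A]
    [AddCommGroup B] [Module R B] {P Q : Submodule R A} {P' Q' : Submodule R B}
    (h : Codisjoint P Q) (h' : Disjoint P' Q') {f : A →ₗ[R] B} (hf : Function.Injective f)
    (hP : ∀ a ∈ P, f a ∈ P') (hQ : ∀ a ∈ Q, f a ∈ Q') {a : A} (ha : f a ∈ P') : a ∈ P := by
  obtain ⟨x, hx, y, hy, rfl⟩ := Submodule.mem_sup.mp (h.eq_top ▸ Submodule.mem_top : a ∈ P ⊔ Q)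
  have hy0 : f y = 0 := by
    refine Submodule.disjoint_def.mp h' _ ?_ (hQ y hy)
    rwa [map_add, add_mem_cancel_left (hP x hx)] at ha
  rwa [(map_eq_zero_iff f hf).mp hy0, add_zero]

namespace ConformalEquiv

variable {k : Type*} [Field k] {S : Type*} [CommRing S] [Algebra k S] {δ : Derivation k S S}
  {A : Type*} [AddCommGroup A] [Module k A] [Module S A] [IsScalarTower k S A]
  {B : Type*} [AddCommGroup B] [Module k B] [Module S B] [IsScalarTower k S B]
  {C : Type*} [AddCommGroup C] [Module k C] [Module S C] [IsScalarTower k S C]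
  {SA : ConformalSuperalgebra k δ A} {SB : ConformalSuperalgebra k δ B}
  {SC : ConformalSuperalgebra k δ C}

lemma isSemiHom (e : ConformalEquiv SA SB) :
    IsSemiHom (AlgHom.id k S) SA SB (e.toLinearEquiv : A →+ B) where
  map_smul s a := e.toLinearEquiv.map_smul s a
  map_even := e.map_even
  map_odd := e.map_odd
  map_der := e.map_der
  map_prod := e.map_prod

/-- A linear equivalence that is a homomorphism of conformal superalgebras, as an isomorphism. -/
def ofIsSemiHom (e : A ≃ₗ[S] B) (he : IsSemiHom (AlgHom.id k S) SA SB (e : A →+ B)) :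
    ConformalEquiv SA SB where
  toLinearEquiv := e
  map_even := he.map_even
  map_odd := he.map_odd
  map_prod := he.map_prod
  map_der := he.map_der

/-- The inverse of an isomorphism of conformal superalgebras. -/
def symm (e : ConformalEquiv SA SB) : ConformalEquiv SB SA where
  toLinearEquiv := e.toLinearEquiv.symm
  map_even b hb := mem_of_apply_mem_of_isCompl SA.isCompl.codisjoint SB.isCompl.disjoint
    (f := e.toLinearEquiv.toLinearMap) e.toLinearEquiv.injective e.map_even e.map_odd
    ((e.toLinearEquiv.apply_symm_apply b).symm ▸ hb)
  map_odd b hb := mem_of_apply_mem_of_isCompl SA.isCompl.symm.codisjoint SB.isCompl.symm.disjoint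
    (f := e.toLinearEquiv.toLinearMap) e.toLinearEquiv.injective e.map_odd e.map_even
    ((e.toLinearEquiv.apply_symm_apply b).symm ▸ hb)
  map_prod n b b' := by
    obtain ⟨a, rfl⟩ := e.toLinearEquiv.surjective b
    obtain ⟨a', rfl⟩ := e.toLinearEquiv.surjective b'
    refine (congrArg e.toLinearEquiv.symm (e.map_prod n a a').symm).trans ?_
    simp
  map_der b := by
    obtain ⟨a, rfl⟩ := e.toLinearEquiv.surjective b
    refine (congrArg e.toLinearEquiv.symm (e.map_der a).symm).trans ?_
    simp

/-- The composite of two isomorphisms of conformal superalgebras. -/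
def trans (e : ConformalEquiv SA SB) (e' : ConformalEquiv SB SC) : ConformalEquiv SA SC :=
  ofIsSemiHom (e.toLinearEquiv.trans e'.toLinearEquiv) (e'.isSemiHom.comp e.isSemiHom)

/-- Conjugation of an additive endomorphism by an isomorphism of conformal superalgebras. -/
def conj (φ : ConformalEquiv SA SB) (Γ : A →+ A) : B →+ B :=
  ((φ.toLinearEquiv : A →+ B).comp Γ).comp (φ.symm.toLinearEquiv : B →+ A)

variable (φ : ConformalEquiv SA SB) {Γ : A →+ A}

lemma isSemiHom_conj {γ : S →ₐ[k] S} (hΓ : IsSemiHom γ SA SA Γ) :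
    IsSemiHom γ SB SB (φ.conj Γ) :=
  (φ.isSemiHom.comp hΓ).comp φ.symm.isSemiHom

lemma conj_apply (x : A) : φ.conj Γ (φ.toLinearEquiv x) = φ.toLinearEquiv (Γ x) :=
  congrArg (fun y => φ.toLinearEquiv (Γ y)) (φ.toLinearEquiv.symm_apply_apply x)

lemma conj_iterate_apply (n : ℕ) (x : A) :
    (φ.conj Γ)^[n] (φ.toLinearEquiv x) = φ.toLinearEquiv (Γ^[n] x) :=
  (Function.Semiconj.iterate_right (f := φ.toLinearEquiv) (fun x => (φ.conj_apply x).symm) n x).symm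

lemma conj_injective (hΓ : Function.Injective Γ) : Function.Injective (φ.conj Γ) :=
  (φ.toLinearEquiv.injective.comp hΓ).comp φ.toLinearEquiv.symm.injective

end ConformalEquiv

section BaseChange

lemma apply_mem_of_mem_baseChange {R S S' A B : Type*} [CommRing R] [CommRing S] [Algebra R S]
    [AddCommGroup A] [Module R A] [Ring S'] [AddCommGroup B] [Module S' B] {γ : S → S'}
    {f : S ⊗[R] A →+ B} (hf : ∀ s x, f (s • x) = γ s • f x) {P : Submodule R A}
    {Q : Submodule S' B} (hPQ : ∀ a ∈ P, f (1 ⊗ₜ a) ∈ Q) {x : S ⊗[R] A}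
    (hx : x ∈ P.baseChange S) : f x ∈ Q := by
  rw [Submodule.baseChange_eq_span] at hx
  induction hx using Submodule.span_induction with
  | mem x h =>
    obtain ⟨a, ha, rfl⟩ := h
    exact hPQ a ha
  | zero => simp
  | add x y _ _ hx hy => simpa using add_mem hx hy
  | smul s x _ hx => simpa only [hf] using Q.smul_mem (γ s) hx

variable {k : Type*} [Field k] {R S : Type*} [CommRing R] [Algebra k R] [CommRing S] [Algebra k S]
  [Algebra R S] [IsScalarTower k R S]
  {A : Type*} [AddCommGroup A] [Module k A] [Module R A] [IsScalarTower k R A]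

lemma span_one_tmul : Submodule.span S (Set.range fun a : A => (1 : S) ⊗ₜ[R] a) = ⊤ := by
  rw [← Submodule.baseChange_top, Submodule.baseChange_eq_span, Submodule.map_top]
  rfl

lemma dividedPow_succ_one (δ : Derivation k S S) (j : ℕ) :
    dividedPow (δ : S →ₗ[k] S) (j + 1) 1 = 0 := by
  simp [dividedPow, pow_succ]

variable [CharZero k] {δR : Derivation k R R} {δS : Derivation k S S}

lemma baseChange_prod_one_tmul (hδ : ∀ r, δS (algebraMap R S r) = algebraMap R S (δR r))
    (SA : ConformalSuperalgebra k δR A) (n : ℕ) (a b : A) :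
    (SA.baseChange hδ).prod n (1 ⊗ₜ a) (1 ⊗ₜ b) = (1 : S) ⊗ₜ[R] SA.prod n a b := by
  change bcOp δS SA n 1 a (1 ⊗ₜ b) = _
  rw [bcOp_tmul, one_smul, finsum_eq_range _ 1]
  · simp [dividedPow_zero]
  · intro j hj
    obtain ⟨i, rfl⟩ := Nat.exists_eq_add_of_le' hj
    rw [dividedPow_succ_one, TensorProduct.zero_tmul]

lemma baseChange_der_one_tmul (hδ : ∀ r, δS (algebraMap R S r) = algebraMap R S (δR r))
    (SA : ConformalSuperalgebra k δR A) (a : A) :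
    (SA.baseChange hδ).der (1 ⊗ₜ a) = (1 : S) ⊗ₜ[R] SA.der a := by
  change bcDer hδ SA _ = _
  rw [bcDer_tmul, Derivation.map_one_eq_zero, TensorProduct.zero_tmul, zero_add]

lemma isSemiHom_one_tmul (hδ : ∀ r, δS (algebraMap R S r) = algebraMap R S (δR r))
    (SA : ConformalSuperalgebra k δR A) :
    IsSemiHom (IsScalarTower.toAlgHom k R S) SA (SA.baseChange hδ)
      (TensorProduct.mk R S A 1).toAddMonoidHom where
  map_smul r a := by simp
  map_even _ ha := Submodule.tmul_mem_baseChange_of_mem _ ha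
  map_odd _ ha := Submodule.tmul_mem_baseChange_of_mem _ ha
  map_der a := (baseChange_der_one_tmul hδ SA a).symm
  map_prod n a b := (baseChange_prod_one_tmul hδ SA n a b).symm

variable {S' : Type*} [CommRing S'] [Algebra k S'] {δ' : Derivation k S' S'}
  {B : Type*} [AddCommGroup B] [Module k B] [Module S' B] [IsScalarTower k S' B]

lemma ConformalSuperalgebra.IsSemiHom.of_baseChange
    {hδ : ∀ r, δS (algebraMap R S r) = algebraMap R S (δR r)}
    {SA : ConformalSuperalgebra k δR A} {SB : ConformalSuperalgebra k δ' B} {γ : S →ₐ[k] S'}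
    (hγ : ∀ s, γ (δS s) = δ' (γ s)) {f : S ⊗[R] A →+ B} (hf : ∀ s x, f (s • x) = γ s • f x)
    (h : IsSemiHom (γ.comp (IsScalarTower.toAlgHom k R S)) SA SB
      (f.comp (TensorProduct.mk R S A 1).toAddMonoidHom)) :
    IsSemiHom γ (SA.baseChange hδ) SB f where
  map_smul := hf
  map_even _ := apply_mem_of_mem_baseChange hf h.map_even
  map_odd _ := apply_mem_of_mem_baseChange hf h.map_odd
  map_der := by
    refine map_der_of_span hγ hf span_one_tmul ?_
    rintro _ ⟨a, rfl⟩
    rw [baseChange_der_one_tmul]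
    exact h.map_der a
  map_prod := by
    refine map_prod_of_span hγ hf span_one_tmul ?_
    rintro n _ ⟨a, rfl⟩ _ ⟨b, rfl⟩
    rw [baseChange_prod_one_tmul]
    exact h.map_prod n a b

lemma isSemiHom_cancelBaseChange {δk : Derivation k k k} {A : Type*} [AddCommGroup A] [Module k A]
    (hδ : ∀ r, δS (algebraMap R S r) = algebraMap R S (δR r))
    (hR : ∀ c, δR (algebraMap k R c) = algebraMap k R (δk c))
    (hS : ∀ c, δS (algebraMap k S c) = algebraMap k S (δk c))
    (SA : ConformalSuperalgebra k δk A) :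
    IsSemiHom (AlgHom.id k S) ((SA.baseChange hR).baseChange hδ) (SA.baseChange hS)
      (TensorProduct.AlgebraTensorModule.cancelBaseChange k R S S A :
        S ⊗[R] (R ⊗[k] A) →+ S ⊗[k] A) := by
  set e := TensorProduct.AlgebraTensorModule.cancelBaseChange k R S S A
  refine .of_baseChange (fun _ => rfl) (map_smul e) ?_
  refine .of_baseChange (fun r => (hδ r).symm) (fun r x => ?_) ?_
  · change e (1 ⊗ₜ (r • x)) = algebraMap R S r • e (1 ⊗ₜ x)
    rw [TensorProduct.tmul_smul, ← algebraMap_smul S, map_smul]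
  · convert isSemiHom_one_tmul hS SA
    · ext
    · exact AddMonoidHom.ext fun a => by simp [e]

/-- Transitivity of base change. -/
def baseChangeTrans {δk : Derivation k k k} {A : Type*} [AddCommGroup A] [Module k A]
    (hδ : ∀ r, δS (algebraMap R S r) = algebraMap R S (δR r))
    (hR : ∀ c, δR (algebraMap k R c) = algebraMap k R (δk c))
    (hS : ∀ c, δS (algebraMap k S c) = algebraMap k S (δk c))
    (SA : ConformalSuperalgebra k δk A) :
    ConformalEquiv ((SA.baseChange hR).baseChange hδ) (SA.baseChange hS) :=
  .ofIsSemiHom _ (isSemiHom_cancelBaseChange hδ hR hS SA)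

end BaseChange

section Twist

variable {k : Type*} [Field k] {R S : Type*} [CommRing R] [Algebra k R] [CommRing S] [Algebra k S]
  [Algebra R S] {A : Type*} [AddCommGroup A] [Module R A]

/-- The semilinear map `γ ⊗ τ` of a base change. -/
def twistMap (γ : S →ₐ[R] S) (τ : A →ₗ[R] A) : S ⊗[R] A →+ S ⊗[R] A :=
  (TensorProduct.map γ.toLinearMap τ).toAddMonoidHom

lemma twistMap_tmul (γ : S →ₐ[R] S) (τ : A →ₗ[R] A) (s : S) (a : A) :
    twistMap γ τ (s ⊗ₜ a) = γ s ⊗ₜ[R] τ a := rfl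

lemma twistMap_smul (γ : S →ₐ[R] S) (τ : A →ₗ[R] A) (s : S) (x : S ⊗[R] A) :
    twistMap γ τ (s • x) = γ s • twistMap γ τ x := by
  induction x using TensorProduct.induction_on with
  | zero => simp
  | add x y hx hy => simp only [smul_add, map_add, hx, hy]
  | tmul t a => simp only [TensorProduct.smul_tmul', twistMap_tmul, smul_eq_mul, map_mul]

lemma twistMap_injective {γ γ' : S →ₐ[R] S} {τ τ' : A →ₗ[R] A} (hγ : Function.LeftInverse γ' γ)
    (hτ : Function.LeftInverse τ' τ) : Function.Injective (twistMap γ τ) := by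
  refine Function.LeftInverse.injective (g := twistMap γ' τ') fun x => ?_
  induction x using TensorProduct.induction_on with
  | zero => simp
  | add x y hx hy => simp only [map_add, hx, hy]
  | tmul s a => simp only [twistMap_tmul, hγ s, hτ a]

lemma isSemiHom_twistMap [CharZero k] [IsScalarTower k R S] [Module k A] [IsScalarTower k R A]
    {δR : Derivation k R R} {δS : Derivation k S S}
    (hδ : ∀ r, δS (algebraMap R S r) = algebraMap R S (δR r)) {SA : ConformalSuperalgebra k δR A}
    {γ : S →ₐ[R] S} (hγ : ∀ s, γ (δS s) = δS (γ s)) {τ : A →ₗ[R] A}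
    (hτ : IsSemiHom (AlgHom.id k R) SA SA (τ : A →+ A)) :
    IsSemiHom (γ.restrictScalars k) (SA.baseChange hδ) (SA.baseChange hδ) (twistMap γ τ) := by
  refine .of_baseChange hγ (twistMap_smul γ τ) ?_
  convert (isSemiHom_one_tmul hδ SA).comp hτ using 1
  · ext r; simp
  · ext a; simp [twistMap_tmul]

end Twist

section RootCharacter

variable {k : Type*} [Field k]

/-- The characters `χ` of `ℚ` with kernel `ℤ`, i.e. the embeddings of `ℚ/ℤ` into `kˣ`. -/
def IsFaithfulModInt (χ : AddChar ℚ k) : Prop :=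
  ∀ q : ℚ, χ q = 1 ↔ ∃ n : ℤ, (n : ℚ) = q

namespace IsFaithfulModInt

variable {χ : AddChar ℚ k} (hχ : IsFaithfulModInt χ)
include hχ

lemma apply_intCast (n : ℤ) : χ n = 1 :=
  (hχ n).mpr ⟨n, rfl⟩

lemma inv : IsFaithfulModInt χ⁻¹ := fun q => by
  rw [AddChar.inv_apply, hχ]
  exact ⟨fun ⟨n, hn⟩ => ⟨-n, by simp [hn]⟩, fun ⟨n, hn⟩ => ⟨-n, by simp [hn]⟩⟩

lemma pow_eq_one_of_den_dvd {q : ℚ} {N : ℕ} (hN : q.den ∣ N) : χ q ^ N = 1 := by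
  obtain ⟨l, rfl⟩ := hN
  have h : χ q ^ q.den = 1 := by
    rw [← AddChar.map_nsmul_eq_pow, hχ]
    exact ⟨q.num, by rw [nsmul_eq_mul, Rat.den_mul_eq_num]⟩
  rw [pow_mul, h, one_pow]

lemma isPrimitiveRoot_one_div {m : ℕ} (hm : 0 < m) : IsPrimitiveRoot (χ (1 / m)) m := by
  have hm' : (m : ℚ) ≠ 0 := by exact_mod_cast hm.ne'
  rw [IsPrimitiveRoot.iff_def]
  simp only [← AddChar.map_nsmul_eq_pow, nsmul_eq_mul]
  refine ⟨(hχ _).mpr ⟨1, by simp [hm']⟩, fun l hl => ?_⟩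
  obtain ⟨n, hn⟩ := (hχ _).mp hl
  have h : (n * m : ℚ) = l := by rw [hn]; field_simp
  exact Int.natCast_dvd_natCast.mp ⟨n, by rw [mul_comm]; exact_mod_cast h.symm⟩

lemma exists_of_pow_eq_one {c : k} {m : ℕ} (hm : 0 < m) (hc : c ^ m = 1) : ∃ p : ℚ, χ p = c := by
  have : NeZero m := ⟨hm.ne'⟩
  obtain ⟨i, -, hi⟩ := (hχ.isPrimitiveRoot_one_div hm).eq_pow_of_pow_eq_one hc
  exact ⟨i • (1 / m : ℚ), by rw [AddChar.map_nsmul_eq_pow, hi]⟩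

end IsFaithfulModInt

variable {ξ : ℕ → k}

lemma root_zpow_num (hcompat : ∀ l m, 0 < l → 0 < m → ξ (l * m) ^ l = ξ m) {q : ℚ} {m : ℕ}
    (hm : 0 < m) {i : ℤ} (h : q * m = i) : ξ q.den ^ q.num = ξ m ^ i := by
  have hm' : (m : ℤ) ≠ 0 := by exact_mod_cast hm.ne'
  obtain ⟨c, hi, hmc⟩ := Rat.num_den_mk (q := q) hm' (by
    rw [Rat.divInt_eq_div, ← h, Int.cast_natCast, mul_div_cancel_right₀ _ (by exact_mod_cast hm')])
  have hc : 0 < c := by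
    refine pos_of_mul_pos_left (b := (q.den : ℤ)) ?_ (Int.natCast_nonneg _)
    rw [← hmc]
    exact_mod_cast hm
  lift c to ℕ using hc.le
  rw [hi, zpow_mul, zpow_natCast, show m = c * q.den by exact_mod_cast hmc,
    hcompat c q.den (by exact_mod_cast hc) q.den_pos]

/-- The character `i / m ↦ ξ_m ^ i` of `ℚ` attached to a compatible family of primitive roots of
unity. -/
def rootChar (hξ : ∀ m, 0 < m → IsPrimitiveRoot (ξ m) m)
    (hcompat : ∀ l m, 0 < l → 0 < m → ξ (l * m) ^ l = ξ m) : AddChar ℚ k where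
  toFun q := ξ q.den ^ q.num
  map_zero_eq_one' := by simp
  map_add_eq_mul' p q := by
    have hN : 0 < p.den * q.den := Nat.mul_pos p.den_pos q.den_pos
    have hp := Rat.mul_den_eq_num p
    have hq := Rat.mul_den_eq_num q
    rw [root_zpow_num hcompat hN (q := p) (i := p.num * q.den) (by push_cast; rw [← hp]; ring),
      root_zpow_num hcompat hN (q := q) (i := q.num * p.den) (by push_cast; rw [← hq]; ring),
      ← zpow_add₀ ((hξ _ hN).ne_zero hN.ne'), root_zpow_num hcompat hN]
    push_cast
    rw [← hp, ← hq]
    ring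

variable (hξ : ∀ m, 0 < m → IsPrimitiveRoot (ξ m) m)
  (hcompat : ∀ l m, 0 < l → 0 < m → ξ (l * m) ^ l = ξ m)

lemma rootChar_one_div {m : ℕ} (hm : 0 < m) : rootChar hξ hcompat (1 / m) = ξ m := by
  have hm' : (m : ℚ) ≠ 0 := by exact_mod_cast hm.ne'
  have h := root_zpow_num hcompat hm (q := 1 / m) (i := 1) (by simp [hm'])
  rwa [zpow_one] at h

lemma isFaithfulModInt_rootChar : IsFaithfulModInt (rootChar hξ hcompat) := fun q => by
  change ξ q.den ^ q.num = 1 ↔ _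
  rw [(hξ q.den q.den_pos).zpow_eq_one_iff_dvd]
  refine ⟨fun ⟨n, hn⟩ => ⟨n, ?_⟩, ?_⟩
  · rw [← Rat.num_div_den q, hn]
    push_cast
    rw [mul_div_cancel_left₀ _ (by exact_mod_cast q.den_ne_zero)]
  · rintro ⟨n, rfl⟩
    simp

end RootCharacter

section GaloisGenerator

variable {k : Type*} [Field k] {χ : AddChar ℚ k} (hχ : IsFaithfulModInt χ)

/-- The automorphism `t^q ↦ χ(q) t^q` of `k[t^q | q ∈ ℚ]`, a topological generator of its Galois
group over `k[t, t⁻¹]`. -/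
def galoisGen : RatLaurent k →ₐ[LaurentPolynomial k] RatLaurent k :=
  let γ : RatLaurent k →ₐ[k] RatLaurent k := AddMonoidAlgebra.lift k (RatLaurent k) ℚ
    { toFun := fun q => AddMonoidAlgebra.single q.toAdd (χ q.toAdd)
      map_one' := by rw [toAdd_one, χ.map_zero_eq_one]; rfl
      map_mul' := fun p q => by
        rw [AddMonoidAlgebra.single_mul_single, toAdd_mul, χ.map_add_eq_mul] }
  { γ with
    commutes' := fun r => by
      change γ _ = _
      induction r using AddMonoidAlgebra.induction_linear with
      | zero => simp
      | add x y hx hy => simp only [map_add, hx, hy]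
      | single n a =>
        rw [algebraMap_ratLaurent_single]
        simp [γ, hχ.apply_intCast] }

lemma galoisGen_single (q : ℚ) (c : k) : galoisGen hχ (AddMonoidAlgebra.single q c) =
    AddMonoidAlgebra.single q (c * χ q) := by
  refine (AddMonoidAlgebra.lift_single _ _ _).trans ?_
  simp

lemma galoisGen_leftInverse : Function.LeftInverse (galoisGen hχ.inv) (galoisGen hχ) := fun s => by
  induction s using AddMonoidAlgebra.induction_linear with
  | zero => simp
  | add x y hx hy => simp only [map_add, hx, hy]
  | single q c =>
    rw [galoisGen_single, galoisGen_single, mul_assoc, ← AddChar.mul_apply, mul_inv_cancel,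
      AddChar.one_apply, mul_one]

lemma galoisGen_der [CharZero k] (s : RatLaurent k) :
    galoisGen hχ (ratLaurentDer k s) = ratLaurentDer k (galoisGen hχ s) := by
  induction s using AddMonoidAlgebra.induction_linear with
  | zero => simp
  | add x y hx hy => simp only [map_add, hx, hy]
  | single q c =>
    have h : χ (q - 1) = χ q := by
      have h1 : χ ((1 : ℤ) : ℚ) = 1 := hχ.apply_intCast 1
      rw [← sub_add_cancel q 1, χ.map_add_eq_mul, add_sub_cancel_right, ← Int.cast_one, h1, mul_one]
    simp only [ratLaurentDer, powerDer_single, galoisGen_single, h]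
    congr 1
    ring

end GaloisGenerator

section Descent

variable {k : Type*} [Field k]

/-- The projection of `k[t^q | q ∈ ℚ]` onto `k[t, t⁻¹]` that forgets the nonintegral exponents. -/
def integralPart : RatLaurent k →ₗ[LaurentPolynomial k] LaurentPolynomial k where
  toFun s := .ofCoeff (Finsupp.comapDomain (Int.cast : ℤ → ℚ) s.coeff Int.cast_injective.injOn)
  map_add' s t := by ext; simp
  map_smul' r s := by
    induction r using AddMonoidAlgebra.induction_linear with
    | zero => ext; simp
    | add x y hx hy =>
      rw [add_smul, map_add, add_smul, ← hx, ← hy]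
      ext
      simp
    | single n a =>
      ext m
      rw [Algebra.smul_def, algebraMap_ratLaurent_single, RingHom.id_apply, smul_eq_mul,
        AddMonoidAlgebra.coeff_single_mul_apply, Finsupp.comapDomain_apply,
        AddMonoidAlgebra.coeff_single_mul_apply]
      simp

lemma integralPart_single_intCast (n : ℤ) (c : k) :
    integralPart (AddMonoidAlgebra.single (n : ℚ) c) = AddMonoidAlgebra.single n c := by
  ext m
  simp [integralPart]

lemma integralPart_single_eq_zero {q : ℚ} (hq : ∀ n : ℤ, (n : ℚ) ≠ q) (c : k) :
    integralPart (AddMonoidAlgebra.single q c) = 0 := by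
  ext m
  simp [integralPart, (hq m).symm]

variable {F : Type*} [AddCommGroup F] [Module (LaurentPolynomial k) F]

variable (F) in
/-- The retraction of `f ↦ 1 ⊗ f` induced by `integralPart`. -/
def integralRetraction : RatLaurent k ⊗[LaurentPolynomial k] F →ₗ[LaurentPolynomial k] F :=
  TensorProduct.lid (LaurentPolynomial k) F ∘ₗ integralPart.rTensor F

lemma integralRetraction_tmul (s : RatLaurent k) (f : F) :
    integralRetraction F (s ⊗ₜ f) = integralPart s • f := by
  simp [integralRetraction]

lemma integralRetraction_one_tmul (f : F) :
    integralRetraction F ((1 : RatLaurent k) ⊗ₜ f) = f := by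
  have h : integralPart (1 : RatLaurent k) = 1 := by
    exact_mod_cast integralPart_single_intCast (k := k) 0 1
  rw [integralRetraction_tmul, h, one_smul]

lemma one_tmul_injective (F : Type*) [AddCommGroup F] [Module (LaurentPolynomial k) F] :
    Function.Injective fun f : F => (1 : RatLaurent k) ⊗ₜ[LaurentPolynomial k] f :=
  Function.LeftInverse.injective integralRetraction_one_tmul

/-- Induction on a common denominator of the exponents that occur in an element. -/
lemma exists_forall_dvd {P : ℕ → RatLaurent k ⊗[LaurentPolynomial k] F → Prop}
    (hadd : ∀ N x y, P N x → P N y → P N (x + y))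
    (hsingle : ∀ N q c f, q.den ∣ N → P N (AddMonoidAlgebra.single q c ⊗ₜ f))
    (x : RatLaurent k ⊗[LaurentPolynomial k] F) : ∃ M, 0 < M ∧ ∀ N, M ∣ N → P N x := by
  have hadd' : ∀ x y, (∃ M, 0 < M ∧ ∀ N, M ∣ N → P N x) → (∃ M, 0 < M ∧ ∀ N, M ∣ N → P N y) →
      ∃ M, 0 < M ∧ ∀ N, M ∣ N → P N (x + y) := by
    rintro x y ⟨M, hM, hx⟩ ⟨M', hM', hy⟩
    exact ⟨M * M', Nat.mul_pos hM hM', fun N hN =>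
      hadd N x y (hx N (dvd_of_mul_right_dvd hN)) (hy N (dvd_of_mul_left_dvd hN))⟩
  have hzero : ∀ N, P N 0 := fun N => by
    simpa using hsingle N 0 0 0 (by simp)
  induction x using TensorProduct.induction_on with
  | zero => exact ⟨1, one_pos, fun N _ => hzero N⟩
  | add x y hx hy => exact hadd' x y hx hy
  | tmul s f =>
    induction s using AddMonoidAlgebra.induction_linear with
    | zero => exact ⟨1, one_pos, fun N _ => by simpa using hzero N⟩
    | add x y hx hy => simpa only [TensorProduct.add_tmul] using hadd' _ _ hx hy
    | single q c => exact ⟨q.den, q.den_pos, fun N hN => hsingle N q c f hN⟩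

variable {χ : AddChar ℚ k} (hχ : IsFaithfulModInt χ)

lemma twistMap_galoisGen_iterate_single_tmul (i : ℕ) (q : ℚ) (c : k) (f : F) :
    (twistMap (galoisGen hχ) LinearMap.id)^[i] (AddMonoidAlgebra.single q c ⊗ₜ f) =
      AddMonoidAlgebra.single q (c * χ q ^ i) ⊗ₜ[LaurentPolynomial k] f := by
  induction i with
  | zero => simp
  | succ i ih =>
    rw [Function.iterate_succ_apply', ih, twistMap_tmul, galoisGen_single, pow_succ, mul_assoc,
      LinearMap.id_apply]

lemma exists_twistMap_galoisGen_iterate_eq (x : RatLaurent k ⊗[LaurentPolynomial k] F) :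
    ∃ M, 0 < M ∧ ∀ N, M ∣ N → (twistMap (galoisGen hχ) LinearMap.id)^[N] x = x := by
  refine exists_forall_dvd (P := fun N x => (twistMap (galoisGen hχ) LinearMap.id)^[N] x = x)
    (fun N x y hx hy => ?_) (fun N q c f hN => ?_) x
  · rw [iterate_map_add, hx, hy]
  · rw [twistMap_galoisGen_iterate_single_tmul, hχ.pow_eq_one_of_den_dvd hN, mul_one]

/-- The trace over a long enough part of the orbit of `x` only sees the integral exponents. -/
lemma exists_sum_twistMap_galoisGen_iterate (x : RatLaurent k ⊗[LaurentPolynomial k] F) :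
    ∃ M, 0 < M ∧ ∀ N, M ∣ N →
      ∑ i ∈ Finset.range N, (twistMap (galoisGen hχ) LinearMap.id)^[i] x =
        N • (1 ⊗ₜ integralRetraction F x) := by
  refine exists_forall_dvd
    (P := fun N x => ∑ i ∈ Finset.range N, (twistMap (galoisGen hχ) LinearMap.id)^[i] x =
      N • (1 ⊗ₜ integralRetraction F x))
    (fun N x y hx hy => ?_) (fun N q c f hN => ?_) x
  · simp only [iterate_map_add, Finset.sum_add_distrib, hx, hy, map_add, TensorProduct.tmul_add,
      smul_add]
  simp only [twistMap_galoisGen_iterate_single_tmul, integralRetraction_tmul]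
  by_cases hq : ∃ n : ℤ, (n : ℚ) = q
  · obtain ⟨n, rfl⟩ := hq
    simp only [hχ.apply_intCast, one_pow, mul_one, Finset.sum_const, Finset.card_range]
    rw [integralPart_single_intCast, ← TensorProduct.smul_tmul, Algebra.smul_def,
      algebraMap_ratLaurent_single, mul_one]
  · have hone : χ q ≠ 1 := mt (hχ q).mp hq
    rw [integralPart_single_eq_zero (by simpa using hq), zero_smul, TensorProduct.tmul_zero,
      smul_zero, ← TensorProduct.sum_tmul]
    refine (congrArg (· ⊗ₜ[LaurentPolynomial k] f)
      (map_sum (AddMonoidAlgebra.singleAddHom q) _ _).symm).trans ?_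
    rw [← Finset.mul_sum, geom_sum_eq hone, hχ.pow_eq_one_of_den_dvd hN]
    simp

lemma exists_one_tmul_of_twistMap_eq [CharZero k] {x : RatLaurent k ⊗[LaurentPolynomial k] F}
    (hx : twistMap (galoisGen hχ) LinearMap.id x = x) : ∃ f : F, 1 ⊗ₜ f = x := by
  obtain ⟨M, hM, h⟩ := exists_sum_twistMap_galoisGen_iterate hχ x
  have h := h M dvd_rfl
  simp only [Function.iterate_fixed hx, Finset.sum_const, Finset.card_range] at h
  have hM' : (M : k) ≠ 0 := by exact_mod_cast hM.ne'
  rw [← Nat.cast_smul_eq_nsmul k, ← Nat.cast_smul_eq_nsmul k] at h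
  exact ⟨_, (smul_right_injective _ hM' h).symm⟩

end Descent

section Units

lemma exists_unit_eq_single {k G : Type*} [Semiring k] [NoZeroDivisors k] [Nontrivial k]
    [AddMonoid G] [TwoUniqueSums G] (u : (AddMonoidAlgebra k G)ˣ) :
    ∃ (q : G) (c : k), c ≠ 0 ∧ (u : AddMonoidAlgebra k G) = AddMonoidAlgebra.single q c := by
  set X := (u : AddMonoidAlgebra k G).coeff.support with hX
  set Y := (↑u⁻¹ : AddMonoidAlgebra k G).coeff.support with hY
  have hX0 : X.Nonempty := by simp [hX, Finsupp.support_nonempty_iff]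
  have hY0 : Y.Nonempty := by simp [hY, Finsupp.support_nonempty_iff]
  have hsum : ∀ r ∈ X ×ˢ Y, UniqueAdd X Y r.1 r.2 → r.1 + r.2 = 0 := by
    intro r hr hu
    rw [Finset.mem_product] at hr
    by_contra hne
    have h := AddMonoidAlgebra.coeff_mul_add_of_uniqueAdd hu
    rw [u.mul_inv, AddMonoidAlgebra.one_def, AddMonoidAlgebra.coeff_single,
      Finsupp.single_eq_of_ne hne] at h
    exact mul_ne_zero (Finsupp.mem_support_iff.mp hr.1) (Finsupp.mem_support_iff.mp hr.2) h.symm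
  have hcard : X.card * Y.card ≤ 1 := by
    by_contra hc
    obtain ⟨p, hp, q, hq, hpq, up, uq⟩ :=
      TwoUniqueSums.uniqueAdd_of_one_lt_card (not_le.mp hc)
    obtain ⟨h1, h2⟩ := up (Finset.mem_product.mp hq).1 (Finset.mem_product.mp hq).2
      ((hsum q hq uq).trans (hsum p hp up).symm)
    exact hpq (Prod.ext h1.symm h2.symm)
  have hone : X.card = 1 :=
    le_antisymm ((Nat.le_mul_of_pos_right _ hY0.card_pos).trans hcard) hX0.card_pos
  obtain ⟨q, c, hc, h⟩ := Finsupp.card_support_eq_one'.mp hone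
  exact ⟨q, c, hc, AddMonoidAlgebra.coeff_injective h⟩

end Units

instance : DecidableEq N2Gen := Classical.decEq N2Gen

section Coordinates

open Polynomial

section Field

variable (k : Type*) [Field k]

/-- The element `∂^i c` of the `N = 2` conformal superalgebra, for a generator `c`. -/
def n2Mono (c : N2Gen) (i : ℕ) : N2 k := Pi.single c (X ^ i)

lemma n2_prod_apply (n : ℕ) (f g : N2 k) (c : N2Gen) :
    (n2Conformal k).prod n f g c = (n.factorial : k) • (n2Bracket k f g c).coeff n := rfl

lemma n2_der_apply (f : N2 k) (c : N2Gen) : (n2Conformal k).der f c = X * f c := rfl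

lemma n2_der_mono (c : N2Gen) (i : ℕ) :
    (n2Conformal k).der (n2Mono k c i) = n2Mono k c (i + 1) := by
  funext d
  rw [n2_der_apply]
  obtain rfl | h := eq_or_ne d c
  · simp [n2Mono, pow_succ']
  · simp [n2Mono, h]

lemma n2Bracket_mono (a b c : N2Gen) (i j : ℕ) :
    n2Bracket k (n2Mono k a i) (n2Mono k b j) c =
      (-X : k[X][X]) ^ i * (C X + X) ^ j * n2Struct k a b c := by
  rw [n2Bracket, Finset.sum_eq_single a, Finset.sum_eq_single b]
  · simp [n2Mono]
  · intro b' _ hb; simp [n2Mono, hb]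
  · simp
  · intro a' _ ha; simp [n2Mono, ha]
  · simp

variable {k}

lemma n2_prod_mono_apply {a b c : N2Gen} {r : ℕ} {κ : k} (hr : (n2Struct k a b c).natDegree ≤ r)
    (hκ : (n2Struct k a b c).coeff r = C κ) (i j n : ℕ) (hn : i + j + r ≤ n) :
    (n2Conformal k).prod n (n2Mono k a i) (n2Mono k b j) c =
      if i + j + r = n then C ((-1) ^ i * n.factorial * κ) else 0 := by
  rw [n2_prod_apply, n2Bracket_mono]
  have hi : ((-X : k[X][X]) ^ i).natDegree ≤ i := by
    rw [neg_pow (X : k[X][X]), ← C_1, ← C_neg, ← C_pow]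
    exact natDegree_C_mul_X_pow_le _ _
  have hj : ((C X + X : k[X][X]) ^ j).natDegree ≤ j := by
    simp
  split_ifs with h
  · have hic : ((-X : k[X][X]) ^ i).coeff i = C ((-1) ^ i) := by
      rw [neg_pow (X : k[X][X]), ← C_1, ← C_neg, ← C_pow, coeff_C_mul_X_pow, if_pos rfl]
      simp
    have hjc : ((C X + X : k[X][X]) ^ j).coeff j = 1 := by
      rw [add_comm, coeff_X_add_C_pow]
      simp
    rw [← h, coeff_mul_add_eq_of_natDegree_le (natDegree_mul_le_of_le hi hj) hr,
      coeff_mul_add_eq_of_natDegree_le hi hj, hκ, hic, hjc, mul_one, ← C_mul, smul_C, smul_eq_mul,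
      mul_left_comm, mul_assoc]
  · rw [coeff_eq_zero_of_natDegree_lt, smul_zero]
    exact (natDegree_mul_le_of_le (natDegree_mul_le_of_le hi hj) hr).trans_lt (hn.lt_of_ne h)

variable {S : Type*} [CommRing S] [Algebra k S]

/-- The coordinate of an element of `S ⊗ A` with respect to a generator of `A`: a polynomial in `∂`
with coefficients in `S`. -/
def n2Coord (S : Type*) [CommRing S] [Algebra k S] (c : N2Gen) : S ⊗[k] N2 k →ₗ[S] S[X] :=
  LinearMap.liftBaseChange S
    ((Polynomial.mapAlgHom (Algebra.ofId k S)).toLinearMap ∘ₗ LinearMap.proj c)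

lemma n2Coord_tmul (c : N2Gen) (s : S) (f : N2 k) :
    n2Coord S c (s ⊗ₜ f) = s • (f c).map (algebraMap k S) :=
  LinearMap.liftBaseChange_tmul ..

lemma n2Coord_mono (c d : N2Gen) (s : S) (i : ℕ) :
    n2Coord S c (s ⊗ₜ n2Mono k d i) = if c = d then monomial i s else 0 := by
  rw [n2Coord_tmul]
  split_ifs with h
  · simp [h, n2Mono, smul_eq_C_mul, C_mul_X_pow_eq_monomial]
  · simp [n2Mono, h]

lemma sum_n2Coord (x : S ⊗[k] N2 k) :
    ∑ c, (n2Coord S c x).sum (fun i s => s ⊗ₜ n2Mono k c i) = x := by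
  have hadd (c : N2Gen) (p q : S[X]) : (p + q).sum (fun i s => s ⊗ₜ[k] n2Mono k c i) =
      p.sum (fun i s => s ⊗ₜ n2Mono k c i) + q.sum (fun i s => s ⊗ₜ n2Mono k c i) :=
    sum_add_index p q _ (fun _ => TensorProduct.zero_tmul _ _)
      (fun _ _ _ => TensorProduct.add_tmul _ _ _)
  have hsingle (s : S) (c : N2Gen) (p : k[X]) : (s • p.map (algebraMap k S)).sum
      (fun i s => s ⊗ₜ[k] n2Mono k c i) = s ⊗ₜ Pi.single c p := by
    induction p using Polynomial.induction_on' with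
    | add p q hp hq =>
      rw [Polynomial.map_add, smul_add, hadd, hp, hq, Pi.single_add, TensorProduct.tmul_add]
    | monomial i r =>
      rw [map_monomial, smul_monomial, sum_monomial_index _ (fun i s => s ⊗ₜ[k] n2Mono k c i)
          (TensorProduct.zero_tmul _ _), smul_eq_mul, mul_comm, ← Algebra.smul_def,
        TensorProduct.smul_tmul, n2Mono, ← Pi.single_smul, smul_X_eq_monomial]
  induction x using TensorProduct.induction_on with
  | zero => simp
  | add x y hx hy => simp only [map_add, hadd, Finset.sum_add_distrib, hx, hy]
  | tmul s f =>
    simp only [n2Coord_tmul, hsingle]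
    rw [← TensorProduct.tmul_sum, Finset.univ_sum_single]

lemma n2Coord_ext {x y : S ⊗[k] N2 k} (h : ∀ c, n2Coord S c x = n2Coord S c y) : x = y := by
  rw [← sum_n2Coord x, ← sum_n2Coord y]
  simp only [h]

lemma n2Coord_eq_zero_of_mem_baseChange {P : Submodule k (N2 k)} {c : N2Gen}
    (hP : ∀ f ∈ P, f c = 0) {x : S ⊗[k] N2 k} (hx : x ∈ P.baseChange S) : n2Coord S c x = 0 := by
  refine (Submodule.mem_bot S).mp <|
    apply_mem_of_mem_baseChange (f := (n2Coord S c).toAddMonoidHom) (γ := id)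
      (fun s x => map_smul (n2Coord S c) s x) (fun f hf => ?_) hx
  simp [n2Coord_tmul, hP f hf]

variable (k S) in
/-- The generators of `S ⊗ A`. -/
def n2G (c : N2Gen) : S ⊗[k] N2 k := 1 ⊗ₜ n2Mono k c 0

lemma n2Coord_smul_n2G (c d : N2Gen) (s : S) :
    n2Coord S c (s • n2G k S d) = if c = d then C s else 0 := by
  rw [n2G, TensorProduct.smul_tmul', smul_eq_mul, mul_one, n2Coord_mono]
  rfl

lemma smul_n2G_injective (c : N2Gen) : Function.Injective fun s : S => s • n2G k S c :=
  fun s s' h => C_injective <| by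
    simpa only [n2Coord_smul_n2G, if_true] using congrArg (n2Coord S c) h

lemma n2G_ne_zero [Nontrivial S] (c : N2Gen) : n2G k S c ≠ 0 := fun h =>
  one_ne_zero (smul_n2G_injective (k := k) (S := S) c (by simpa using h))

end Field

variable {k : Type*} [Field k] [CharZero k] {S : Type*} [CommRing S] [Algebra k S]

lemma n2G_ne_neg [Nontrivial S] (c : N2Gen) : n2G k S c ≠ -n2G k S c := fun h =>
  n2G_ne_zero c <| (smul_eq_zero_iff_right (two_ne_zero' k)).mp <|
    (two_smul k _).trans (eq_neg_iff_add_eq_zero.mp h)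

variable {δ : Derivation k S S}

variable (δ) in
/-- The `N = 2` conformal superalgebra over a differential algebra. -/
abbrev n2Over : ConformalSuperalgebra k δ (S ⊗[k] N2 k) :=
  (n2Conformal k).baseChange (der_algebraMap_base δ)

lemma n2Coord_of_mem_even {x : S ⊗[k] N2 k} (hx : x ∈ (n2Over δ).even) :
    n2Coord S .Gp x = 0 ∧ n2Coord S .Gm x = 0 :=
  ⟨n2Coord_eq_zero_of_mem_baseChange (fun _ (hf : _ ∧ _) => hf.1) hx,
    n2Coord_eq_zero_of_mem_baseChange (fun _ (hf : _ ∧ _) => hf.2) hx⟩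

lemma n2Coord_of_mem_odd {x : S ⊗[k] N2 k} (hx : x ∈ (n2Over δ).odd) :
    n2Coord S .L x = 0 ∧ n2Coord S .J x = 0 :=
  ⟨n2Coord_eq_zero_of_mem_baseChange (fun _ (hf : _ ∧ _) => hf.1) hx,
    n2Coord_eq_zero_of_mem_baseChange (fun _ (hf : _ ∧ _) => hf.2) hx⟩

lemma n2Coord_prod_mono (a b c : N2Gen) (i j n : ℕ) (s t : S) : ∃ N,
    n2Coord S c ((n2Over δ).prod n (s ⊗ₜ n2Mono k a i) (t ⊗ₜ n2Mono k b j)) =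
      t • ∑ l ∈ Finset.range (N + 1), dividedPow (δ : S →ₗ[k] S) l s •
        ((n2Conformal k).prod (n + l) (n2Mono k a i) (n2Mono k b j) c).map (algebraMap k S) := by
  obtain ⟨N, hN⟩ := (n2Conformal k).prod_eventually_zero (n2Mono k a i) (n2Mono k b j)
  refine ⟨N, ?_⟩
  change n2Coord S c (bcOp δ (n2Conformal k) n s (n2Mono k a i) (t ⊗ₜ n2Mono k b j)) = _
  rw [bcOp_tmul, finsum_eq_range _ (N + 1)
    (fun l hl => by rw [hN _ (by omega), TensorProduct.tmul_zero]), map_smul, map_sum]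
  simp only [n2Coord_tmul]

lemma n2Coord_prod_mono_top {a b c : N2Gen} {r : ℕ} {κ : k}
    (hr : (n2Struct k a b c).natDegree ≤ r)
    (hκ : (n2Struct k a b c).coeff r = C κ) (i j n : ℕ) (hn : i + j + r ≤ n) (s t : S) :
    n2Coord S c ((n2Over δ).prod n (s ⊗ₜ n2Mono k a i) (t ⊗ₜ n2Mono k b j)) =
      if i + j + r = n then C (((-1) ^ i * n.factorial * κ : k) • (s * t)) else 0 := by
  obtain ⟨N, hN⟩ := n2Coord_prod_mono (δ := δ) a b c i j n s t
  rw [hN, Finset.sum_eq_single 0]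
  · rw [add_zero, dividedPow_zero, n2_prod_mono_apply hr hκ i j n hn]
    split_ifs
    · rw [map_C, smul_C, smul_C, smul_eq_mul, smul_eq_mul, Algebra.smul_def, ← mul_assoc, mul_comm,
        mul_comm t]
    · simp
  · intro l _ hl
    rw [n2_prod_mono_apply hr hκ i j (n + l) (by omega), if_neg (by omega)]
    simp
  · simp

lemma n2Coord_prod_mono_eq_zero {a b c : N2Gen} (h : n2Struct k a b c = 0) (i j n : ℕ) (s t : S) :
    n2Coord S c ((n2Over δ).prod n (s ⊗ₜ n2Mono k a i) (t ⊗ₜ n2Mono k b j)) = 0 := by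
  obtain ⟨N, hN⟩ := n2Coord_prod_mono (δ := δ) a b c i j n s t
  simp [hN, n2_prod_apply, n2Bracket_mono, h]

lemma n2Coord_prod_sum (n : ℕ) (x y : S ⊗[k] N2 k) (c : N2Gen) :
    n2Coord S c ((n2Over δ).prod n x y) = ∑ a, ∑ b, (n2Coord S a x).sum fun i s =>
      (n2Coord S b y).sum fun j t =>
        n2Coord S c ((n2Over δ).prod n (s ⊗ₜ n2Mono k a i) (t ⊗ₜ n2Mono k b j)) := by
  conv_lhs => rw [← sum_n2Coord x, ← sum_n2Coord y]
  simp only [Polynomial.sum, map_sum, LinearMap.sum_apply]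
  rw [Finset.sum_comm]
  refine Finset.sum_congr rfl fun a _ => ?_
  rw [Finset.sum_comm]
  exact Finset.sum_congr rfl fun b _ => Finset.sum_comm

/-- The component along `c` of the brackets of `x` and `y` involves only the components of `x` and
`y` along `a` and `b`, respectively. -/
def OnlyPair (a b c : N2Gen) (x y : S ⊗[k] N2 k) : Prop :=
  ∀ a' b', (a', b') ≠ (a, b) → n2Coord S a' x = 0 ∨ n2Coord S b' y = 0 ∨ n2Struct k a' b' c = 0

lemma OnlyPair.n2Coord_prod {a b c : N2Gen} {x y : S ⊗[k] N2 k} (h : OnlyPair a b c x y) (n : ℕ) :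
    n2Coord S c ((n2Over δ).prod n x y) = (n2Coord S a x).sum fun i s =>
      (n2Coord S b y).sum fun j t =>
        n2Coord S c ((n2Over δ).prod n (s ⊗ₜ n2Mono k a i) (t ⊗ₜ n2Mono k b j)) := by
  have hzero (a' b' : N2Gen) (hne : (a', b') ≠ (a, b)) : ((n2Coord S a' x).sum fun i s =>
      (n2Coord S b' y).sum fun j t =>
        n2Coord S c ((n2Over δ).prod n (s ⊗ₜ n2Mono k a' i) (t ⊗ₜ n2Mono k b' j))) = 0 := by
    rcases h a' b' hne with h | h | h
    · simp [h]
    · simp [h, Polynomial.sum]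
    · simp [Polynomial.sum, n2Coord_prod_mono_eq_zero h]
  rw [n2Coord_prod_sum, Finset.sum_eq_single a, Finset.sum_eq_single b]
  · exact fun b' _ hb => hzero a b' (by simp [hb])
  · simp
  · exact fun a' _ ha => Finset.sum_eq_zero fun b' _ => hzero a' b' (by simp [ha])
  · simp

lemma OnlyPair.n2Coord_prod_top {a b c : N2Gen} {r : ℕ} {κ : k}
    (hr : (n2Struct k a b c).natDegree ≤ r) (hκ : (n2Struct k a b c).coeff r = C κ)
    {x y : S ⊗[k] N2 k} (h : OnlyPair a b c x y) {d e : ℕ} (hd : (n2Coord S a x).natDegree = d)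
    (he : (n2Coord S b y).natDegree = e) :
    n2Coord S c ((n2Over δ).prod (d + e + r) x y) =
      C (((-1) ^ d * (d + e + r).factorial * κ : k) •
        ((n2Coord S a x).leadingCoeff * (n2Coord S b y).leadingCoeff)) := by
  have hsum (i : ℕ) (s : S) : ((n2Coord S b y).sum fun j t => n2Coord S c
        ((n2Over δ).prod (d + e + r) (s ⊗ₜ n2Mono k a i) (t ⊗ₜ n2Mono k b j))) =
      ∑ j ∈ Finset.range (e + 1), n2Coord S c ((n2Over δ).prod (d + e + r)
        (s ⊗ₜ n2Mono k a i) ((n2Coord S b y).coeff j ⊗ₜ n2Mono k b j)) :=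
    he ▸ sum_over_range _ (by simp)
  have hlow (i j : ℕ) (hij : i + j < d + e) (s t : S) : n2Coord S c
      ((n2Over δ).prod (d + e + r) (s ⊗ₜ n2Mono k a i) (t ⊗ₜ n2Mono k b j)) = 0 := by
    rw [n2Coord_prod_mono_top hr hκ i j _ (by omega), if_neg (by omega)]
  simp only [h.n2Coord_prod, hsum]
  rw [sum_over_range _ (by simp), hd, Finset.sum_range_succ, Finset.sum_range_succ,
    Finset.sum_eq_zero, Finset.sum_eq_zero, zero_add, zero_add,
    n2Coord_prod_mono_top hr hκ d e _ le_rfl, if_pos rfl, leadingCoeff, leadingCoeff, hd, he]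
  · exact fun j hj => hlow d j (by simpa using hj) _ _
  · refine fun i hi => Finset.sum_eq_zero fun j hj => hlow i j ?_ _ _
    rw [Finset.mem_range] at hi hj
    omega

lemma OnlyPair.prod_ne_zero [IsDomain S] {a b c : N2Gen} {r : ℕ} {κ : k} (hκ0 : κ ≠ 0)
    (hr : (n2Struct k a b c).natDegree ≤ r) (hκ : (n2Struct k a b c).coeff r = C κ)
    {x y : S ⊗[k] N2 k} (h : OnlyPair a b c x y) (hx : n2Coord S a x ≠ 0)
    (hy : n2Coord S b y ≠ 0) :
    (n2Over δ).prod ((n2Coord S a x).natDegree + (n2Coord S b y).natDegree + r) x y ≠ 0 := by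
  intro h0
  have htop := h.n2Coord_prod_top (δ := δ) hr hκ rfl rfl
  rw [h0, map_zero, eq_comm, C_eq_zero, smul_eq_zero] at htop
  rcases htop with h' | h'
  · exact mul_ne_zero (mul_ne_zero (pow_ne_zero _ (neg_ne_zero.mpr one_ne_zero))
      (Nat.cast_ne_zero.mpr (Nat.factorial_ne_zero _))) hκ0 h'
  · exact mul_ne_zero (leadingCoeff_ne_zero.mpr hx) (leadingCoeff_ne_zero.mpr hy) h'

lemma n2Coord_L_eq_zero [IsDomain S] {x : S ⊗[k] N2 k} (hx : x ∈ (n2Over δ).even)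
    (hxx : ∀ n, (n2Over δ).prod n x x = 0) : n2Coord S .L x = 0 := by
  obtain ⟨hxp, hxm⟩ := n2Coord_of_mem_even hx
  have hpair : OnlyPair .L .L .L x x := by
    rintro (_ | _ | _ | _) (_ | _ | _ | _) h <;> simp_all [n2Struct]
  by_contra h
  refine hpair.prod_ne_zero (r := 1) (κ := 2) two_ne_zero ?_ ?_ h h (hxx _)
  · simp only [n2Struct]; compute_degree
  · simp only [n2Struct]; simp [coeff_ofNat_mul]; rfl

/-- If `x` has only a `J`-component and `[x_λ y] = y`, then `x` and the component of `y` along `g`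
are constant, since otherwise the bracket would have positive degree in `λ`. -/
lemma eigenvalue_of_prod_eq_self [IsDomain S] {x y : S ⊗[k] N2 k}
    (hx : ∀ c, c ≠ .J → n2Coord S c x = 0) (hy : y ∈ (n2Over δ).odd)
    (hxy : (n2Over δ).prod 0 x y = y) (hxy' : ∀ n, (n2Over δ).prod (n + 1) x y = 0)
    {g : N2Gen} {κ : k} (hκ : κ ≠ 0) (hg : n2Struct k .J g g = C (C κ))
    (hyg : n2Coord S g y ≠ 0) :
    κ • x = n2G k S .J ∧ ∃ α : S, n2Coord S g y = C α := by
  obtain ⟨hyL, hyJ⟩ := n2Coord_of_mem_odd hy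
  have hpair : OnlyPair .J g g x y := by
    rintro a b hab
    by_cases ha : a = .J
    · subst ha
      cases b <;> cases g <;> simp_all [n2Struct]
    · exact Or.inl (hx a ha)
  have hr : (n2Struct k .J g g).natDegree ≤ 0 := by rw [hg, natDegree_C]
  have hc : (n2Struct k .J g g).coeff 0 = C κ := by rw [hg, coeff_C_zero]
  have hxJ : n2Coord S .J x ≠ 0 := by
    intro h
    have hx0 : x = 0 := n2Coord_ext fun c => by by_cases hc : c = .J <;> simp [*]
    rw [← hxy, hx0] at hyg
    simp at hyg
  have hdeg : (n2Coord S .J x).natDegree + (n2Coord S g y).natDegree = 0 := by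
    by_contra hne
    obtain ⟨n, hn⟩ := Nat.exists_eq_succ_of_ne_zero hne
    exact hpair.prod_ne_zero hκ hr hc hxJ hyg (by rw [hn]; exact hxy' n)
  obtain ⟨hdx, hdy⟩ := Nat.add_eq_zero_iff.mp hdeg
  obtain ⟨q, hq⟩ := natDegree_eq_zero.mp hdx
  obtain ⟨α, hα⟩ := natDegree_eq_zero.mp hdy
  have hα0 : α ≠ 0 := by rintro rfl; exact hyg (by rw [← hα, C_0])
  have htop := hpair.n2Coord_prod_top (δ := δ) hr hc hdx hdy
  rw [hxy, ← hq, ← hα, leadingCoeff_C, leadingCoeff_C, C_inj] at htop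
  have hκq : κ • q = 1 := mul_right_cancel₀ hα0 <| by
    rw [one_mul, smul_mul_assoc]
    simpa using htop.symm
  refine ⟨n2Coord_ext fun c => ?_, α, hα.symm⟩
  rw [← algebraMap_smul S κ x, map_smul, ← one_smul S (n2G k S .J), n2Coord_smul_n2G]
  split_ifs with h
  · rw [h, ← hq, smul_C, algebraMap_smul, hκq]
  · rw [hx c h, smul_zero]

lemma eq_J_or_eq_neg_J [IsDomain S] {x y : S ⊗[k] N2 k} (hx : x ∈ (n2Over δ).even)
    (hy : y ∈ (n2Over δ).odd) (hy0 : y ≠ 0) (hxx : ∀ n, (n2Over δ).prod n x x = 0)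
    (hxy : (n2Over δ).prod 0 x y = y) (hxy' : ∀ n, (n2Over δ).prod (n + 1) x y = 0) :
    (x = n2G k S .J ∧ ∃ α : S, y = α • n2G k S .Gp) ∨
    (x = -n2G k S .J ∧ ∃ α : S, y = α • n2G k S .Gm) := by
  have hxJ : ∀ c, c ≠ .J → n2Coord S c x = 0 := by
    rintro (_ | _ | _ | _) hc
    · exact n2Coord_L_eq_zero hx hxx
    · exact absurd rfl hc
    · exact (n2Coord_of_mem_even hx).1
    · exact (n2Coord_of_mem_even hx).2
  obtain ⟨hyL, hyJ⟩ := n2Coord_of_mem_odd hy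
  have plus (h : n2Coord S .Gp y ≠ 0) :=
    eigenvalue_of_prod_eq_self hxJ hy hxy hxy' one_ne_zero (by simp [n2Struct]) h
  have minus (h : n2Coord S .Gm y ≠ 0) :=
    eigenvalue_of_prod_eq_self hxJ hy hxy hxy' (κ := -1) (neg_ne_zero.mpr one_ne_zero)
      (by simp [n2Struct]) h
  rw [one_smul] at plus
  have neg_one_smul_x : (-1 : k) • x = -x := neg_one_smul k x
  rw [neg_one_smul_x] at minus
  by_cases hp : n2Coord S .Gp y = 0
  · have hm : n2Coord S .Gm y ≠ 0 := fun hm =>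
      hy0 (n2Coord_ext fun c => by cases c <;> simp [*])
    obtain ⟨hJ, α, hα⟩ := minus hm
    refine Or.inr ⟨neg_eq_iff_eq_neg.mp hJ, α, n2Coord_ext fun c => ?_⟩
    rw [n2Coord_smul_n2G]
    cases c <;> simp [*]
  · obtain ⟨hJ, α, hα⟩ := plus hp
    have hm : n2Coord S .Gm y = 0 := by
      by_contra hm
      exact n2G_ne_neg .J (hJ ▸ (minus hm).1.symm)
    refine Or.inl ⟨hJ, α, n2Coord_ext fun c => ?_⟩
    rw [n2Coord_smul_n2G]
    cases c <;> simp [*]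

end Coordinates

section Presentation

open N2Gen Polynomial

section Relations

variable {k : Type*} [Field k] {S S' : Type*} [CommRing S] [Algebra k S] [CommRing S']
  [Algebra k S'] {δ : Derivation k S S} {δ' : Derivation k S' S'}
  {A : Type*} [AddCommGroup A] [Module k A] [Module S A] [IsScalarTower k S A]
  {B : Type*} [AddCommGroup B] [Module k B] [Module S' B] [IsScalarTower k S' B]

/-- The right-hand sides of the defining relations of the `N = 2` conformal superalgebra for the
`0`-products of the generators, evaluated at a family of elements of `A`. -/
def n2Rel₀ (SA : ConformalSuperalgebra k δ A) (v : N2Gen → A) : N2Gen → N2Gen → A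
  | L, L => SA.der (v L)
  | L, J => SA.der (v J)
  | L, Gp => SA.der (v Gp)
  | L, Gm => SA.der (v Gm)
  | J, Gp => v Gp
  | J, Gm => -v Gm
  | Gp, L => (2⁻¹ : k) • SA.der (v Gp)
  | Gm, L => (2⁻¹ : k) • SA.der (v Gm)
  | Gp, J => -v Gp
  | Gm, J => v Gm
  | Gp, Gm => v L + (2⁻¹ : k) • SA.der (v J)
  | Gm, Gp => v L - (2⁻¹ : k) • SA.der (v J)
  | _, _ => 0

variable (k) in
/-- The right-hand sides of the defining relations of the `N = 2` conformal superalgebra for the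
`1`-products of the generators, evaluated at a family of elements of `A`. -/
def n2Rel₁ (v : N2Gen → A) : N2Gen → N2Gen → A
  | L, L => (2 : k) • v L
  | L, J => v J
  | L, Gp => (3 / 2 : k) • v Gp
  | L, Gm => (3 / 2 : k) • v Gm
  | J, L => v J
  | Gp, L => (3 / 2 : k) • v Gp
  | Gm, L => (3 / 2 : k) • v Gm
  | Gp, Gm => v J
  | Gm, Gp => -v J
  | _, _ => 0

/-- A family of elements of a conformal superalgebra satisfying the defining relations of the
generators `L, J, G⁺, G⁻`. -/
structure N2Relations (SA : ConformalSuperalgebra k δ A) (v : N2Gen → A) : Prop where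
  L_even : v L ∈ SA.even
  J_even : v J ∈ SA.even
  Gp_odd : v Gp ∈ SA.odd
  Gm_odd : v Gm ∈ SA.odd
  prod_zero : ∀ a b, SA.prod 0 (v a) (v b) = n2Rel₀ SA v a b
  prod_one : ∀ a b, SA.prod 1 (v a) (v b) = n2Rel₁ k v a b
  prod_add_two : ∀ n a b, SA.prod (n + 2) (v a) (v b) = 0

variable {SA : ConformalSuperalgebra k δ A} {SB : ConformalSuperalgebra k δ' B} {f : A →+ B}

lemma map_n2Rel₀ (hsmul : ∀ (r : k) x, f (r • x) = r • f x)
    (hder : ∀ x, f (SA.der x) = SB.der (f x)) (v : N2Gen → A) (a b : N2Gen) :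
    f (n2Rel₀ SA v a b) = n2Rel₀ SB (f ∘ v) a b := by
  cases a <;> cases b <;>
  simp only [n2Rel₀, map_add, map_sub, map_neg, map_zero, hsmul, hder, Function.comp_apply]

lemma map_n2Rel₁ (hsmul : ∀ (r : k) x, f (r • x) = r • f x) (v : N2Gen → A) (a b : N2Gen) :
    f (n2Rel₁ k v a b) = n2Rel₁ k (f ∘ v) a b := by
  cases a <;> cases b <;>
  simp only [n2Rel₁, map_neg, map_zero, hsmul, Function.comp_apply]

lemma N2Relations.map {γ : S →ₐ[k] S'} {v : N2Gen → A} (hv : N2Relations SA v)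
    (hf : IsSemiHom γ SA SB f) : N2Relations SB (f ∘ v) where
  L_even := hf.map_even _ hv.L_even
  J_even := hf.map_even _ hv.J_even
  Gp_odd := hf.map_odd _ hv.Gp_odd
  Gm_odd := hf.map_odd _ hv.Gm_odd
  prod_zero a b := by
    rw [← map_n2Rel₀ (map_smul_base hf.map_smul) hf.map_der, ← hv.prod_zero, hf.map_prod]
    rfl
  prod_one a b := by
    rw [← map_n2Rel₁ (map_smul_base hf.map_smul), ← hv.prod_one, hf.map_prod]
    rfl
  prod_add_two n a b := by
    rw [Function.comp_apply, Function.comp_apply, ← hf.map_prod, hv.prod_add_two, map_zero]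

lemma N2Relations.prod_smul_smul {v : N2Gen → A} (hv : N2Relations SA v) (n : ℕ) (s t : S)
    (a b : N2Gen) : SA.prod n (s • v a) (t • v b) =
      (s * t) • SA.prod n (v a) (v b) + (δ s * t) • SA.prod (n + 1) (v a) (v b) := by
  have hvanish : ∀ m, 2 ≤ m → SA.prod m (v a) (v b) = 0 := fun m hm => by
    obtain ⟨n, rfl⟩ := Nat.exists_eq_add_of_le' hm
    exact hv.prod_add_two n a b
  rw [SA.prod_smul, smul_prod_range SA n s _ _ 2 hvanish, Finset.sum_range_succ,
    Finset.sum_range_one, dividedPow_zero, smul_add, smul_smul, smul_smul, mul_comm t, mul_comm t]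
  simp [dividedPow]

end Relations

variable {k : Type*} [Field k]

lemma n2_prod_generators (n : ℕ) (a b c : N2Gen) :
    (n2Conformal k).prod n (n2Mono k a 0) (n2Mono k b 0) c =
      (n.factorial : k) • (n2Struct k a b c).coeff n := by
  rw [n2_prod_apply, n2Bracket_mono]
  simp

lemma natDegree_n2Struct_le_one (a b c : N2Gen) : (n2Struct k a b c).natDegree ≤ 1 := by
  cases a <;> cases b <;> cases c <;> simp only [n2Struct] <;> compute_degree <;> exact zero_le_one

lemma span_n2Mono : Submodule.span k (Set.range fun p : N2Gen × ℕ => n2Mono k p.1 p.2) = ⊤ := by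
  rw [eq_top_iff]
  rintro f -
  rw [← Finset.univ_sum_single f]
  refine sum_mem fun c _ => ?_
  induction f c using Polynomial.induction_on' with
  | add p q hp hq => rw [Pi.single_add]; exact add_mem hp hq
  | monomial i r =>
    rw [← smul_X_eq_monomial, Pi.single_smul]
    exact Submodule.smul_mem _ _ (Submodule.subset_span ⟨(c, i), rfl⟩)

variable {S : Type*} [CommRing S] [Algebra k S] {δ : Derivation k S S}
  {B : Type*} [AddCommGroup B] [Module k B] [Module S B] [IsScalarTower k S B]
  {SB : ConformalSuperalgebra k δ B} {v : N2Gen → B}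

lemma aeval_der_mem {Q : Submodule S B} (hQ : ∀ x ∈ Q, SB.der x ∈ Q) (p : k[X]) {x : B}
    (hx : x ∈ Q) : aeval SB.der p x ∈ Q := by
  induction p using Polynomial.induction_on with
  | C r => simpa using Submodule.smul_of_tower_mem Q r hx
  | add p q hp hq => simpa using add_mem hp hq
  | monomial i r h => simpa [pow_succ', mul_left_comm] using hQ _ h

variable (SB v) in
/-- The linear map commuting with `∂` that has prescribed values on the generators. -/
def n2Lift : N2 k →ₗ[k] B where
  toFun f := ∑ c, aeval SB.der (f c) (v c)
  map_add' f g := by simp [Finset.sum_add_distrib]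
  map_smul' r f := by simp [Finset.smul_sum]

lemma n2Lift_apply (f : N2 k) : n2Lift SB v f = ∑ c, aeval SB.der (f c) (v c) := rfl

lemma n2Lift_n2Mono (c : N2Gen) : n2Lift SB v (n2Mono k c 0) = v c := by
  rw [n2Lift_apply, Finset.sum_eq_single c]
  · simp [n2Mono]
  · intro d _ hd; simp [n2Mono, hd]
  · simp

lemma n2Lift_der (f : N2 k) : n2Lift SB v ((n2Conformal k).der f) = SB.der (n2Lift SB v f) := by
  simp [n2Lift_apply, n2_der_apply]

variable [CharZero k]

lemma n2_relations : N2Relations (n2Conformal k) (n2Mono k · 0) where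
  L_even := by constructor <;> simp [n2Mono]
  J_even := by constructor <;> simp [n2Mono]
  Gp_odd := by constructor <;> simp [n2Mono]
  Gm_odd := by constructor <;> simp [n2Mono]
  prod_zero a b := by
    funext c
    rw [n2_prod_generators]
    cases a <;> cases b <;> cases c <;> simp [n2Struct, n2Rel₀, n2_der_apply, n2Mono, smul_eq_C_mul]
  prod_one a b := by
    have h2 : (C 2⁻¹ * 2 : k[X]) = 1 := by
      rw [← C_ofNat, ← C_mul, inv_mul_cancel₀ two_ne_zero, C_1]
    funext c
    rw [n2_prod_generators]
    cases a <;> cases b <;> cases c <;>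
    simp [n2Struct, n2Rel₁, n2Mono, coeff_one, smul_eq_C_mul, h2, C_ofNat]
  prod_add_two n a b := by
    funext c
    rw [n2_prod_generators, coeff_eq_zero_of_natDegree_lt, smul_zero, Pi.zero_apply]
    exact (natDegree_n2Struct_le_one a b c).trans_lt (by omega)

lemma N2Relations.n2Lift_prod_generators (hv : N2Relations SB v) (n : ℕ) (a b : N2Gen) :
    n2Lift SB v ((n2Conformal k).prod n (n2Mono k a 0) (n2Mono k b 0)) =
      SB.prod n (v a) (v b) := by
  let f : N2 k →+ B := (n2Lift SB v).toAddMonoidHom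
  have hcomp : f ∘ (n2Mono k · 0) = v := funext n2Lift_n2Mono
  match n with
  | 0 =>
    rw [n2_relations.prod_zero, hv.prod_zero]
    exact (map_n2Rel₀ (f := f) (map_smul (n2Lift SB v)) n2Lift_der _ a b).trans (by rw [hcomp])
  | 1 =>
    rw [n2_relations.prod_one, hv.prod_one]
    exact (map_n2Rel₁ (f := f) (map_smul (n2Lift SB v)) _ a b).trans (by rw [hcomp])
  | n + 2 => rw [n2_relations.prod_add_two, hv.prod_add_two, map_zero]

lemma N2Relations.n2Lift_prod (hv : N2Relations SB v) (n : ℕ) (f g : N2 k) :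
    n2Lift SB v ((n2Conformal k).prod n f g) =
      SB.prod n (n2Lift SB v f) (n2Lift SB v g) := by
  refine map_prod_of_span (γ := Algebra.ofId k S) (fun r => by simp [Algebra.ofId_apply])
    (f := (n2Lift SB v).toAddMonoidHom) (fun r f => by simp [Algebra.ofId_apply])
    span_n2Mono ?_ n f g
  rintro n _ ⟨⟨a, i⟩, rfl⟩ _ ⟨⟨b, j⟩, rfl⟩
  simp only [LinearMap.toAddMonoidHom_coe]
  induction i generalizing n with
  | zero =>
    induction j generalizing n with
    | zero => simpa only [n2Lift_n2Mono] using hv.n2Lift_prod_generators n a b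
    | succ j ih =>
      rw [← n2_der_mono, (n2Conformal k).prod_der, map_add, n2Lift_der, map_smul, ih, ih,
        n2Lift_der, SB.prod_der]
  | succ i ih =>
    rw [← n2_der_mono, (n2Conformal k).der_prod, map_neg, map_smul, ih, n2Lift_der, SB.der_prod]

lemma N2Relations.isSemiHom_n2Lift (hv : N2Relations SB v) :
    IsSemiHom (Algebra.ofId k S) (n2Conformal k) SB (n2Lift SB v).toAddMonoidHom where
  map_smul r f := by simp [Algebra.ofId_apply]
  map_even f hf := by
    obtain ⟨hp, hm⟩ : f Gp = 0 ∧ f Gm = 0 := hf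
    simpa [n2Lift_apply, N2Gen.sum_univ, hp, hm] using add_mem
      (aeval_der_mem SB.der_even (f L) hv.L_even) (aeval_der_mem SB.der_even (f J) hv.J_even)
  map_odd f hf := by
    obtain ⟨hL, hJ⟩ : f L = 0 ∧ f J = 0 := hf
    simpa [n2Lift_apply, N2Gen.sum_univ, hL, hJ] using add_mem
      (aeval_der_mem SB.der_odd (f Gp) hv.Gp_odd) (aeval_der_mem SB.der_odd (f Gm) hv.Gm_odd)
  map_der := n2Lift_der
  map_prod := hv.n2Lift_prod

lemma n2_ext_of_Gp_Gm {γ : k →ₐ[k] S} {f g : N2 k →+ B} (hf : IsSemiHom γ (n2Conformal k) SB f)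
    (hg : IsSemiHom γ (n2Conformal k) SB g) (hp : f (n2Mono k Gp 0) = g (n2Mono k Gp 0))
    (hm : f (n2Mono k Gm 0) = g (n2Mono k Gm 0)) : f = g := by
  have hJ : f (n2Mono k J 0) = g (n2Mono k J 0) := by
    rw [show n2Mono k J 0 = (n2Conformal k).prod 1 (n2Mono k Gp 0) (n2Mono k Gm 0) from
      (n2_relations.prod_one Gp Gm).symm, hf.map_prod, hg.map_prod, hp, hm]
  have hL : f (n2Mono k L 0) = g (n2Mono k L 0) := by
    have hL' : n2Mono k L 0 = (n2Conformal k).prod 0 (n2Mono k Gp 0) (n2Mono k Gm 0) -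
        (2⁻¹ : k) • (n2Conformal k).der (n2Mono k J 0) := by
      rw [n2_relations.prod_zero Gp Gm, n2Rel₀, add_sub_cancel_right]
    rw [hL', map_sub, map_sub, hf.map_smul, hg.map_smul, hf.map_der, hg.map_der, hf.map_prod,
      hg.map_prod, hp, hm, hJ]
  have hmono (c : N2Gen) (i : ℕ) : f (n2Mono k c i) = g (n2Mono k c i) := by
    induction i with
    | zero => cases c <;> assumption
    | succ i ih =>
      rw [← n2_der_mono, hf.map_der, hg.map_der, ih]
  refine AddMonoidHom.ext fun x => ?_
  have hx : x ∈ Submodule.span k (Set.range fun p : N2Gen × ℕ => n2Mono k p.1 p.2) :=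
    by rw [span_n2Mono]; exact Submodule.mem_top
  induction hx using Submodule.span_induction with
  | mem x h =>
    obtain ⟨⟨c, i⟩, rfl⟩ := h
    exact hmono c i
  | zero => simp
  | add x y _ _ hx hy => rw [map_add, map_add, hx, hy]
  | smul r x _ hx => rw [hf.map_smul, hg.map_smul, hx]

end Presentation

section Torus

open N2Gen

variable {k : Type*} [Field k] {S : Type*} [CommRing S] [Algebra k S] {δ : Derivation k S S}
  {B : Type*} [AddCommGroup B] [Module S B] {v : N2Gen → B}

/-- The twist of a family by a unit `β`: `G^± ↦ β^{±1} G^±` and `J ↦ J`, the correction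
`L ↦ L + β⁻¹ δ(β) J` being forced by `L = G⁺₍₀₎G⁻ - ½ ∂J`. -/
def n2TorusFun (δ : Derivation k S S) (v : N2Gen → B) (β : Sˣ) : N2Gen → B
  | L => v L + (δ β * ↑β⁻¹) • v J
  | J => v J
  | Gp => (β : S) • v Gp
  | Gm => (↑β⁻¹ : S) • v Gm

lemma n2TorusFun_L (β : Sˣ) :
    n2TorusFun δ v β L = (1 : S) • v L + (δ β * ↑β⁻¹) • v J := by
  rw [one_smul, n2TorusFun]

lemma n2TorusFun_J (β : Sˣ) : n2TorusFun δ v β J = (1 : S) • v J := by rw [one_smul, n2TorusFun]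

lemma n2TorusFun_Gp (β : Sˣ) : n2TorusFun δ v β Gp = (β : S) • v Gp := rfl

lemma n2TorusFun_Gm (β : Sˣ) : n2TorusFun δ v β Gm = (↑β⁻¹ : S) • v Gm := rfl

variable [Module k B] [IsScalarTower k S B] {SB : ConformalSuperalgebra k δ B}

namespace N2Relations

lemma prod_zero_smul_smul (hv : N2Relations SB v) (s t : S) (a b : N2Gen) :
    SB.prod 0 (s • v a) (t • v b) =
      (s * t) • n2Rel₀ SB v a b + (δ s * t) • n2Rel₁ k v a b := by
  rw [hv.prod_smul_smul, hv.prod_zero, hv.prod_one]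

lemma prod_one_smul_smul (hv : N2Relations SB v) (s t : S) (a b : N2Gen) :
    SB.prod 1 (s • v a) (t • v b) = (s * t) • n2Rel₁ k v a b := by
  rw [hv.prod_smul_smul, hv.prod_one, hv.prod_add_two 0, smul_zero, add_zero]

lemma prod_add_two_smul_smul (hv : N2Relations SB v) (n : ℕ) (s t : S) (a b : N2Gen) :
    SB.prod (n + 2) (s • v a) (t • v b) = 0 := by
  rw [hv.prod_smul_smul, hv.prod_add_two, hv.prod_add_two (n + 1), smul_zero, smul_zero, add_zero]

variable [CharZero k]

lemma n2TorusFun_prod_zero (hv : N2Relations SB v) (β : Sˣ) (a b : N2Gen) :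
    SB.prod 0 (n2TorusFun δ v β a) (n2TorusFun δ v β b) = n2Rel₀ SB (n2TorusFun δ v β) a b := by
  have leibniz : (β : S) * δ ↑β⁻¹ + ↑β⁻¹ * δ (β : S) = 0 := by
    simpa only [Derivation.leibniz, smul_eq_mul, Derivation.map_one_eq_zero] using
      congrArg δ β.mul_inv
  have unit : (β : S) * ↑β⁻¹ = 1 := β.mul_inv
  have half : algebraMap k S 2⁻¹ * 2 = 1 := by
    rw [← map_ofNat (algebraMap k S) 2, ← map_mul, inv_mul_cancel₀ two_ne_zero, map_one]
  have three_halves : algebraMap k S (3 / 2) = 1 + algebraMap k S 2⁻¹ := by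
    rw [← map_one (algebraMap k S), ← map_add]
    norm_num
  have smul_base (r : k) (x : B) : r • x = algebraMap k S r • x := (algebraMap_smul S r x).symm
  cases a <;> cases b <;>
  simp only [n2TorusFun_L, n2TorusFun_J, n2TorusFun_Gp, n2TorusFun_Gm, map_add,
    LinearMap.add_apply, hv.prod_zero_smul_smul, n2Rel₀, n2Rel₁, SB.der_smul,
    Derivation.map_one_eq_zero, smul_base, three_halves, map_ofNat] <;>
  match_scalars <;> grind

lemma n2TorusFun_prod_one (hv : N2Relations SB v) (β : Sˣ) (a b : N2Gen) :
    SB.prod 1 (n2TorusFun δ v β a) (n2TorusFun δ v β b) = n2Rel₁ k (n2TorusFun δ v β) a b := by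
  have unit : (β : S) * ↑β⁻¹ = 1 := β.mul_inv
  have half : algebraMap k S 2⁻¹ * 2 = 1 := by
    rw [← map_ofNat (algebraMap k S) 2, ← map_mul, inv_mul_cancel₀ two_ne_zero, map_one]
  have three_halves : algebraMap k S (3 / 2) = 1 + algebraMap k S 2⁻¹ := by
    rw [← map_one (algebraMap k S), ← map_add]
    norm_num
  have smul_base (r : k) (x : B) : r • x = algebraMap k S r • x := (algebraMap_smul S r x).symm
  cases a <;> cases b <;>
  simp only [n2TorusFun_L, n2TorusFun_J, n2TorusFun_Gp, n2TorusFun_Gm, map_add,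
    LinearMap.add_apply, hv.prod_one_smul_smul, n2Rel₁, smul_base, three_halves, map_ofNat] <;>
  match_scalars <;> grind

lemma torus (hv : N2Relations SB v) (β : Sˣ) : N2Relations SB (n2TorusFun δ v β) where
  L_even := add_mem hv.L_even (Submodule.smul_mem _ _ hv.J_even)
  J_even := hv.J_even
  Gp_odd := Submodule.smul_mem _ _ hv.Gp_odd
  Gm_odd := Submodule.smul_mem _ _ hv.Gm_odd
  prod_zero := hv.n2TorusFun_prod_zero β
  prod_one := hv.n2TorusFun_prod_one β
  prod_add_two n a b := by
    cases a <;> cases b <;>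
    simp only [n2TorusFun_L, n2TorusFun_J, n2TorusFun_Gp, n2TorusFun_Gm, map_add,
      LinearMap.add_apply, hv.prod_add_two_smul_smul, add_zero]

end N2Relations

end Torus

section Classification

open N2Gen

variable {k : Type*} [Field k] [CharZero k] {S : Type*} [CommRing S] [Algebra k S]
  {δ : Derivation k S S}

lemma n2G_relations : N2Relations (n2Over δ) (n2G k S) :=
  n2_relations.map (isSemiHom_one_tmul (der_algebraMap_base δ) (n2Conformal k))

lemma n2Over_ext {S' : Type*} [CommRing S'] [Algebra k S'] {δ' : Derivation k S' S'}
    {B : Type*} [AddCommGroup B] [Module k B] [Module S' B] [IsScalarTower k S' B]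
    {SB : ConformalSuperalgebra k δ' B} {γ : S →ₐ[k] S'} {f g : S ⊗[k] N2 k →+ B}
    (hf : IsSemiHom γ (n2Over δ) SB f) (hg : IsSemiHom γ (n2Over δ) SB g)
    (hp : f (n2G k S Gp) = g (n2G k S Gp)) (hm : f (n2G k S Gm) = g (n2G k S Gm)) : f = g := by
  have one := isSemiHom_one_tmul (der_algebraMap_base δ) (n2Conformal k)
  have hone := n2_ext_of_Gp_Gm (hf.comp one) (hg.comp one) hp hm
  refine AddMonoidHom.ext fun x => ?_
  induction x using TensorProduct.induction_on with
  | zero => rw [map_zero, map_zero]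
  | add x y hx hy => rw [map_add, map_add, hx, hy]
  | tmul s y =>
    rw [← mul_one s, ← smul_eq_mul, ← TensorProduct.smul_tmul', hf.map_smul, hg.map_smul]
    exact congrArg (γ s • ·) (DFunLike.congr_fun hone y)

variable (δ) in
/-- The endomorphism `G^± ↦ β^{±1} G^±`, `J ↦ J` of `S ⊗ A` attached to a unit `β`. -/
def n2TorusHom (β : Sˣ) : S ⊗[k] N2 k →ₗ[S] S ⊗[k] N2 k :=
  (n2Lift (n2Over δ) (n2TorusFun δ (n2G k S) β)).liftBaseChange S

lemma n2TorusHom_n2G (β : Sˣ) (c : N2Gen) :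
    n2TorusHom δ β (n2G k S c) = n2TorusFun δ (n2G k S) β c := by
  rw [n2TorusHom, n2G, LinearMap.liftBaseChange_tmul, one_smul, n2Lift_n2Mono]

lemma isSemiHom_n2TorusHom (β : Sˣ) : IsSemiHom (AlgHom.id k S) (n2Over δ) (n2Over δ)
    (n2TorusHom δ β : S ⊗[k] N2 k →+ S ⊗[k] N2 k) := by
  refine .of_baseChange (fun _ => rfl) (map_smul (n2TorusHom δ β)) ?_
  convert ((n2G_relations (k := k)).torus β).isSemiHom_n2Lift using 1
  · ext
  · ext; simp [n2TorusHom]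

lemma n2TorusHom_comp_inv (β : Sˣ) :
    n2TorusHom (k := k) δ β ∘ₗ n2TorusHom δ β⁻¹ = LinearMap.id := by
  have h := n2Over_ext ((isSemiHom_n2TorusHom (δ := δ) β).comp (isSemiHom_n2TorusHom β⁻¹))
    (ConformalEquiv.refl (n2Over (k := k) δ)).isSemiHom ?_ ?_
  · exact LinearMap.ext fun x => DFunLike.congr_fun h x
  · change n2TorusHom δ β (n2TorusHom δ β⁻¹ (n2G k S Gp)) = n2G k S Gp
    rw [n2TorusHom_n2G, n2TorusFun_Gp, map_smul, n2TorusHom_n2G, n2TorusFun_Gp, smul_smul,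
      Units.inv_mul, one_smul]
  · change n2TorusHom δ β (n2TorusHom δ β⁻¹ (n2G k S Gm)) = n2G k S Gm
    rw [n2TorusHom_n2G, n2TorusFun_Gm, map_smul, n2TorusHom_n2G, n2TorusFun_Gm, smul_smul,
      Units.inv_mul, one_smul]

variable (δ) in
/-- The automorphism `G^± ↦ β^{±1} G^±`, `J ↦ J` of `S ⊗ A` attached to a unit `β`. -/
def n2Torus (β : Sˣ) : ConformalEquiv (n2Over (k := k) δ) (n2Over δ) :=
  .ofIsSemiHom
    (.ofLinearMap (n2TorusHom δ β) (n2TorusHom δ β⁻¹) (n2TorusHom_comp_inv β)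
      (by simpa only [inv_inv] using n2TorusHom_comp_inv β⁻¹))
    (isSemiHom_n2TorusHom β)

lemma n2Torus_Gp (β : Sˣ) :
    (n2Torus δ β).toLinearEquiv (n2G k S Gp) = (β : S) • n2G k S Gp :=
  n2TorusHom_n2G β Gp

lemma n2Torus_Gm (β : Sˣ) :
    (n2Torus δ β).toLinearEquiv (n2G k S Gm) = (↑β⁻¹ : S) • n2G k S Gm :=
  n2TorusHom_n2G β Gm

lemma n2Over_prod_J_J (n : ℕ) : (n2Over δ).prod n (n2G k S J) (n2G k S J) = 0 :=
  match n with
  | 0 => n2G_relations.prod_zero J J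
  | 1 => n2G_relations.prod_one J J
  | n + 2 => n2G_relations.prod_add_two n J J

lemma n2Over_prod_succ_J_Gp (n : ℕ) : (n2Over δ).prod (n + 1) (n2G k S J) (n2G k S Gp) = 0 :=
  match n with
  | 0 => n2G_relations.prod_one J Gp
  | n + 1 => n2G_relations.prod_add_two n J Gp

lemma n2Over_prod_succ_J_Gm (n : ℕ) : (n2Over δ).prod (n + 1) (n2G k S J) (n2G k S Gm) = 0 :=
  match n with
  | 0 => n2G_relations.prod_one J Gm
  | n + 1 => n2G_relations.prod_add_two n J Gm

lemma prod_one_smul_Gp_smul_Gm (s t : S) :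
    (n2Over δ).prod 1 (s • n2G k S Gp) (t • n2G k S Gm) = (s * t) • n2G k S J :=
  n2G_relations.prod_one_smul_smul s t Gp Gm

lemma prod_one_smul_Gm_smul_Gp (s t : S) :
    (n2Over δ).prod 1 (s • n2G k S Gm) (t • n2G k S Gp) = (s * t) • -n2G k S J :=
  n2G_relations.prod_one_smul_smul s t Gm Gp

variable [IsDomain S] {γ : S →ₐ[k] S} {T : S ⊗[k] N2 k →+ S ⊗[k] N2 k}

lemma map_J_and_map_Gp (hT : IsSemiHom γ (n2Over δ) (n2Over δ) T) (hinj : Function.Injective T) :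
    (T (n2G k S J) = n2G k S J ∧ ∃ α : S, T (n2G k S Gp) = α • n2G k S Gp) ∨
    (T (n2G k S J) = -n2G k S J ∧ ∃ α : S, T (n2G k S Gp) = α • n2G k S Gm) :=
  eq_J_or_eq_neg_J (δ := δ) (hT.map_even _ n2G_relations.J_even)
    (hT.map_odd _ n2G_relations.Gp_odd) ((map_ne_zero_iff T hinj).mpr (n2G_ne_zero _))
    (fun n => by rw [← hT.map_prod, n2Over_prod_J_J, map_zero])
    (by rw [← hT.map_prod, n2G_relations.prod_zero, n2Rel₀])
    (fun n => by rw [← hT.map_prod, n2Over_prod_succ_J_Gp, map_zero])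

/-- The eigenvalue of `J` on `G⁻` is `-1`, so the classification of eigenvectors is applied to
`-T J`. -/
lemma map_J_and_map_Gm (hT : IsSemiHom γ (n2Over δ) (n2Over δ) T) (hinj : Function.Injective T) :
    (T (n2G k S J) = n2G k S J ∧ ∃ α : S, T (n2G k S Gm) = α • n2G k S Gm) ∨
    (T (n2G k S J) = -n2G k S J ∧ ∃ α : S, T (n2G k S Gm) = α • n2G k S Gp) := by
  have h := eq_J_or_eq_neg_J (δ := δ) (x := -T (n2G k S J))
    (neg_mem (hT.map_even _ n2G_relations.J_even)) (hT.map_odd _ n2G_relations.Gm_odd)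
    ((map_ne_zero_iff T hinj).mpr (n2G_ne_zero _))
    (fun n => by
      rw [map_neg, map_neg, LinearMap.neg_apply, neg_neg, ← hT.map_prod, n2Over_prod_J_J, map_zero])
    (by
      rw [map_neg, LinearMap.neg_apply, ← hT.map_prod, n2G_relations.prod_zero, n2Rel₀, map_neg,
        neg_neg])
    (fun n => by
      rw [map_neg, LinearMap.neg_apply, ← hT.map_prod, n2Over_prod_succ_J_Gm, map_zero, neg_zero])
  rw [neg_inj, neg_eq_iff_eq_neg] at h
  exact h.symm

lemma exists_unit_smul_or_swap (hT : IsSemiHom γ (n2Over δ) (n2Over δ) T)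
    (hinj : Function.Injective T) : ∃ α : Sˣ,
      (T (n2G k S Gp) = (α : S) • n2G k S Gp ∧ T (n2G k S Gm) = (↑α⁻¹ : S) • n2G k S Gm) ∨
      (T (n2G k S Gp) = (α : S) • n2G k S Gm ∧ T (n2G k S Gm) = (↑α⁻¹ : S) • n2G k S Gp) := by
  have hJ : T (n2G k S J) = (n2Over δ).prod 1 (T (n2G k S Gp)) (T (n2G k S Gm)) := by
    rw [← hT.map_prod, n2G_relations.prod_one, n2Rel₁]
  rcases map_J_and_map_Gp hT hinj with ⟨hp, α, hα⟩ | ⟨hp, α, hα⟩ <;>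
    rcases map_J_and_map_Gm hT hinj with ⟨hm, α', hα'⟩ | ⟨hm, α', hα'⟩
  · have hunit : α * α' = 1 := smul_n2G_injective (k := k) J <| by
      rw [hp, hα, hα', prod_one_smul_Gp_smul_Gm] at hJ
      simpa only [one_smul] using hJ.symm
    exact ⟨.mkOfMulEqOne α α' hunit, Or.inl ⟨hα, hα'⟩⟩
  · exact absurd (hp.symm.trans hm) (n2G_ne_neg J)
  · exact absurd (hm.symm.trans hp) (n2G_ne_neg J)
  · have hunit : α * α' = 1 := smul_n2G_injective (k := k) J <| by
      rw [hp, hα, hα', prod_one_smul_Gm_smul_Gp, smul_neg, neg_inj] at hJ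
      simpa only [one_smul] using hJ.symm
    exact ⟨.mkOfMulEqOne α α' hunit, Or.inr ⟨hα, hα'⟩⟩

end Classification

section Conjugacy

open N2Gen

section Omega

variable {k : Type*} [Field k]

lemma n2Omega_Gp : (n2Omega k).toLinearEquiv (n2Mono k Gp 0) = n2Mono k Gm 0 := by
  funext c
  cases c <;> simp [n2Omega, n2OmegaFun, n2Mono]

lemma n2Omega_Gm : (n2Omega k).toLinearEquiv (n2Mono k Gm 0) = n2Mono k Gp 0 := by
  funext c
  cases c <;> simp [n2Omega, n2OmegaFun, n2Mono]

lemma n2Omega_J : (n2Omega k).toLinearEquiv (n2Mono k J 0) = -n2Mono k J 0 := by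
  funext c
  cases c <;> simp [n2Omega, n2OmegaFun, n2Mono]

variable {S : Type*} [CommRing S] [Algebra k S] {γ : S →ₐ[k] S}

lemma twistMap_n2G (τ : N2 k →ₗ[k] N2 k) (c : N2Gen) :
    twistMap γ τ (n2G k S c) = 1 ⊗ₜ τ (n2Mono k c 0) := by
  rw [n2G, twistMap_tmul, map_one]

lemma map_inv_mul_inv {α β ε : Sˣ} (h : γ β * α = ε) : γ ↑β⁻¹ * ↑α⁻¹ = (↑ε⁻¹ : S) := by
  have h' : Units.map (γ : S →* S) β * α = ε := Units.ext h
  rw [← h', mul_inv]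
  rfl

end Omega

variable {k : Type*} [Field k] [CharZero k] {S : Type*} [CommRing S] [Algebra k S]
  {δ : Derivation k S S} {γ : S →ₐ[k] S} {T : S ⊗[k] N2 k →+ S ⊗[k] N2 k}

lemma conj_of_Gp_Gm (hγ : ∀ s, γ (δ s) = δ (γ s)) (hT : IsSemiHom γ (n2Over δ) (n2Over δ) T)
    (θ : ConformalEquiv (n2Over (k := k) δ) (n2Over δ))
    (τ : ConformalEquiv (n2Conformal k) (n2Conformal k))
    (hp : T (θ.toLinearEquiv (n2G k S Gp)) =
      θ.toLinearEquiv (twistMap γ τ.toLinearEquiv (n2G k S Gp)))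
    (hm : T (θ.toLinearEquiv (n2G k S Gm)) =
      θ.toLinearEquiv (twistMap γ τ.toLinearEquiv (n2G k S Gm))) (x : S ⊗[k] N2 k) :
    T (θ.toLinearEquiv x) = θ.toLinearEquiv (twistMap γ τ.toLinearEquiv x) := by
  have h₁ := hT.comp θ.isSemiHom
  have h₂ := θ.isSemiHom.comp (isSemiHom_twistMap (der_algebraMap_base δ) hγ τ.isSemiHom)
  rw [AlgHom.comp_id] at h₁
  rw [AlgHom.id_comp] at h₂
  exact DFunLike.congr_fun (n2Over_ext h₁ h₂ hp hm) x

lemma n2Torus_conj_refl (hγ : ∀ s, γ (δ s) = δ (γ s)) (hT : IsSemiHom γ (n2Over δ) (n2Over δ) T)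
    {α β : Sˣ} (hp : T (n2G k S Gp) = (α : S) • n2G k S Gp)
    (hm : T (n2G k S Gm) = (↑α⁻¹ : S) • n2G k S Gm) (hβ : γ β * α = β) (x : S ⊗[k] N2 k) :
    T ((n2Torus δ β).toLinearEquiv x) = (n2Torus δ β).toLinearEquiv
      (twistMap γ (ConformalEquiv.refl (n2Conformal k)).toLinearEquiv x) := by
  refine conj_of_Gp_Gm hγ hT _ _ ?_ ?_ x
  · rw [twistMap_n2G, n2Torus_Gp, hT.map_smul, hp, smul_smul, hβ]
    exact (n2Torus_Gp β).symm
  · rw [twistMap_n2G, n2Torus_Gm, hT.map_smul, hm, smul_smul, map_inv_mul_inv hβ]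
    exact (n2Torus_Gm β).symm

lemma n2Torus_conj_omega (hγ : ∀ s, γ (δ s) = δ (γ s)) (hT : IsSemiHom γ (n2Over δ) (n2Over δ) T)
    {α β : Sˣ} (hp : T (n2G k S Gp) = (α : S) • n2G k S Gm)
    (hm : T (n2G k S Gm) = (↑α⁻¹ : S) • n2G k S Gp) (hβ : γ β * α = (↑β⁻¹ : S))
    (x : S ⊗[k] N2 k) :
    T ((n2Torus δ β).toLinearEquiv x) =
      (n2Torus δ β).toLinearEquiv (twistMap γ (n2Omega k).toLinearEquiv x) := by
  refine conj_of_Gp_Gm hγ hT _ _ ?_ ?_ x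
  · rw [twistMap_n2G, n2Torus_Gp, hT.map_smul, hp, smul_smul, hβ, LinearEquiv.coe_coe, n2Omega_Gp]
    exact (n2Torus_Gm β).symm
  · rw [twistMap_n2G, n2Torus_Gm, hT.map_smul, hm, smul_smul, map_inv_mul_inv hβ, inv_inv,
      LinearEquiv.coe_coe, n2Omega_Gm]
    exact (n2Torus_Gp β).symm

end Conjugacy

section GaloisTwist

open N2Gen AddMonoidAlgebra

variable {k : Type*} [Field k]

/-- The unit `c t^q` of `k[t^q | q ∈ ℚ]`. -/
def monomialUnit (q : ℚ) {c : k} (hc : c ≠ 0) : (RatLaurent k)ˣ where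
  val := single q c
  inv := single (-q) c⁻¹
  val_inv := by rw [single_mul_single, add_neg_cancel, mul_inv_cancel₀ hc, one_def]
  inv_val := by rw [single_mul_single, neg_add_cancel, inv_mul_cancel₀ hc, one_def]

lemma val_monomialUnit (q : ℚ) {c : k} (hc : c ≠ 0) :
    (monomialUnit q hc : RatLaurent k) = single q c := rfl

lemma val_inv_monomialUnit (q : ℚ) {c : k} (hc : c ≠ 0) :
    (↑(monomialUnit q hc)⁻¹ : RatLaurent k) = single (-q) c⁻¹ := rfl

variable {χ : AddChar ℚ k} (hχ : IsFaithfulModInt χ)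

/-- The semilinear map `γ ⊗ τ` of `k[t^q | q ∈ ℚ] ⊗ A` over the Galois automorphism `γ`. -/
def galoisTwist {A : Type*} [AddCommGroup A] [Module k A] (τ : A →ₗ[k] A) :
    RatLaurent k ⊗[k] A →+ RatLaurent k ⊗[k] A :=
  twistMap ((galoisGen hχ).restrictScalars k) τ

lemma exists_monomialUnit_galoisGen_mul_eq {c : k} {N : ℕ} (hN : 0 < N) (hcN : c ^ N = 1) :
    ∃ β : (RatLaurent k)ˣ, galoisGen hχ β * (single 0 c : RatLaurent k) = β := by
  obtain ⟨p, rfl⟩ := hχ.exists_of_pow_eq_one hN hcN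
  refine ⟨monomialUnit (-p) one_ne_zero, ?_⟩
  rw [val_monomialUnit, galoisGen_single, single_mul_single, add_zero, one_mul,
    ← AddChar.map_add_eq_mul, neg_add_cancel, AddChar.map_zero_eq_one]

lemma exists_monomialUnit_galoisGen_mul_eq_inv (hsq : ∀ x : k, IsSquare x) (q : ℚ) {c : k}
    (hc : c ≠ 0) : ∃ β : (RatLaurent k)ˣ, galoisGen hχ β * single q c = (↑β⁻¹ : RatLaurent k) := by
  have hχc : χ (-(q / 2)) * c ≠ 0 := mul_ne_zero (χ.val_isUnit _).ne_zero hc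
  obtain ⟨b, hb⟩ := hsq (χ (-(q / 2)) * c)⁻¹
  have hb0 : b ≠ 0 := by
    rintro rfl
    exact inv_ne_zero hχc (hb.trans (mul_zero 0))
  refine ⟨monomialUnit (-(q / 2)) hb0, ?_⟩
  rw [val_monomialUnit, val_inv_monomialUnit, galoisGen_single, single_mul_single]
  congr 1
  · ring
  · apply eq_inv_of_mul_eq_one_left
    rw [mul_assoc b, mul_right_comm, ← hb, inv_mul_cancel₀ hχc]

variable {T : RatLaurent k ⊗[k] N2 k →+ RatLaurent k ⊗[k] N2 k}

lemma iterate_apply_Gp (hT : ∀ s x, T (s • x) = galoisGen hχ s • T x) {q : ℚ} {c : k}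
    (hp : T (n2G k _ Gp) = (single q c : RatLaurent k) • n2G k _ Gp) (n : ℕ) :
    T^[n] (n2G k _ Gp) =
      (single (n * q) (χ (n.choose 2 * q) * c ^ n) : RatLaurent k) • n2G k _ Gp := by
  induction n with
  | zero => simp [← one_def]
  | succ n ih =>
    rw [Function.iterate_succ_apply', ih, hT, galoisGen_single, hp, smul_smul, single_mul_single,
      Nat.choose_succ_succ' n 1, Nat.choose_one_right]
    congr 2
    · push_cast
      ring
    · rw [Nat.cast_add, add_mul, AddChar.map_add_eq_mul]
      ring

lemma eq_zero_and_pow_eq_one_of_iterate_apply_Gp (hT : ∀ s x, T (s • x) = galoisGen hχ s • T x)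
    {q : ℚ} {c : k} (hp : T (n2G k _ Gp) = (single q c : RatLaurent k) • n2G k _ Gp) {N : ℕ}
    (hN : 0 < N) (hTN : T^[N] (n2G k _ Gp) = n2G k _ Gp) : q = 0 ∧ c ^ N = 1 := by
  have h : single 0 1 = (single (N * q) (χ (N.choose 2 * q) * c ^ N) : RatLaurent k) :=
    smul_n2G_injective (k := k) Gp <| by
      simp only [← iterate_apply_Gp hχ hT hp, hTN, ← one_def, one_smul]
  obtain ⟨hq, hc⟩ | ⟨h1, -⟩ := single_inj.mp h
  · have hq0 : q = 0 := (mul_eq_zero.mp hq.symm).resolve_left (by exact_mod_cast hN.ne')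
    exact ⟨hq0, by simpa [hq0] using hc.symm⟩
  · exact absurd h1 one_ne_zero

lemma exists_conj_galoisTwist [CharZero k] (hsq : ∀ x : k, IsSquare x)
    (hT : IsSemiHom ((galoisGen hχ).restrictScalars k) (n2Over (ratLaurentDer k))
      (n2Over (ratLaurentDer k)) T) (hinj : Function.Injective T) {N : ℕ} (hN : 0 < N)
    (hTN : T^[N] (n2G k _ Gp) = n2G k _ Gp) :
    ∃ θ : ConformalEquiv (n2Over (k := k) (ratLaurentDer k)) (n2Over (ratLaurentDer k)),
      (∀ x, T (θ.toLinearEquiv x) = θ.toLinearEquiv (galoisTwist hχ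
        (ConformalEquiv.refl (n2Conformal k)).toLinearEquiv x)) ∨
      (∀ x, T (θ.toLinearEquiv x) =
        θ.toLinearEquiv (galoisTwist hχ (n2Omega k).toLinearEquiv x)) := by
  obtain ⟨α, h⟩ := exists_unit_smul_or_swap hT hinj
  obtain ⟨q, c, hc, hα⟩ := exists_unit_eq_single α
  rcases h with ⟨hp, hm⟩ | ⟨hp, hm⟩
  · obtain ⟨rfl, hcN⟩ :=
      eq_zero_and_pow_eq_one_of_iterate_apply_Gp hχ hT.map_smul (hα ▸ hp) hN hTN
    obtain ⟨β, hβ⟩ := exists_monomialUnit_galoisGen_mul_eq hχ hN hcN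
    exact ⟨n2Torus _ β, Or.inl (n2Torus_conj_refl (galoisGen_der hχ) hT hp hm (hα ▸ hβ))⟩
  · obtain ⟨β, hβ⟩ := exists_monomialUnit_galoisGen_mul_eq_inv hχ hsq q hc
    exact ⟨n2Torus _ β, Or.inr (n2Torus_conj_omega (galoisGen_der hχ) hT hp hm (hα ▸ hβ))⟩

end GaloisTwist

section LoopAsInvariants

open AddMonoidAlgebra

variable {k : Type*} [Field k] {A : Type*} [AddCommGroup A] [Module k A] {χ : AddChar ℚ k}
  (hχ : IsFaithfulModInt χ)

lemma galoisTwist_single_tmul (τ : A →ₗ[k] A) (q : ℚ) (c : k) (a : A) :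
    galoisTwist hχ τ (single q c ⊗ₜ a) = single q c ⊗ₜ (χ q • τ a) := by
  rw [galoisTwist, twistMap_tmul, ← TensorProduct.smul_tmul, smul_single, smul_eq_mul, mul_comm]
  exact congrArg (· ⊗ₜ[k] τ a) (galoisGen_single hχ q c)

lemma galoisTwist_iterate_one_tmul (τ : A →ₗ[k] A) (n : ℕ) (a : A) :
    (galoisTwist hχ τ)^[n] (1 ⊗ₜ a) = 1 ⊗ₜ τ^[n] a := by
  refine (Function.Semiconj.iterate_right (f := fun a : A => (1 : RatLaurent k) ⊗ₜ[k] a)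
    (fun a => ?_) n a).symm
  rw [galoisTwist, twistMap_tmul, map_one]

lemma galoisTwist_injective (τ : A ≃ₗ[k] A) :
    Function.Injective (galoisTwist hχ τ.toLinearMap) :=
  twistMap_injective (γ' := (galoisGen hχ.inv).restrictScalars k) (τ' := τ.symm.toLinearMap)
    (galoisGen_leftInverse hχ) τ.symm_apply_apply

lemma apply_eq_self_of_galoisTwist_eq {τ : A →ₗ[k] A} {c : ℚ →₀ A}
    (hc : galoisTwist hχ τ (c.sum fun q a => single q 1 ⊗ₜ a) =
      c.sum fun q a => single q 1 ⊗ₜ a) (q : ℚ) : χ q • τ (c q) = c q := by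
  let B : Module.Basis ℚ k (RatLaurent k) := ⟨coeffLinearEquiv k⟩
  let d : ℚ →₀ A := .onFinset c.support (fun q => χ q • τ (c q) - c q)
    fun q hq => Finsupp.mem_support_iff.mpr fun h => hq (by rw [h, map_zero, smul_zero, sub_zero])
  have hd : d = 0 := TensorProduct.sum_tmul_basis_left_eq_zero B d <| by
    rw [Finsupp.onFinset_sum _ fun _ => TensorProduct.tmul_zero _ _]
    simp only [TensorProduct.tmul_sub, Finset.sum_sub_distrib]
    refine sub_eq_zero.mpr (Eq.trans ?_ hc)
    rw [Finsupp.sum, map_sum]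
    exact Finset.sum_congr rfl fun q _ => (galoisTwist_single_tmul hχ τ q 1 (c q)).symm
  exact sub_eq_zero.mp (DFunLike.congr_fun hd q)

variable [CharZero k] {SA : ConformalSuperalgebra k (0 : Derivation k k k) A}

lemma isSemiHom_galoisTwist (σ : ConformalEquiv SA SA) :
    IsSemiHom ((galoisGen hχ).restrictScalars k)
      (SA.baseChange (der_algebraMap_base (ratLaurentDer k)))
      (SA.baseChange (der_algebraMap_base (ratLaurentDer k)))
      (galoisTwist hχ σ.toLinearEquiv.toLinearMap) :=
  isSemiHom_twistMap _ (γ := (galoisGen hχ).restrictScalars k) (galoisGen_der hχ) σ.isSemiHom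

lemma one_tmul_mem_loopSubmodule_refl {ζ : k} (hζ : IsPrimitiveRoot ζ 1) (a : A) :
    1 ⊗ₜ a ∈ loopSubmodule (ConformalEquiv.refl SA) 1 one_pos ζ hζ :=
  Submodule.subset_span ⟨0, a, by rw [zpow_zero, one_smul]; rfl,
    by rw [Int.cast_zero, zero_div, AddMonoidAlgebra.one_def]⟩

variable {σ : ConformalEquiv SA SA} {m : ℕ} (hm : 0 < m) {ζ : k} (hζ : IsPrimitiveRoot ζ m)

section

variable (hχζ : χ (1 / m) = ζ)
include hχ hχζ

lemma galoisTwist_symm_eq_self_of_mem {x : RatLaurent k ⊗[k] A}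
    (hx : x ∈ loopSubmodule σ m hm ζ hζ) :
    galoisTwist hχ σ.symm.toLinearEquiv.toLinearMap x = x := by
  change x ∈ Submodule.span k _ at hx
  induction hx using Submodule.span_induction with
  | mem x h =>
    obtain ⟨i, a, ha, rfl⟩ := h
    have hχi : χ (i / m) = ζ ^ i := by
      rw [← hχζ, ← AddChar.map_zsmul_eq_zpow, zsmul_eq_mul, mul_one_div]
    rw [galoisTwist_single_tmul, hχi, ← map_smul, ← ha]
    exact congrArg _ (σ.toLinearEquiv.symm_apply_apply a)
  | zero => rw [map_zero]
  | add x y _ _ hx hy => rw [map_add, hx, hy]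
  | smul c x _ hx => rw [map_smul_base (isSemiHom_galoisTwist hχ σ.symm).map_smul, hx]

lemma single_tmul_mem_loopSubmodule (hσ : ∀ a, σ.toLinearEquiv^[m] a = a) {q : ℚ} {a : A}
    (ha : σ.toLinearEquiv a = χ q • a) : single q 1 ⊗ₜ a ∈ loopSubmodule σ m hm ζ hζ := by
  rcases eq_or_ne a 0 with rfl | ha0
  · rw [TensorProduct.tmul_zero]
    exact zero_mem _
  have hiter (n : ℕ) : σ.toLinearEquiv^[n] a = χ q ^ n • a := by
    induction n with
    | zero => rw [pow_zero, one_smul, Function.iterate_zero_apply]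
    | succ n ih => rw [Function.iterate_succ_apply', ih, map_smul, ha, smul_smul, pow_succ]
  have hpow : χ q ^ m = 1 := smul_left_injective k ha0 <| by
    simp only [← hiter, hσ, one_smul]
  obtain ⟨i, hi⟩ := (hχ (m * q)).mp <| by rw [← nsmul_eq_mul, AddChar.map_nsmul_eq_pow, hpow]
  have hq : q = i / m := by rw [hi, mul_div_cancel_left₀ _ (by exact_mod_cast hm.ne')]
  refine Submodule.subset_span ⟨i, a, ?_, by rw [hq]⟩
  rw [ha, hq, ← hχζ, ← AddChar.map_zsmul_eq_zpow, zsmul_eq_mul, mul_one_div]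

/-- `L(A, σ)` consists of the invariants of `γ ⊗ σ⁻¹`. -/
lemma mem_loopSubmodule_iff (hσ : ∀ a, σ.toLinearEquiv^[m] a = a) (x : RatLaurent k ⊗[k] A) :
    x ∈ loopSubmodule σ m hm ζ hζ ↔
      galoisTwist hχ σ.symm.toLinearEquiv.toLinearMap x = x := by
  refine ⟨galoisTwist_symm_eq_self_of_mem hχ hm hζ hχζ, fun hx => ?_⟩
  obtain ⟨c, rfl⟩ :=
    TensorProduct.eq_repr_basis_left (⟨coeffLinearEquiv k⟩ : Module.Basis ℚ k (RatLaurent k)) x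
  refine sum_mem fun q _ => single_tmul_mem_loopSubmodule hχ hm hζ hχζ hσ ?_
  have h := congrArg σ.toLinearEquiv (apply_eq_self_of_galoisTwist_eq hχ hx q)
  rw [map_smul] at h
  exact h.symm.trans (congrArg (χ q • ·) (σ.toLinearEquiv.apply_symm_apply (c q)))

end

lemma isSemiHom_twistedLoop_subtype : IsSemiHom
    (IsScalarTower.toAlgHom k (LaurentPolynomial k) (RatLaurent k)) (twistedLoop σ m hm ζ hζ)
    (SA.baseChange (der_algebraMap_base (ratLaurentDer k)))
    (loopSubmodule σ m hm ζ hζ).subtype.toAddMonoidHom where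
  map_smul r x := (algebraMap_smul (RatLaurent k) r x.1).symm
  map_even _ hx := hx
  map_odd _ hx := hx
  map_der _ := rfl
  map_prod _ _ _ := rfl

lemma isoOver_twistedLoop {F : Type*} [AddCommGroup F] [Module k F] [Module (LaurentPolynomial k) F]
    [IsScalarTower k (LaurentPolynomial k) F] {SF : ConformalSuperalgebra k (laurentDer k) F}
    {g : F →+ RatLaurent k ⊗[k] A} (hinj : Function.Injective g)
    (hg : IsSemiHom (IsScalarTower.toAlgHom k (LaurentPolynomial k) (RatLaurent k)) SF
      (SA.baseChange (der_algebraMap_base (ratLaurentDer k))) g)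
    (hrange : ∀ x, x ∈ loopSubmodule σ m hm ζ hζ ↔ ∃ f, g f = x) :
    IsoOver SF (twistedLoop σ m hm ζ hζ) := by
  let g' : F →ₗ[LaurentPolynomial k] loopSubmodule σ m hm ζ hζ :=
    { toFun := fun f => ⟨g f, (hrange _).mpr ⟨f, rfl⟩⟩
      map_add' := fun f f' => Subtype.ext (map_add g f f')
      map_smul' := fun r f =>
        Subtype.ext ((hg.map_smul r f).trans (algebraMap_smul (RatLaurent k) r (g f))) }
  have hbij : Function.Bijective g' := by
    refine ⟨fun f f' h => hinj (congrArg Subtype.val h), ?_⟩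
    rintro ⟨x, hx⟩
    obtain ⟨f, hf⟩ := (hrange x).mp hx
    exact ⟨f, Subtype.ext hf⟩
  exact ⟨{ toLinearEquiv := LinearEquiv.ofBijective g' hbij
           map_even := hg.map_even
           map_odd := hg.map_odd
           map_prod := fun n a b => Subtype.ext (hg.map_prod n a b)
           map_der := fun a => Subtype.ext (hg.map_der a) }⟩

end LoopAsInvariants

lemma IsoOver.isoOverBase {k : Type*} [Field k] {R : Type*} [CommRing R] [Algebra k R]
    {δ : Derivation k R R}
    {A : Type*} [AddCommGroup A] [Module k A] [Module R A] [IsScalarTower k R A]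
    {B : Type*} [AddCommGroup B] [Module k B] [Module R B] [IsScalarTower k R B]
    {SA : ConformalSuperalgebra k δ A} {SB : ConformalSuperalgebra k δ B} (h : IsoOver SA SB) :
    IsoOverBase SA SB :=
  h.map fun e =>
    { toLinearEquiv := e.toLinearEquiv.restrictScalars k
      map_even := e.map_even
      map_odd := e.map_odd
      map_prod := e.map_prod
      map_der := e.map_der }

section Forms

open N2Gen

variable {k : Type*} [Field k] [CharZero k] {ξ : ℕ → k}
  (hξ : ∀ m, 0 < m → IsPrimitiveRoot (ξ m) m)

/-- The untwisted loop algebra `L(A, id)` of the `N = 2` conformal superalgebra. -/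
abbrev n2LoopId := twistedLoop (ConformalEquiv.refl (n2Conformal k)) 1 one_pos (ξ 1) (hξ 1 one_pos)

/-- The loop algebra `L(A, ω)` of the `N = 2` conformal superalgebra. -/
abbrev n2LoopOmega := twistedLoop (n2Omega k) 2 two_pos (ξ 2) (hξ 2 two_pos)

variable (hcompat : ∀ l m, 0 < l → 0 < m → ξ (l * m) ^ l = ξ m)

section

variable {F : Type*} [AddCommGroup F] [Module k F] [Module (LaurentPolynomial k) F]
  [IsScalarTower k (LaurentPolynomial k) F] {SF : ConformalSuperalgebra k (laurentDer k) F}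

lemma isoOver_twistedLoop_of_conj {g : F →+ RatLaurent k ⊗[k] N2 k} (hginj : Function.Injective g)
    (hg : IsSemiHom (IsScalarTower.toAlgHom k (LaurentPolynomial k) (RatLaurent k)) SF
      (n2Over (ratLaurentDer k)) g) {T : RatLaurent k ⊗[k] N2 k →+ RatLaurent k ⊗[k] N2 k}
    (hfix : ∀ x, T x = x ↔ ∃ f, g f = x)
    {θ : ConformalEquiv (n2Over (k := k) (ratLaurentDer k)) (n2Over (ratLaurentDer k))}
    {σ : ConformalEquiv (n2Conformal k) (n2Conformal k)} {m : ℕ} (hm : 0 < m)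
    (hσ : ∀ a, σ.toLinearEquiv^[m] a = a)
    (hθ : ∀ x, T (θ.toLinearEquiv x) = θ.toLinearEquiv
      (galoisTwist (isFaithfulModInt_rootChar hξ hcompat) σ.symm.toLinearEquiv x)) :
    IsoOver SF (twistedLoop σ m hm (ξ m) (hξ m hm)) := by
  have hg' := θ.symm.isSemiHom.comp hg
  rw [AlgHom.id_comp] at hg'
  refine isoOver_twistedLoop hm (hξ m hm) (θ.toLinearEquiv.symm.injective.comp hginj) hg'
    fun x => ?_
  rw [mem_loopSubmodule_iff (isFaithfulModInt_rootChar hξ hcompat) hm (hξ m hm)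
    (rootChar_one_div hξ hcompat hm) hσ, ← θ.toLinearEquiv.injective.eq_iff, ← hθ, hfix]
  exact exists_congr fun f => θ.toLinearEquiv.symm_apply_eq.symm

lemma isoOver_id_or_omega (hsq : ∀ x : k, IsSquare x) {g : F →+ RatLaurent k ⊗[k] N2 k}
    (hginj : Function.Injective g)
    (hg : IsSemiHom (IsScalarTower.toAlgHom k (LaurentPolynomial k) (RatLaurent k)) SF
      (n2Over (ratLaurentDer k)) g) {T : RatLaurent k ⊗[k] N2 k →+ RatLaurent k ⊗[k] N2 k}
    (hT : IsSemiHom ((galoisGen (isFaithfulModInt_rootChar hξ hcompat)).restrictScalars k)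
      (n2Over (ratLaurentDer k)) (n2Over (ratLaurentDer k)) T) (hTinj : Function.Injective T)
    {N : ℕ} (hN : 0 < N) (hTN : T^[N] (n2G k _ Gp) = n2G k _ Gp)
    (hfix : ∀ x, T x = x ↔ ∃ f, g f = x) :
    IsoOver SF (n2LoopId hξ) ∨ IsoOver SF (n2LoopOmega hξ) := by
  obtain ⟨θ, hθ | hθ⟩ :=
    exists_conj_galoisTwist (isFaithfulModInt_rootChar hξ hcompat) hsq hT hTinj hN hTN
  · exact Or.inl (isoOver_twistedLoop_of_conj hξ hcompat hginj hg hfix _ (fun _ => rfl) hθ)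
  · exact Or.inr (isoOver_twistedLoop_of_conj hξ hcompat hginj hg hfix _ (n2Omega_period k) hθ)

include hcompat in
/-- Transported along `φ`, the semilinear automorphism `γ ⊗ id` of `Ŝ ⊗ F`, whose invariants
are `F`, becomes a semilinear automorphism of `Ŝ ⊗ A`. -/
lemma isoOver_of_baseChange_equiv (hsq : ∀ x : k, IsSquare x)
    (φ : ConformalEquiv (SF.baseChange (ratLaurentDer_algebraMap (k := k)))
      (n2Over (k := k) (ratLaurentDer k))) :
    IsoOver SF (n2LoopId hξ) ∨ IsoOver SF (n2LoopOmega hξ) := by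
  have hχ := isFaithfulModInt_rootChar hξ hcompat
  let Γ : RatLaurent k ⊗[LaurentPolynomial k] F →+ RatLaurent k ⊗[LaurentPolynomial k] F :=
    twistMap (galoisGen hχ) LinearMap.id
  have hΓ : IsSemiHom ((galoisGen hχ).restrictScalars k) (SF.baseChange ratLaurentDer_algebraMap)
      (SF.baseChange ratLaurentDer_algebraMap) Γ :=
    isSemiHom_twistMap _ (galoisGen_der hχ) (ConformalEquiv.refl SF).isSemiHom
  have hΓinj : Function.Injective Γ :=
    twistMap_injective (τ' := LinearMap.id) (galoisGen_leftInverse hχ) fun _ => rfl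
  have hΓfix (y) : Γ y = y ↔ ∃ f : F, 1 ⊗ₜ f = y := by
    refine ⟨exists_one_tmul_of_twistMap_eq hχ, ?_⟩
    rintro ⟨f, rfl⟩
    exact (twistMap_tmul _ _ _ _).trans (congrArg (· ⊗ₜ f) (map_one (galoisGen hχ)))
  obtain ⟨N, hN, hper⟩ :=
    exists_twistMap_galoisGen_iterate_eq hχ (φ.toLinearEquiv.symm (n2G k (RatLaurent k) Gp))
  have hg := φ.isSemiHom.comp (isSemiHom_one_tmul ratLaurentDer_algebraMap SF)
  rw [AlgHom.id_comp] at hg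
  refine isoOver_id_or_omega hξ hcompat hsq (φ.toLinearEquiv.injective.comp (one_tmul_injective F))
    hg (φ.isSemiHom_conj hΓ) (φ.conj_injective hΓinj) hN ?_ fun x => ?_
  · have h := φ.conj_iterate_apply (Γ := Γ) N (φ.toLinearEquiv.symm (n2G k (RatLaurent k) Gp))
    rwa [hper N dvd_rfl, LinearEquiv.apply_symm_apply] at h
  · obtain ⟨y, rfl⟩ := φ.toLinearEquiv.surjective x
    rw [φ.conj_apply, φ.toLinearEquiv.injective.eq_iff, hΓfix]
    exact exists_congr fun f => φ.toLinearEquiv.injective.eq_iff.symm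

include hcompat in
lemma isoOver_of_isForm (hsq : ∀ x : k, IsSquare x)
    (hF : IsForm (ratLaurentDer_algebraMap (k := k)) SF
      ((n2Conformal k).baseChange (der_algebraMap_base (laurentDer k)))) :
    IsoOver SF (n2LoopId hξ) ∨ IsoOver SF (n2LoopOmega hξ) := by
  obtain ⟨e⟩ := hF
  exact isoOver_of_baseChange_equiv hξ hcompat hsq
    (e.trans (baseChangeTrans _ _ _ (n2Conformal k)))

end

include hcompat in
lemma twistedLoop_isoOver (hsq : ∀ x : k, IsSquare x)
    {σ : ConformalEquiv (n2Conformal k) (n2Conformal k)} {m : ℕ} (hm : 0 < m)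
    (hσ : ∀ a, σ.toLinearEquiv^[m] a = a) :
    IsoOver (twistedLoop σ m hm (ξ m) (hξ m hm)) (n2LoopId hξ) ∨
    IsoOver (twistedLoop σ m hm (ξ m) (hξ m hm)) (n2LoopOmega hξ) := by
  have hχ := isFaithfulModInt_rootChar hξ hcompat
  refine isoOver_id_or_omega hξ hcompat hsq Subtype.val_injective
    (isSemiHom_twistedLoop_subtype hm (hξ m hm)) (isSemiHom_galoisTwist hχ σ.symm)
    (galoisTwist_injective hχ σ.symm.toLinearEquiv) hm ?_ fun x => ?_
  · have h := Function.LeftInverse.iterate (f := σ.toLinearEquiv) (g := σ.symm.toLinearEquiv)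
      σ.toLinearEquiv.symm_apply_apply m (n2Mono k Gp 0)
    rw [hσ] at h
    exact (galoisTwist_iterate_one_tmul hχ _ m _).trans (congrArg _ h)
  · rw [← mem_loopSubmodule_iff hχ hm (hξ m hm) (rootChar_one_div hξ hcompat hm) hσ]
    exact ⟨fun h => ⟨⟨x, h⟩, rfl⟩, fun ⟨f, hf⟩ => hf ▸ f.2⟩

include hcompat in
lemma n2G_J_notMem_loopSubmodule_omega :
    n2G k (RatLaurent k) J ∉ loopSubmodule (n2Omega k) 2 two_pos (ξ 2) (hξ 2 two_pos) := fun h => by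
  have hfix := galoisTwist_symm_eq_self_of_mem (isFaithfulModInt_rootChar hξ hcompat) two_pos
    (hξ 2 two_pos) (rootChar_one_div hξ hcompat two_pos) h
  have hω : (n2Omega k).symm.toLinearEquiv (n2Mono k J 0) = -n2Mono k J 0 := n2Omega_J
  rw [galoisTwist, twistMap_n2G, LinearEquiv.coe_coe, hω, TensorProduct.tmul_neg] at hfix
  exact n2G_ne_neg J hfix.symm

include hcompat in
lemma not_isoOverBase_id_omega : ¬ IsoOverBase (n2LoopId hξ) (n2LoopOmega hξ) := by
  rintro ⟨e⟩
  let v (c : N2Gen) : loopSubmodule (ConformalEquiv.refl (n2Conformal k)) 1 one_pos (ξ 1)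
    (hξ 1 one_pos) := ⟨n2G k (RatLaurent k) c, one_tmul_mem_loopSubmodule_refl _ _⟩
  have hprod {n : ℕ} (a b c) (h : (n2LoopId hξ).prod n a b = c) :
      (n2Over (ratLaurentDer k)).prod n (e.toLinearEquiv a).1 (e.toLinearEquiv b).1 =
        (e.toLinearEquiv c).1 :=
    h ▸ congrArg Subtype.val (e.map_prod n a b).symm
  have hzero : (e.toLinearEquiv 0).1 = 0 := congrArg Subtype.val (map_zero e.toLinearEquiv)
  have hJ := eq_J_or_eq_neg_J (δ := ratLaurentDer k) (x := (e.toLinearEquiv (v J)).1)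
    (y := (e.toLinearEquiv (v Gp)).1)
    (e.map_even (v J) (n2G_relations (δ := ratLaurentDer k)).J_even)
    (e.map_odd (v Gp) (n2G_relations (δ := ratLaurentDer k)).Gp_odd)
    (fun h => n2G_ne_zero Gp (congrArg Subtype.val
      ((map_eq_zero_iff _ e.toLinearEquiv.injective).mp (Subtype.ext h))))
    (fun n => (hprod (v J) (v J) 0 (Subtype.ext (n2Over_prod_J_J n))).trans hzero)
    (hprod (v J) (v Gp) (v Gp) (Subtype.ext (n2G_relations.prod_zero J Gp)))
    (fun n => (hprod (v J) (v Gp) 0 (Subtype.ext (n2Over_prod_succ_J_Gp n))).trans hzero)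
  have hmem := (e.toLinearEquiv (v J)).2
  refine n2G_J_notMem_loopSubmodule_omega hξ hcompat ?_
  rcases hJ with ⟨h, -⟩ | ⟨h, -⟩
  · exact h ▸ hmem
  · exact neg_mem_iff.mp (h ▸ hmem)

end Forms

end

theorem theorem4p20_general {k : Type*} [Field k] [CharZero k]
    (ξ : ℕ → k) (hξ : ∀ m, 0 < m → IsPrimitiveRoot (ξ m) m)
    (hcompat : ∀ l m, 0 < l → 0 < m → ξ (l * m) ^ l = ξ m) (hsq : ∀ x : k, IsSquare x) :
    (∀ (m : ℕ) (hm : 0 < m) (σ : ConformalEquiv (n2Conformal k) (n2Conformal k)),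
      (∀ a, σ.toLinearEquiv^[m] a = a) →
        IsoOverBase (twistedLoop σ m hm (ξ m) (hξ m hm))
          (twistedLoop (ConformalEquiv.refl (n2Conformal k)) 1 one_pos (ξ 1) (hξ 1 one_pos)) ∨
        IsoOverBase (twistedLoop σ m hm (ξ m) (hξ m hm))
          (twistedLoop (n2Omega k) 2 two_pos (ξ 2) (hξ 2 two_pos))) ∧
    (¬ IsoOverBase
        (twistedLoop (ConformalEquiv.refl (n2Conformal k)) 1 one_pos (ξ 1) (hξ 1 one_pos))
        (twistedLoop (n2Omega k) 2 two_pos (ξ 2) (hξ 2 two_pos))) ∧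
    (∀ (F : Type*) [AddCommGroup F] [Module k F] [Module (LaurentPolynomial k) F]
        [IsScalarTower k (LaurentPolynomial k) F]
        (SF : ConformalSuperalgebra k (laurentDer k) F),
      IsForm (ratLaurentDer_algebraMap (k := k)) SF
          ((n2Conformal k).baseChange (der_algebraMap_base (laurentDer k))) →
        IsoOver SF
          (twistedLoop (ConformalEquiv.refl (n2Conformal k)) 1 one_pos (ξ 1) (hξ 1 one_pos)) ∨
        IsoOver SF
          (twistedLoop (n2Omega k) 2 two_pos (ξ 2) (hξ 2 two_pos))) :=
  ⟨fun _ hm _ hσ => (twistedLoop_isoOver hξ hcompat hsq hm hσ).imp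
      IsoOver.isoOverBase IsoOver.isoOverBase,
    not_isoOverBase_id_omega hξ hcompat,
    fun _ _ _ _ _ _ hF => isoOver_of_isForm hξ hcompat hsq hF⟩

theorem theorem4p20 {k : Type*} [Field k] [CharZero k] [IsAlgClosed k]
    (ξ : ℕ → k) (hξ : ∀ m, 0 < m → IsPrimitiveRoot (ξ m) m)
    (hcompat : ∀ l m, 0 < l → 0 < m → ξ (l * m) ^ l = ξ m) :
    -- every twisted loop algebra is `k`-isomorphic to `L(A, id)` or to `L(A, ω)`
    (∀ (m : ℕ) (hm : 0 < m) (σ : ConformalEquiv (n2Conformal k) (n2Conformal k)),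
      (∀ a, σ.toLinearEquiv^[m] a = a) →
        IsoOverBase (twistedLoop σ m hm (ξ m) (hξ m hm))
          (twistedLoop (ConformalEquiv.refl (n2Conformal k)) 1 one_pos (ξ 1) (hξ 1 one_pos)) ∨
        IsoOverBase (twistedLoop σ m hm (ξ m) (hξ m hm))
          (twistedLoop (n2Omega k) 2 two_pos (ξ 2) (hξ 2 two_pos))) ∧
    -- `L(A, id)` and `L(A, ω)` are not `k`-isomorphic
    (¬ IsoOverBase
        (twistedLoop (ConformalEquiv.refl (n2Conformal k)) 1 one_pos (ξ 1) (hξ 1 one_pos))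
        (twistedLoop (n2Omega k) 2 two_pos (ξ 2) (hξ 2 two_pos))) ∧
    -- every `Ŝ/R`-form of `A ⊗_k R` is isomorphic, even over `R`, to one of the two
    (∀ (F : Type*) [AddCommGroup F] [Module k F] [Module (LaurentPolynomial k) F]
        [IsScalarTower k (LaurentPolynomial k) F]
        (SF : ConformalSuperalgebra k (laurentDer k) F),
      IsForm (ratLaurentDer_algebraMap (k := k)) SF
          ((n2Conformal k).baseChange (der_algebraMap_base (laurentDer k))) →
        IsoOver SF
          (twistedLoop (ConformalEquiv.refl (n2Conformal k)) 1 one_pos (ξ 1) (hξ 1 one_pos)) ∨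
        IsoOver SF
          (twistedLoop (n2Omega k) 2 two_pos (ξ 2) (hξ 2 two_pos))) :=
  theorem4p20_general ξ hξ hcompat IsAlgClosed.exists_eq_mul_self
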